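/- **Theorem.** Let $N\ge 3$. Let $\mathcal G_N$ be the groupoid with objects $1,\dots,N$ presented by the generators $A_{i,j}^{(k)}$ ($i\ne j$, $k\in\{-1,1\}$), where $A_{i,j}^{(k)}$ has source $i$ and target $j$, and the relations $A_{i,j}^{(k)}A_{j,\ell}^{(k)}=A_{i,\ell}^{(k)}$ for all $i,j,\ell,k$, with the convention $A_{i,i}^{(k)}=e_i$ (the unit at $i$). Let $\mathcal A$ be its set of arrows. A word is a product of generators $A_{i,j}^{(k)}$, $i\neq j$; it is reduced if no two consecutive letters have the same upper index $k$. Each non-unit arrow is represented by exactly one nonempty reduced word. Let $|\cdot|_M:\mathcal A\to[0,\infty)$ be a metric generated by the generators: $|e_i|_M=0$ for all $i$, and if $w$ is represented by the nonempty reduced word $A_{i_1,j_1}^{(k_1)}\cdots A_{i_d,j_d}^{(k_d)}$, then $|w|_M=\sum_{\ell=1}^d |A_{i_\ell,j_\ell}^{(k_\ell)}|_M$. Let $p_{i,j}^{(k)}\in(0,1)$ ($i\ne j$, $k=\pm1$) satisfy $\sum_{j\ne i}\sum_{k=\pm1}p_{i,j}^{(k)}=1$ for every $i$. Consider the Markov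 chains $(W_n)_{n\ge0}$ on $\mathcal A$ with $P(W_{n+1}=y\mid W_n=x)=p_{i,j}^{(k)}$ if $y=xA_{i,j}^{(k)}$, where $i$ is the target of $x$ and $j\neq i$, and $P(W_{n+1}=y\mid W_n=x)=0$ for every other $y$. (a) There is an $\epsilon>0$ for which there is a family of functions $R_{i,j}^{(k)}$ ($i\ne j$, $k=\pm1$) on the disk $D_{1+\epsilon}=\{\lambda\in\mathbb C:|\lambda|<1+\epsilon\}$ such that each $R_{i,j}^{(k)}$ is complex analytic on $D_{1+\epsilon}$, $R_{i,j}^{(k)}(\lambda)\in(0,1)$ for all real $\lambda\in(0,1]$, and for all $\lambda\in D_{1+\epsilon}$ $$R_{i,j}^{(k)}(\lambda)=\lambda\Big[p_{i,j}^{(k)}+\sum_{m\ne i,j}p_{i,m}^{(k)}R_{m,j}^{(k)}(\lambda)+\sum_{m\ne i}p_{i,m}^{(-k)}R_{m,i}^{(-k)}(\lambda)R_{i,j}^{(k)}(\lambda)\Big].$$ For every $\epsilon>0$ there is at most one such family on $D_{1+\epsilon}$. (b) Let $\epsilon>0$ and let $(R_{i,j}^{(k)})$ be such a family on $D_{1+\epsilon}$.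 Let $B(k;\lambda,z)$ be the $N\times N$ matrix with entries $(1-\delta_{i,j})\,z^{|A_{i,j}^{(k)}|_M}R_{i,j}^{(k)}(\lambda)$ (principal branch of the power), and let $h(\lambda,z)=\det[I-B(1;\lambda,z)B(-1;\lambda,z)]$. Then $\partial_\lambda h(1,1)\ne0$; the constants $$\gamma=\frac{\partial_z h(1,1)}{\partial_\lambda h(1,1)},\qquad \sigma^2=\frac{\partial_z^2h(1,1)+\partial_zh(1,1)-2\gamma\,\partial^2_{z,\lambda}h(1,1)+\gamma^2\big(\partial_\lambda^2h(1,1)+\partial_\lambda h(1,1)\big)}{\partial_\lambda h(1,1)}$$ are real with $\sigma^2\ge0$; and for every chain $(W_n)$ as above, with any (possibly random) initial value $W_0$, $$\lim_{n\to\infty}\frac{|W_n|_M}{n}=\gamma\quad\text{almost surely},\qquad \frac{|W_n|_M-\gamma n}{\sqrt n}\to\mathcal N(0,\sigma^2)\quad\text{in law},$$ where $\mathcal N(0,0)$ denotes the point mass at $0$. -/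

import Mathlib

open MeasureTheory ProbabilityTheory Filter Topology
open scoped NNReal ENNReal

noncomputable section

namespace WindowWalk

/-! ### The groupoid `G_N`

The upper index `k ∈ {-1, 1}` is an element of `ℤˣ`, and the windows `1, …, N` are the elements
of `Fin N`. -/

/-- The vertices of the directed multigraph: the `N` windows. -/
structure Window (N : ℕ) : Type where
  /-- the label of the window -/
  idx : Fin N

/-- For `i ≠ j` and `k ∈ {-1, 1}` there is one directed edge `(i, j, k)` from `i` to `j`; there
are no loops. -/
instance (N : ℕ) : Quiver.{0} (Window N) where
  Hom i j := {_k : ℤˣ // i.idx ≠ j.idx}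

/-- The letter `A_{i,j}^{(k)}` in the free groupoid on the edges `(i, j, k)`, `i ≠ j`, with the
convention `A_{i,i}^{(k)} = e_i`. -/
def letter {N : ℕ} (i j : Fin N) (k : ℤˣ) :
    (Quiver.FreeGroupoid.of (Window N)).obj ⟨i⟩ ⟶ (Quiver.FreeGroupoid.of (Window N)).obj ⟨j⟩ :=
  if h : i = j then CategoryTheory.eqToHom (by rw [h])
  else (Quiver.FreeGroupoid.of (Window N)).map (X := ⟨i⟩) (Y := ⟨j⟩) ⟨k, h⟩

/-- The generating relations `A_{i,j}^{(k)} A_{j,l}^{(k)} = A_{i,l}^{(k)}`, for all `i`, `j`, `l`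
(not necessarily distinct) and all `k`. Composition is written in diagrammatic order. -/
inductive relation (N : ℕ) : HomRel (Quiver.FreeGroupoid (Window N))
  | mk (i j l : Fin N) (k : ℤˣ) :
      relation N (CategoryTheory.CategoryStruct.comp (letter i j k) (letter j l k)) (letter i l k)

/-- The groupoid `G_N` presented by the generators `A_{i,j}^{(k)}` and the relations above. (It is
a groupoid by Mathlib's instances on free groupoids and on quotients of groupoids.) -/
abbrev GN (N : ℕ) : Type := CategoryTheory.Quotient (relation N)

/-- The object `i` of `G_N`. -/
abbrev ob {N : ℕ} (i : Fin N) : GN N :=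
  (CategoryTheory.Quotient.functor (relation N)).obj ((Quiver.FreeGroupoid.of (Window N)).obj ⟨i⟩)

/-- The arrow set of `G_N`. -/
structure Arr (N : ℕ) where
  /-- the source of the arrow -/
  source : Fin N
  /-- the target of the arrow -/
  target : Fin N
  /-- the arrow itself, as a morphism of `G_N` -/
  hom : ob source ⟶ ob target

/-- The arrow set is a discrete space. -/
instance (N : ℕ) : MeasurableSpace (Arr N) := ⊤

/-- The unit `e_i`. -/
def unit {N : ℕ} (i : Fin N) : Arr N := ⟨i, i, CategoryTheory.CategoryStruct.id (ob i)⟩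

/-- The image of the letter `A_{i,j}^{(k)}` in `G_N`. -/
def genHom {N : ℕ} (i j : Fin N) (k : ℤˣ) : (ob i : GN N) ⟶ ob j :=
  (CategoryTheory.Quotient.functor (relation N)).map (letter i j k)

/-- The generator `A_{i,j}^{(k)}` as an arrow of `G_N`. -/
def gen {N : ℕ} (i j : Fin N) (k : ℤˣ) : Arr N := ⟨i, j, genHom i j k⟩

/-- The right composition `x A_{i,j}^{(k)}`, where `i` is the target of `x`. -/
def Arr.mulGen {N : ℕ} (x : Arr N) (j : Fin N) (k : ℤˣ) : Arr N :=
  ⟨x.source, j, CategoryTheory.CategoryStruct.comp x.hom (genHom x.target j k)⟩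

/-! ### Words and metrics

A word starting at the window `i` is recorded as the list `[(j₁, k₁), …, (j_d, k_d)]`, which stands
for the product `A_{i,j₁}^{(k₁)} A_{j₁,j₂}^{(k₂)} ⋯ A_{j_{d-1},j_d}^{(k_d)}`. -/

/-- The arrow represented by a word that starts at `i`. -/
def wordArr {N : ℕ} (i : Fin N) (l : List (Fin N × ℤˣ)) : Arr N :=
  l.foldl (fun x s => x.mulGen s.1 s.2) (unit i)

/-- A word starting at `i` is reduced if its letters are generators `A_{i,j}^{(k)}` with `i ≠ j`,
and no two consecutive letters have the same upper index. (Exactly the pairs of consecutive letters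
with the same upper index can be shortened by a generating relation.) -/
def IsReducedWord {N : ℕ} : Fin N → List (Fin N × ℤˣ) → Prop
  | _, [] => True
  | i, (j, k) :: l => i ≠ j ∧ (∀ s ∈ l.head?, s.2 ≠ k) ∧ IsReducedWord j l

/-- The sum of the values of `M` at the letters of a word that starts at `i`. -/
def letterSum {N : ℕ} (M : Arr N → ℝ) : Fin N → List (Fin N × ℤˣ) → ℝ
  | _, [] => 0
  | i, (j, k) :: l => M (gen i j k) + letterSum M j l

/-- `M = |·|_M` is a metric on the arrow set generated by the generators: it is non-negative,
vanishes at the units, and its value at an arrow is the sum of its values at the letters of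
the reduced word that represents the arrow. -/
structure IsGeneratedMetric {N : ℕ} (M : Arr N → ℝ) : Prop where
  nonneg : ∀ x, 0 ≤ M x
  map_unit : ∀ i, M (unit i) = 0
  map_word : ∀ i l, IsReducedWord i l → l ≠ [] → M (wordArr i l) = letterSum M i l

/-! ### The Markov chain -/

/-- Jump probabilities `p_{i,j}^{(k)} ∈ (0, 1)`, `i ≠ j`. The values `p i i k` play no role. -/
structure IsJumpProb {N : ℕ} (p : Fin N → Fin N → ℤˣ → ℝ) : Prop where
  pos : ∀ i j k, i ≠ j → 0 < p i j k
  lt_one : ∀ i j k, i ≠ j → p i j k < 1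
  sum_eq_one : ∀ i, ∑ j ∈ Finset.univ.erase i, ∑ k : ℤˣ, p i j k = 1

open Classical in
/-- The transition probability from `x` to `y`: it is `p_{i,j}^{(k)}` if `i` is the target of `x`,
`i ≠ j` and `y = x A_{i,j}^{(k)}`, and `0` if `y` is not of this form. (Distinct generators are
distinct arrows, so that at most one term of the sum is not `0`.) -/
def transProb {N : ℕ} (p : Fin N → Fin N → ℤˣ → ℝ) (x y : Arr N) : ℝ :=
  ∑ j ∈ Finset.univ.erase x.target, ∑ k : ℤˣ, if y = x.mulGen j k then p x.target j k else 0

/-- `W` is a Markov chain on the arrow set with transition probabilities `transProb p`, with an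
arbitrary (possibly random) initial value `W 0`. -/
structure IsWordChain {N : ℕ} (p : Fin N → Fin N → ℤˣ → ℝ) {Ω : Type*} [MeasurableSpace Ω]
    (P : Measure Ω) (W : ℕ → Ω → Arr N) : Prop where
  measurable : ∀ n, Measurable (W n)
  markov : ∀ (n : ℕ) (w : ℕ → Arr N),
    P {ω | ∀ m ≤ n + 1, W m ω = w m} =
      P {ω | ∀ m ≤ n, W m ω = w m} * ENNReal.ofReal (transProb p (w n) (w (n + 1)))

/-! ### The constants -/

/-- The properties that characterize the family `R_{i,j}^{(k)}`, `i ≠ j`, of functions on the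
disk `|t| < 1 + ε`. The values `R i i k` play no role. -/
structure IsRFamily {N : ℕ} (p : Fin N → Fin N → ℤˣ → ℝ) (ε : ℝ)
    (R : Fin N → Fin N → ℤˣ → ℂ → ℂ) : Prop where
  analytic : ∀ i j k, i ≠ j → AnalyticOnNhd ℂ (R i j k) (Metric.ball 0 (1 + ε))
  mem_Ioo : ∀ i j k, i ≠ j → ∀ t ∈ Set.Ioc (0 : ℝ) 1,
    ∃ r ∈ Set.Ioo (0 : ℝ) 1, R i j k (t : ℂ) = (r : ℂ)
  equation : ∀ i j k, i ≠ j → ∀ t ∈ Metric.ball (0 : ℂ) (1 + ε),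
    R i j k t = t * ((p i j k : ℂ)
      + ∑ m ∈ (Finset.univ.erase i).erase j, (p i m k : ℂ) * R m j k t
      + ∑ m ∈ Finset.univ.erase i, (p i m (-k) : ℂ) * R m i (-k) t * R i j k t)

/-- The matrix `B(k; t, z)`, with entries `(1 - δ_{i,j}) z ^ |A_{i,j}^{(k)}|_M R_{i,j}^{(k)}(t)`.
The power is the principal branch. -/
def matB {N : ℕ} (M : Arr N → ℝ) (R : Fin N → Fin N → ℤˣ → ℂ → ℂ) (k : ℤˣ) (t z : ℂ) :
    Matrix (Fin N) (Fin N) ℂ :=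
  Matrix.of fun i j => if i = j then 0 else z ^ ((M (gen i j k) : ℝ) : ℂ) * R i j k t

/-- `h(t, z) = det (I - B(1; t, z) B(-1; t, z))`. -/
def hFun {N : ℕ} (M : Arr N → ℝ) (R : Fin N → Fin N → ℤˣ → ℂ → ℂ) (t z : ℂ) : ℂ :=
  (1 - matB M R 1 t z * matB M R (-1) t z).det

/-- The first partial derivative at `(1, 1)` in the first variable. -/
def d1 (h : ℂ → ℂ → ℂ) : ℂ := deriv (fun t => h t 1) 1

/-- The first partial derivative at `(1, 1)` in the second variable. -/
def d2 (h : ℂ → ℂ → ℂ) : ℂ := deriv (fun z => h 1 z) 1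

/-- The second partial derivative at `(1, 1)` in the first variable. -/
def d11 (h : ℂ → ℂ → ℂ) : ℂ := iteratedDeriv 2 (fun t => h t 1) 1

/-- The second partial derivative at `(1, 1)` in the second variable. -/
def d22 (h : ℂ → ℂ → ℂ) : ℂ := iteratedDeriv 2 (fun z => h 1 z) 1

/-- The mixed second partial derivative at `(1, 1)`. -/
def d21 (h : ℂ → ℂ → ℂ) : ℂ := deriv (fun z => deriv (fun t => h t z) 1) 1

/-- The constant `γ = ∂_z h(1,1) / ∂_λ h(1,1)`. -/
def gammaOf (h : ℂ → ℂ → ℂ) : ℂ := d2 h / d1 h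

/-- The constant `σ²`. -/
def sigmaSqOf (h : ℂ → ℂ → ℂ) : ℂ :=
  (d22 h + d2 h - 2 * gammaOf h * d21 h + gammaOf h ^ 2 * (d11 h + d1 h)) / d1 h

end WindowWalk

end

/-! Both limit theorems come from perturbing the eigenvalue 1 of the transition operator `stepOp p`.
For small complex θ there is an eigenfunction F_θ with eigenvalue exp(ψ(θ)), where ψ is analytic and
ψ(0) = 0, and F_θ is close to exp(θ|x|_M) with small relative error, uniformly in the arrow x
(`exists_eigenfunctions`). Iterating the operator therefore controls E exp(θ|W_n|_M) by exp(nψ(θ)).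
Taking θ = is/√n gives the central limit theorem through characteristic functions; real θ gives
Chernoff bounds and, with Borel–Cantelli, the law of large numbers. Imaginary θ also shows that
ψ'(0) and ψ''(0) are real and that ψ''(0) ≥ 0.

The eigenfunctions are explicit. Multiplying on the right by letters of upper index k moves inside a
block: a base arrow b with target i and the arrows b A_{i,j}^{(k)}. Probabilistically,
R_{j,i}^{(k)}(λ) is the generating function of the first passage from b A_{i,j}^{(k)} back to b, so
inside one block the equation with eigenvalue 1/λ has an explicit Green function. The blocks can be
glued (`transition_eigenfun`) once there are vectors with σ_k = B(k) σ_{-k}; non-zero ones exist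
exactly when h(λ, z) = 0. The relative error does not grow with the word length because |R| < 1 at λ
= 1 (`norm_eigenfun_sub_le`). Solving h = 0 by λ = exp(-ψ(θ)), z = exp(θ) and differentiating twice
identifies ψ'(0) with γ and ψ''(0) with σ² (`exists_log_implicit`).

Positivity enters twice. First, R must be analytic beyond the unit disk. The constant 1 solves the
system at λ = 1; for N ≥ 3 the linearisation there expands a positive vector
(`exists_expanded_vector`), so there is a supersolution below 1 for some λ > 1, and monotone
iteration from 0 converges (`exists_isRFamily`). Second, ∂_λ h(1,1) ≠ 0 follows from a
Perron–Frobenius argument and R(t) ≤ t R(1) for 0 < t ≤ 1 (`hFun_one_one`). -/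

noncomputable section

namespace WindowWalk

open CategoryTheory

/-! ### Normal forms in the groupoid

A *stack* with source `i₀` is a word that starts at `i₀`, stored as a list with its last letter at
the head. -/

section NormalForm

variable {N : ℕ}

/-- The target of the arrow represented by a stack. -/
def stackTarget (i₀ : Fin N) : List (Fin N × ℤˣ) → Fin N
  | [] => i₀
  | a :: _ => a.1

/-- Remove the last letter of a stack if its upper index is `k`. -/
def strip (k : ℤˣ) : List (Fin N × ℤˣ) → List (Fin N × ℤˣ)
  | [] => []
  | a :: s => if a.2 = k then s else a :: s

/-- Multiply the arrow represented by a reduced stack by the generator with upper index `k` that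
leads to the window `l`. -/
def push (i₀ : Fin N) (s : List (Fin N × ℤˣ)) (l : Fin N) (k : ℤˣ) : List (Fin N × ℤˣ) :=
  if l = stackTarget i₀ (strip k s) then strip k s else (l, k) :: strip k s

/-- Reduced stacks. -/
def IsReducedStack (i₀ : Fin N) : List (Fin N × ℤˣ) → Prop
  | [] => True
  | a :: s => stackTarget i₀ s ≠ a.1 ∧ (∀ b ∈ s.head?, b.2 ≠ a.2) ∧ IsReducedStack i₀ s

theorem strip_eq_self {k : ℤˣ} {s : List (Fin N × ℤˣ)} (h : ∀ b ∈ s.head?, b.2 ≠ k) :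
    strip k s = s := by
  cases s with
  | nil => rfl
  | cons a s => simp only [strip]; rw [if_neg (h a (by simp))]

theorem IsReducedStack.strip {i₀ : Fin N} {s : List (Fin N × ℤˣ)} (hs : IsReducedStack i₀ s)
    (k : ℤˣ) : IsReducedStack i₀ (strip k s) := by
  cases s with
  | nil => exact hs
  | cons a s =>
    simp only [WindowWalk.strip]
    split_ifs
    exacts [hs.2.2, hs]

theorem IsReducedStack.head_strip {i₀ : Fin N} {s : List (Fin N × ℤˣ)}
    (hs : IsReducedStack i₀ s) (k : ℤˣ) : ∀ b ∈ (WindowWalk.strip k s).head?, b.2 ≠ k := by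
  cases s with
  | nil => simp [WindowWalk.strip]
  | cons a s =>
    simp only [WindowWalk.strip]
    split_ifs with h
    · rw [← h]; exact hs.2.1
    · simpa using h

theorem stackTarget_push (i₀ : Fin N) (s : List (Fin N × ℤˣ)) (l : Fin N) (k : ℤˣ) :
    stackTarget i₀ (push i₀ s l k) = l := by
  unfold push
  split_ifs with h
  exacts [h.symm, rfl]

theorem IsReducedStack.push {i₀ : Fin N} {s : List (Fin N × ℤˣ)} (hs : IsReducedStack i₀ s)
    (l : Fin N) (k : ℤˣ) : IsReducedStack i₀ (push i₀ s l k) := by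
  unfold WindowWalk.push
  split_ifs with h
  exacts [hs.strip k, ⟨fun h' => h h'.symm, hs.head_strip k, hs.strip k⟩]

theorem strip_push {i₀ : Fin N} {s : List (Fin N × ℤˣ)} (hs : IsReducedStack i₀ s)
    (l : Fin N) (k : ℤˣ) : strip k (push i₀ s l k) = strip k s := by
  unfold push
  split_ifs with h
  · exact strip_eq_self (hs.head_strip k)
  · simp [strip]

/-- This is the relation A_{i,j}A_{j,l} = A_{i,l} on stacks: a push of index `k` first deletes a
last letter of index `k`, so only the final window matters. -/
theorem push_push {i₀ : Fin N} {s : List (Fin N × ℤˣ)} (hs : IsReducedStack i₀ s)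
    (j l : Fin N) (k : ℤˣ) : push i₀ (push i₀ s j k) l k = push i₀ s l k := by
  rw [push, strip_push hs, ← push]

theorem push_stackTarget {i₀ : Fin N} {s : List (Fin N × ℤˣ)} (hs : IsReducedStack i₀ s)
    (k : ℤˣ) : push i₀ s (stackTarget i₀ s) k = s := by
  cases s with
  | nil => simp [push, strip, stackTarget]
  | cons a s =>
    obtain ⟨j, k'⟩ := a
    by_cases h : k' = k
    · have := hs.1
      simp only [push, strip, h, stackTarget, if_true]
      rw [if_neg (fun h' => this h'.symm)]
    · simp [push, strip, h, stackTarget]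

/-- The reduced stacks with target `i`. -/
def Stack (i : Fin N) : Type :=
  {x : Fin N × List (Fin N × ℤˣ) // IsReducedStack x.1 x.2 ∧ stackTarget x.1 x.2 = i}

/-- The right action of a generator on reduced stacks. -/
def stackEquiv (i j : Fin N) (k : ℤˣ) : Stack i ≃ Stack j where
  toFun x := ⟨(x.1.1, push x.1.1 x.1.2 j k), x.2.1.push j k, stackTarget_push _ _ _ _⟩
  invFun x := ⟨(x.1.1, push x.1.1 x.1.2 i k), x.2.1.push i k, stackTarget_push _ _ _ _⟩
  left_inv := by
    rintro ⟨⟨i₀, s⟩, hs, rfl⟩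
    exact Subtype.ext (Prod.ext rfl ((push_push hs _ _ _).trans (push_stackTarget hs k)))
  right_inv := by
    rintro ⟨⟨i₀, s⟩, hs, rfl⟩
    exact Subtype.ext (Prod.ext rfl ((push_push hs _ _ _).trans (push_stackTarget hs k)))

/-- The windows, as objects of the groupoid whose arrows are the bijections between the sets of
reduced stacks. -/
structure StackOb (N : ℕ) : Type where
  /-- the label of the window -/
  idx : Fin N

instance : Groupoid.{0} (StackOb N) where
  Hom i j := Stack i.idx ≃ Stack j.idx
  id i := Equiv.refl _
  comp f g := f.trans g
  inv f := f.symm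
  inv_comp f := Equiv.symm_trans_self f
  comp_inv f := Equiv.self_trans_symm f

/-- The action of the free groupoid on reduced stacks. -/
def freeAction (N : ℕ) : Quiver.FreeGroupoid (Window N) ⥤ StackOb N :=
  Quiver.FreeGroupoid.lift
    { obj := fun i => ⟨i.idx⟩
      map := fun {i j} e => stackEquiv i.idx j.idx e.1 }

theorem freeAction_map_of {X Y : Window N} (e : X ⟶ Y) :
    (freeAction N).map ((Quiver.FreeGroupoid.of (Window N)).map e) =
      stackEquiv X.idx Y.idx e.1 :=
  rfl

theorem stackEquiv_self (i : Fin N) (k : ℤˣ) : stackEquiv i i k = Equiv.refl _ := by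
  refine Equiv.ext fun ⟨⟨i₀, s⟩, hs, h⟩ => ?_
  subst h
  exact Subtype.ext (Prod.ext rfl (push_stackTarget hs k))

theorem freeAction_map_letter (i j : Fin N) (k : ℤˣ) :
    (freeAction N).map (letter i j k) = stackEquiv i j k := by
  unfold letter
  split_ifs with h
  · subst h
    rw [stackEquiv_self]
    exact (freeAction N).map_id _
  · rw [freeAction_map_of]

/-- The action of the groupoid `G_N` on reduced stacks. -/
def stackAction (N : ℕ) : GN N ⥤ StackOb N :=
  CategoryTheory.Quotient.lift (relation N) (freeAction N) (by
    rintro _ _ _ _ ⟨i, j, l, k⟩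
    rw [Functor.map_comp, freeAction_map_letter, freeAction_map_letter, freeAction_map_letter]
    exact Equiv.ext fun ⟨⟨i₀, s⟩, hs, h⟩ => Subtype.ext (Prod.ext rfl (push_push hs _ _ _)))

theorem stackAction_map_genHom (i j : Fin N) (k : ℤˣ) :
    (stackAction N).map (genHom i j k) = stackEquiv i j k :=
  freeAction_map_letter i j k

/-- The image of the empty stack under an arrow. -/
def Arr.stackAux (x : Arr N) : Stack x.target :=
  Equiv.toFun (α := Stack x.source) (β := Stack x.target) ((stackAction N).map x.hom)
    ⟨(x.source, []), trivial, rfl⟩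

/-- The reduced stack of an arrow. -/
def Arr.stack (x : Arr N) : List (Fin N × ℤˣ) := x.stackAux.1.2

theorem Arr.stackAux_mulGen (x : Arr N) (j : Fin N) (k : ℤˣ) :
    (x.mulGen j k).stackAux = stackEquiv x.target j k x.stackAux := by
  unfold Arr.stackAux Arr.mulGen
  dsimp only
  rw [Functor.map_comp, stackAction_map_genHom]
  rfl

theorem Arr.stackAux_unit (i : Fin N) : (unit i).stackAux = ⟨(i, []), trivial, rfl⟩ := by
  unfold Arr.stackAux unit
  dsimp only
  exact congrArg (fun e : Stack i ≃ Stack i => e ⟨(i, []), trivial, rfl⟩)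
    ((stackAction N).map_id (ob i))

theorem genHom_comp (i j l : Fin N) (k : ℤˣ) :
    genHom i j k ≫ genHom j l k = genHom i l k := by
  unfold genHom
  rw [← Functor.map_comp]
  exact CategoryTheory.Quotient.sound _ (relation.mk i j l k)

theorem genHom_self (i : Fin N) (k : ℤˣ) : genHom i i k = 𝟙 (ob i) := by
  unfold genHom letter
  rw [dif_pos rfl]
  exact (CategoryTheory.Quotient.functor (relation N)).map_id _

theorem Arr.mulGen_mulGen (x : Arr N) (j l : Fin N) (k : ℤˣ) :
    (x.mulGen j k).mulGen l k = x.mulGen l k := by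
  unfold Arr.mulGen
  simp only [Category.assoc, genHom_comp]

theorem Arr.mulGen_target (x : Arr N) (k : ℤˣ) : x.mulGen x.target k = x := by
  unfold Arr.mulGen
  simp only [genHom_self, Category.comp_id]

/-- Every arrow is a product of generators. -/
theorem hom_induction {P : ∀ i j : Fin N, ((ob i : GN N) ⟶ ob j) → Prop}
    (hid : ∀ i, P i i (𝟙 _))
    (hcomp : ∀ i j l k (g : (ob i : GN N) ⟶ ob j), P i j g → P i l (g ≫ genHom j l k))
    (i j : Fin N) (g : (ob i : GN N) ⟶ ob j) : P i j g := by
  obtain ⟨f⟩ := g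
  obtain ⟨q⟩ := f
  have key : ∀ (b : Window N) (q : @Quiver.Path (Quiver.Symmetrify (Window N))
      (Quiver.symmetrifyQuiver (Window N)) (⟨i⟩ : Window N) b),
      P i b.idx (Quot.mk _ (Quot.mk _ q)) := by
    intro b q
    induction q with
    | nil => exact hid i
    | @cons b c q e ih =>
      have hrw : ∀ k, (Quot.mk _ (Quot.mk _ (@Quiver.Hom.toPath (Quiver.Symmetrify (Window N))
          (Quiver.symmetrifyQuiver (Window N)) _ _ e)) :
            (ob (Window.idx b) : GN N) ⟶ ob (Window.idx c)) =
            genHom (Window.idx b) (Window.idx c) k →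
          P i (Window.idx c) (Quot.mk _ (Quot.mk _ (@Quiver.Path.cons (Quiver.Symmetrify (Window N))
            (Quiver.symmetrifyQuiver (Window N)) _ _ _ q e))) := by
        intro k hk
        have := hcomp i (Window.idx b) (Window.idx c) k _ ih
        rw [← hk] at this
        exact this
      rcases (e : {_k : ℤˣ // Window.idx b ≠ Window.idx c} ⊕
        {_k : ℤˣ // Window.idx c ≠ Window.idx b}) with ⟨k, h⟩ | ⟨k, h⟩
      · refine hrw k ?_
        unfold genHom letter
        rw [dif_neg h]
        rfl
      · refine hrw k ?_
        -- The formal inverse of A_{c,b}^{(k)} is A_{b,c}^{(k)}, since the two compose to a unit;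
        -- inverse edges therefore need no new letters.
        have h1 : genHom (Window.idx c) (Window.idx b) k ≫ genHom (Window.idx b) (Window.idx c) k =
            𝟙 _ := by
          rw [genHom_comp, genHom_self]
        have h2 : ∀ g' : (ob (Window.idx b) : GN N) ⟶ ob (Window.idx c),
            genHom (Window.idx c) (Window.idx b) k ≫ g' = 𝟙 _ →
              g' = genHom (Window.idx b) (Window.idx c) k := by
          intro g' hg'
          rw [← cancel_epi (genHom (Window.idx c) (Window.idx b) k), h1, hg']
        refine h2 _ ?_
        unfold genHom letter
        rw [dif_neg h]
        exact Groupoid.comp_inv ((CategoryTheory.Quotient.functor (relation N)).map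
          ((Quiver.FreeGroupoid.of (Window N)).map (X := c) (Y := b) ⟨k, h⟩))
  exact key _ q

theorem Arr.induction {P : Arr N → Prop} (hunit : ∀ i, P (unit i))
    (hmul : ∀ x l k, P x → P (x.mulGen l k)) (x : Arr N) : P x := by
  obtain ⟨i, j, g⟩ := x
  exact hom_induction (P := fun i j g => P ⟨i, j, g⟩) hunit
    (fun i j l k g h => hmul ⟨i, j, g⟩ l k h) i j g

theorem Arr.stackAux_source (x : Arr N) : x.stackAux.1.1 = x.source := by
  induction x using Arr.induction with
  | hunit i => rw [Arr.stackAux_unit]; rfl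
  | hmul x l k ih => rw [Arr.stackAux_mulGen]; exact ih

theorem Arr.isReducedStack (x : Arr N) : IsReducedStack x.source x.stack := by
  rw [← x.stackAux_source]; exact x.stackAux.2.1

theorem Arr.stackTarget_stack (x : Arr N) : stackTarget x.source x.stack = x.target := by
  rw [← x.stackAux_source]; exact x.stackAux.2.2

theorem Arr.stack_unit (i : Fin N) : (unit i).stack = [] := by
  unfold Arr.stack; rw [Arr.stackAux_unit]

theorem Arr.stack_mulGen (x : Arr N) (l : Fin N) (k : ℤˣ) :
    (x.mulGen l k).stack = push x.source x.stack l k := by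
  rw [← x.stackAux_source]
  unfold Arr.stack; rw [Arr.stackAux_mulGen]; rfl

/-- The arrow represented by a stack. -/
def stackArr (i₀ : Fin N) : List (Fin N × ℤˣ) → Arr N
  | [] => unit i₀
  | a :: s => (stackArr i₀ s).mulGen a.1 a.2

theorem stackArr_target (i₀ : Fin N) (s : List (Fin N × ℤˣ)) :
    (stackArr i₀ s).target = stackTarget i₀ s := by
  cases s <;> rfl

theorem stackArr_push (i₀ : Fin N) (s : List (Fin N × ℤˣ)) (l : Fin N) (k : ℤˣ) :
    stackArr i₀ (push i₀ s l k) = (stackArr i₀ s).mulGen l k := by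
  have h : (stackArr i₀ (strip k s)).mulGen l k = (stackArr i₀ s).mulGen l k := by
    cases s with
    | nil => rfl
    | cons a s =>
      simp only [strip]
      split_ifs with h
      · subst h; exact (Arr.mulGen_mulGen _ _ _ _).symm
      · rfl
  unfold push
  split_ifs with hl
  · rw [← h, hl, ← stackArr_target, Arr.mulGen_target]
  · exact h

/-- The image of the empty stack under an arrow, together with the source, determines the arrow.
Countability of the arrow set and the value of the metric are read off from this code. -/
theorem Arr.stackArr_stack (x : Arr N) : stackArr x.source x.stack = x := by
  induction x using Arr.induction with
  | hunit i => rw [Arr.stack_unit]; rfl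
  | hmul x l k ih => rw [Arr.stack_mulGen]; exact (stackArr_push _ _ _ _).trans (congrArg (·.mulGen l k) ih)

instance : Countable (Arr N) := by
  have : Function.Injective (fun x : Arr N => (x.source, x.stack)) := by
    intro x y h
    simp only [Prod.mk.injEq] at h
    rw [← x.stackArr_stack, ← y.stackArr_stack, h.1, h.2]
  exact this.countable

theorem stackArr_eq_wordArr (i₀ : Fin N) (s : List (Fin N × ℤˣ)) :
    stackArr i₀ s = wordArr i₀ s.reverse := by
  unfold wordArr
  rw [List.foldl_reverse]
  induction s with
  | nil => rfl
  | cons a s ih => rw [stackArr, ih]; rfl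

/-- The sum of the values of `M` at the letters of a stack. -/
def stackSum (M : Arr N → ℝ) (i₀ : Fin N) : List (Fin N × ℤˣ) → ℝ
  | [] => 0
  | a :: s => stackSum M i₀ s + M (gen (stackTarget i₀ s) a.1 a.2)

theorem letterSum_append (M : Arr N → ℝ) (i : Fin N) (l : List (Fin N × ℤˣ)) (a : Fin N × ℤˣ) :
    letterSum M i (l ++ [a]) =
      letterSum M i l + M (gen (stackTarget i l.reverse) a.1 a.2) := by
  induction l generalizing i with
  | nil => simp [letterSum, stackTarget]
  | cons b l ih =>
    have : stackTarget i (b :: l).reverse = stackTarget b.1 l.reverse := by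
      rw [List.reverse_cons]
      rcases l.reverse with _ | ⟨c, t⟩ <;> rfl
    rw [this, List.cons_append]
    simp only [letterSum]
    rw [ih, add_assoc]

theorem stackSum_eq_letterSum (M : Arr N → ℝ) (i₀ : Fin N) (s : List (Fin N × ℤˣ)) :
    stackSum M i₀ s = letterSum M i₀ s.reverse := by
  induction s with
  | nil => rfl
  | cons a s ih => rw [List.reverse_cons, letterSum_append, List.reverse_reverse, ← ih]; rfl

theorem isReducedWord_append {i : Fin N} {l : List (Fin N × ℤˣ)} {a : Fin N × ℤˣ}
    (hl : IsReducedWord i l) (ha : stackTarget i l.reverse ≠ a.1)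
    (hk : ∀ b ∈ l.reverse.head?, b.2 ≠ a.2) : IsReducedWord i (l ++ [a]) := by
  induction l generalizing i with
  | nil => simpa [IsReducedWord, stackTarget] using ha
  | cons b l ih =>
    have h1 : stackTarget i (b :: l).reverse = stackTarget b.1 l.reverse := by
      rw [List.reverse_cons]
      rcases l.reverse with _ | ⟨c, t⟩ <;> rfl
    rw [h1] at ha
    refine ⟨hl.1, ?_, ih hl.2.2 ha ?_⟩
    · cases l with
      | nil =>
        have := hk b (by simp)
        simpa using this.symm
      | cons c l => simpa using hl.2.1
    · intro c hc
      refine hk c ?_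
      rw [List.reverse_cons, List.head?_append, hc]
      rfl

theorem IsReducedStack.isReducedWord {i₀ : Fin N} {s : List (Fin N × ℤˣ)}
    (hs : IsReducedStack i₀ s) : IsReducedWord i₀ s.reverse := by
  induction s with
  | nil => trivial
  | cons a s ih =>
    rw [List.reverse_cons]
    exact isReducedWord_append (ih hs.2.2) (by rw [List.reverse_reverse]; exact hs.1)
      (by rw [List.reverse_reverse]; exact hs.2.1)

theorem IsGeneratedMetric.eq_stackSum {M : Arr N → ℝ} (hM : IsGeneratedMetric M) (x : Arr N) :
    M x = stackSum M x.source x.stack := by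
  rw [stackSum_eq_letterSum]
  conv_lhs => rw [← x.stackArr_stack, stackArr_eq_wordArr]
  by_cases h : x.stack = []
  · rw [h]; exact hM.map_unit _
  · exact hM.map_word _ _ x.isReducedStack.isReducedWord (by simpa using h)

end NormalForm

end WindowWalk

end

noncomputable section

namespace WindowWalk

theorem sum_units_int {α : Type*} [AddCommMonoid α] (f : ℤˣ → α) (k : ℤˣ) :
    ∑ e : ℤˣ, f e = f k + f (-k) := by
  have h : (Finset.univ : Finset ℤˣ) = {1, -1} := by decide
  rw [h, Finset.sum_pair (by decide)]
  rcases Int.units_eq_one_or k with rfl | rfl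
  · rfl
  · rw [neg_neg, add_comm]

/-! ### Rates on a finite set -/

section Rates

variable {ι : Type*} [Fintype ι] [DecidableEq ι]

/-- Positive rates on a finite set have a positive invariant measure. -/
theorem exists_invariant_measure [Nonempty ι] {q : ι → ι → ℝ} (hq : ∀ i j, i ≠ j → 0 < q i j) :
    ∃ π : ι → ℝ, (∀ i, 0 < π i) ∧
      ∀ j, ∑ i ∈ Finset.univ.erase j, π i * q i j = π j * ∑ m ∈ Finset.univ.erase j, q j m := by
  classical
  let L : Matrix ι ι ℝ := Matrix.of fun i j =>
    if i = j then -∑ m ∈ Finset.univ.erase j, q j m else q i j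
  have hL1 : ∃ v, v ≠ 0 ∧ L.mulVec v = 0 := by
    refine ⟨fun _ => 1, fun h => ?_, ?_⟩
    · obtain ⟨i⟩ := ‹Nonempty ι›
      simpa using congrFun h i
    · ext i
      simp only [Matrix.mulVec, dotProduct, L, Matrix.of_apply, mul_one, Pi.zero_apply]
      rw [← Finset.add_sum_erase _ _ (Finset.mem_univ i), if_pos rfl,
        Finset.sum_congr rfl (g := fun m => q i m)
          (fun m hm => if_neg (Finset.ne_of_mem_erase hm).symm), neg_add_cancel]
  -- The rate matrix annihilates constants, so it is singular and has a left null vector, of unknown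
  -- signs at first.
  obtain ⟨u, hu0, hu⟩ := Matrix.exists_vecMul_eq_zero_iff.mpr
    (Matrix.exists_mulVec_eq_zero_iff.mp hL1)
  have hu' : ∀ j, ∑ i ∈ Finset.univ.erase j, u i * q i j
      = u j * ∑ m ∈ Finset.univ.erase j, q j m := by
    intro j
    have := congrFun hu j
    simp only [Matrix.vecMul, dotProduct, L, Matrix.of_apply, Pi.zero_apply] at this
    rw [← Finset.add_sum_erase _ _ (Finset.mem_univ j), if_pos rfl] at this
    have h2 : ∀ m ∈ Finset.univ.erase j, (u m * if m = j then
        -∑ m ∈ Finset.univ.erase j, q j m else q m j) = u m * q m j := fun m hm => by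
      rw [if_neg (Finset.ne_of_mem_erase hm)]
    rw [Finset.sum_congr rfl h2] at this
    linarith
  have hQ : ∀ j, 0 ≤ ∑ m ∈ Finset.univ.erase j, q j m := fun j =>
    Finset.sum_nonneg fun m hm => (hq _ _ (Finset.ne_of_mem_erase hm).symm).le
  -- These triangle inequalities have equal sums over `j`, so each is an equality and |u| is
  -- invariant as well.
  have hle : ∀ j ∈ Finset.univ, |u j| * ∑ m ∈ Finset.univ.erase j, q j m
      ≤ ∑ i ∈ Finset.univ.erase j, |u i| * q i j := by
    intro j _
    rw [← abs_of_nonneg (hQ j), ← abs_mul, ← hu' j]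
    refine (Finset.abs_sum_le_sum_abs _ _).trans (Finset.sum_le_sum fun i hi => ?_)
    rw [abs_mul, abs_of_pos (hq _ _ (Finset.ne_of_mem_erase hi))]
  have hsum : ∑ j, |u j| * ∑ m ∈ Finset.univ.erase j, q j m
      = ∑ j, ∑ i ∈ Finset.univ.erase j, |u i| * q i j := by
    simp_rw [Finset.mul_sum]
    refine Finset.sum_comm' fun x y => ?_
    simp only [Finset.mem_univ, Finset.mem_erase, and_true, true_and]
    exact ne_comm
  have heq := (Finset.sum_eq_sum_iff_of_le hle).mp hsum
  refine ⟨fun i => |u i|, fun j => ?_, fun j => (heq j (Finset.mem_univ j)).symm⟩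
  rw [abs_pos]
  intro hj
  have h0 := heq j (Finset.mem_univ j)
  rw [hj, abs_zero, zero_mul, eq_comm, Finset.sum_eq_zero_iff_of_nonneg (fun i hi =>
    mul_nonneg (abs_nonneg _) (hq _ _ (Finset.ne_of_mem_erase hi)).le)] at h0
  refine hu0 (funext fun i => ?_)
  by_cases hij : i = j
  · rw [hij, hj]; rfl
  · have := h0 i (Finset.mem_erase.mpr ⟨hij, Finset.mem_univ _⟩)
    rcases mul_eq_zero.mp this with h | h
    · exact abs_eq_zero.mp h
    · exact absurd h (hq _ _ hij).ne'

/-- The expected cost until `j` is hit, and Kac's formula for the cost of a cycle at `j`. -/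
theorem exists_hitting_cost {q : ι → ι → ℝ} (hq : ∀ i j, i ≠ j → 0 < q i j) {c : ι → ℝ}
    (hc : ∀ i, 0 < c i) {π : ι → ℝ}
    (hπ : ∀ j, ∑ i ∈ Finset.univ.erase j, π i * q i j = π j * ∑ m ∈ Finset.univ.erase j, q j m)
    (j : ι) :
    ∃ f : ι → ℝ, f j = 0 ∧ (∀ i, i ≠ j → 0 < f i) ∧
      (∀ i, i ≠ j → ∑ m ∈ Finset.univ.erase i, q i m * (f m - f i) = -c i) ∧
      π j * ∑ m ∈ Finset.univ.erase j, q j m * f m = ∑ i ∈ Finset.univ.erase j, π i * c i := by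
  classical
  let A : Matrix ι ι ℝ := Matrix.of fun i m =>
    if i = j then (if m = j then 1 else 0)
    else if m = i then ∑ m ∈ Finset.univ.erase i, q i m else if m = j then 0 else -q i m
  -- A row `i ≠ j` omits the rate to `j`, which makes it strictly diagonally dominant.
  have hA : A.det ≠ 0 := by
    refine det_ne_zero_of_sum_row_lt_diag fun i => ?_
    by_cases hi : i = j
    · subst hi
      rw [Finset.sum_eq_zero]
      · simp [A]
      · intro m hm
        simp [A, Finset.ne_of_mem_erase hm]
    · have hQ : 0 ≤ ∑ m ∈ Finset.univ.erase i, q i m :=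
        Finset.sum_nonneg fun m hm => (hq _ _ (Finset.ne_of_mem_erase hm).symm).le
      simp only [A, Matrix.of_apply, if_neg hi, if_true, Real.norm_eq_abs, abs_of_nonneg hQ]
      refine Finset.sum_lt_sum (fun m hm => ?_) ⟨j, ?_, ?_⟩
      · have hm' := Finset.ne_of_mem_erase hm
        rw [if_neg hm']
        split_ifs
        · rw [abs_zero]; exact (hq _ _ hm'.symm).le
        · rw [abs_neg, abs_of_pos (hq _ _ hm'.symm)]
      · exact Finset.mem_erase.mpr ⟨fun h => hi h.symm, Finset.mem_univ _⟩
      · rw [if_neg (fun h => hi h.symm), if_pos rfl, abs_zero]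
        exact hq _ _ hi
  let f : ι → ℝ := A⁻¹.mulVec fun i => if i = j then 0 else c i
  have hf : A.mulVec f = fun i => if i = j then 0 else c i := by
    rw [Matrix.mulVec_mulVec, Matrix.mul_nonsing_inv _ hA.isUnit, Matrix.one_mulVec]
  have hfj : f j = 0 := by
    have := congrFun hf j
    simpa [Matrix.mulVec, dotProduct, A] using this
  have hfi : ∀ i, i ≠ j → ∑ m ∈ Finset.univ.erase i, q i m * (f m - f i) = -c i := by
    intro i hi
    have := congrFun hf i
    simp only [Matrix.mulVec, dotProduct, A, Matrix.of_apply, if_neg hi] at this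
    rw [← Finset.add_sum_erase _ _ (Finset.mem_univ i), if_pos rfl] at this
    have h2 : ∀ m ∈ Finset.univ.erase i, (if m = i then ∑ m ∈ Finset.univ.erase i, q i m
        else if m = j then 0 else -q i m) * f m = -(q i m * f m) := by
      intro m hm
      rw [if_neg (Finset.ne_of_mem_erase hm)]
      split_ifs with h
      · rw [h, hfj]; ring
      · ring
    rw [Finset.sum_congr rfl h2, Finset.sum_neg_distrib] at this
    simp_rw [mul_sub]
    rw [Finset.sum_sub_distrib, ← Finset.sum_mul]
    linarith
  -- Minimum principle: at a minimiser other than `j` the generator would be non-negative, against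
  -- the value `-c i`.
  have hmin : ∀ i, (∀ m, f i ≤ f m) → i = j := by
    intro i hi
    by_contra hij
    have h1 := hfi i hij
    have h2 : 0 ≤ ∑ m ∈ Finset.univ.erase i, q i m * (f m - f i) :=
      Finset.sum_nonneg fun m hm => mul_nonneg (hq _ _ (Finset.ne_of_mem_erase hm).symm).le
        (sub_nonneg.mpr (hi m))
    linarith [hc i]
  obtain ⟨i₀, hi₀⟩ : ∃ i₀, ∀ m, f i₀ ≤ f m := by
    have : Nonempty ι := ⟨j⟩
    exact Finite.exists_min f
  have hj0 : ∀ m, f j ≤ f m := by rw [← hmin i₀ hi₀]; exact hi₀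
  refine ⟨f, hfj, fun i hi => ?_, hfi, ?_⟩
  · rcases (hj0 i).lt_or_eq with h | h
    · rwa [hfj] at h
    · exact absurd (hmin i fun m => h ▸ hj0 m) hi
  -- Invariance makes the generator integrate to zero against `π`; isolating the term at `j` is
  -- Kac's formula.
  · have htot : ∑ i, π i * ∑ m ∈ Finset.univ.erase i, q i m * (f m - f i) = 0 := by
      have h1 : ∑ i, π i * ∑ m ∈ Finset.univ.erase i, q i m * f m
          = ∑ m, ∑ i ∈ Finset.univ.erase m, π i * q i m * f m := by
        simp_rw [Finset.mul_sum, ← mul_assoc]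
        refine Finset.sum_comm' fun x y => ?_
        simp only [Finset.mem_univ, Finset.mem_erase, and_true, true_and]
        exact ne_comm
      simp_rw [mul_sub, Finset.sum_sub_distrib, mul_sub, Finset.sum_sub_distrib]
      rw [h1, sub_eq_zero]
      refine Finset.sum_congr rfl fun m _ => ?_
      rw [← Finset.sum_mul, hπ, ← Finset.sum_mul, mul_assoc]
    rw [← Finset.add_sum_erase _ _ (Finset.mem_univ j), hfj] at htot
    simp only [sub_zero] at htot
    have h2 : ∀ i ∈ Finset.univ.erase j,
        π i * ∑ m ∈ Finset.univ.erase i, q i m * (f m - f i) = -(π i * c i) := by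
      intro i hi
      rw [hfi i (Finset.ne_of_mem_erase hi)]; ring
    rw [Finset.sum_congr rfl h2, Finset.sum_neg_distrib] at htot
    linarith

/-- A pair of positive vectors that is increased by the off-diagonal all-ones matrix, conjugated by
a diagonal matrix. -/
theorem exists_subinvariant_pair (h3 : 3 ≤ Fintype.card ι) {w : ι → ℝ} (hw : ∀ i, 0 < w i) :
    ∃ x y : ι → ℝ, (∀ i, 0 < x i) ∧ (∀ i, 0 < y i) ∧
      (∀ i, x i < ∑ m ∈ Finset.univ.erase i, y m) ∧
      ∀ i, y i * w i < ∑ m ∈ Finset.univ.erase i, w m * x m := by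
  have : Nonempty ι := Fintype.card_pos_iff.mp (by omega)
  -- The index `a` of largest weight is treated apart, and `η` is chosen so that `y a * w a` is the
  -- sum of the other weights. For `i ≠ a` a third index is needed; with two indices the four
  -- inequalities contradict each other.
  obtain ⟨a, ha⟩ := Finite.exists_max w
  have hcard : ∀ i, 2 ≤ (Finset.univ.erase i : Finset ι).card := by
    intro i; rw [Finset.card_erase_of_mem (Finset.mem_univ i), Finset.card_univ]; omega
  set S := ∑ m ∈ Finset.univ.erase a, w m with hS
  have hSpos : 0 < S := Finset.sum_pos (fun m _ => hw m)
    (Finset.card_pos.mp (by have := hcard a; omega))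
  set η := S / w a with hη
  have hηpos : 0 < η := div_pos hSpos (hw a)
  have hηw : η * w a = S := div_mul_cancel₀ _ (hw a).ne'
  have hy : ∀ i, 0 < if i = a then η else (1 : ℝ) := by
    intro i; split_ifs; exacts [hηpos, one_pos]
  have hx : ∀ i, 0 < if i = a then (3 / 2 : ℝ) else 1 + η / 2 := by
    intro i; split_ifs <;> positivity
  refine ⟨_, _, hx, hy, fun i => ?_, fun i => ?_⟩
  · by_cases hi : i = a
    · subst hi
      rw [if_pos rfl, Finset.sum_congr rfl (g := fun _ => (1 : ℝ))
        (fun m hm => if_neg (Finset.ne_of_mem_erase hm)), Finset.sum_const, nsmul_eq_mul, mul_one]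
      have : (2 : ℝ) ≤ ((Finset.univ.erase i : Finset ι).card : ℝ) := by exact_mod_cast hcard i
      linarith
    · rw [if_neg hi]
      have hai : a ∈ Finset.univ.erase i :=
        Finset.mem_erase.mpr ⟨fun h => hi h.symm, Finset.mem_univ _⟩
      rw [← Finset.add_sum_erase _ _ hai, if_pos rfl]
      obtain ⟨b, hb⟩ : ((Finset.univ.erase i).erase a : Finset ι).Nonempty := by
        rw [← Finset.card_pos, Finset.card_erase_of_mem hai]
        have := hcard i; omega
      have h1 := Finset.single_le_sum (f := fun m => if m = a then η else (1 : ℝ))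
        (fun m _ => (hy m).le) hb
      rw [if_neg (Finset.ne_of_mem_erase hb)] at h1
      linarith
  · by_cases hi : i = a
    · subst hi
      rw [if_pos rfl, hηw, Finset.sum_congr rfl (g := fun m => w m * (1 + η / 2))
        (fun m hm => by rw [if_neg (Finset.ne_of_mem_erase hm)]), ← Finset.sum_mul]
      nlinarith
    · rw [if_neg hi, one_mul]
      have hai : a ∈ Finset.univ.erase i :=
        Finset.mem_erase.mpr ⟨fun h => hi h.symm, Finset.mem_univ _⟩
      have h1 := Finset.single_le_sum
        (f := fun m => w m * if m = a then (3 / 2 : ℝ) else 1 + η / 2)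
        (fun m _ => (mul_pos (hw m) (hx m)).le) hai
      rw [if_pos rfl] at h1
      linarith [ha i, hw a]

end Rates

/-! ### The system of equations for the functions `R` -/

section System

variable {N : ℕ}

/-- The right-hand side of the system of equations for the functions `R`, with `t = 1`. -/
def rPoly {𝕜 : Type*} [CommRing 𝕜] (q x : Fin N → Fin N → ℤˣ → 𝕜) (i j : Fin N) (k : ℤˣ) : 𝕜 :=
  q i j k + ∑ m ∈ (Finset.univ.erase i).erase j, q i m k * x m j k
    + ∑ m ∈ Finset.univ.erase i, q i m (-k) * x m i (-k) * x i j k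

/-- The linearisation of the system at the solution `1` expands a positive vector. -/
theorem exists_expanded_vector (hN : 3 ≤ N) {p : Fin N → Fin N → ℤˣ → ℝ} (hp : IsJumpProb p) :
    ∃ v : Fin N → Fin N → ℤˣ → ℝ, (∀ i j k, i ≠ j → 0 < v i j k) ∧ ∀ i j k, i ≠ j →
      v i j k < ∑ m ∈ (Finset.univ.erase i).erase j, p i m k * v m j k
        + ∑ m ∈ Finset.univ.erase i, p i m (-k) * (v m i (-k) + v i j k) := by
  have : Nonempty (Fin N) := ⟨⟨0, by omega⟩⟩
  choose π hπ0 hπ using fun k : ℤˣ => exists_invariant_measure (q := fun i j => p i j k)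
    (fun i j h => hp.pos i j k h)
  obtain ⟨x, y, hx, hy, hxy, hyx⟩ := exists_subinvariant_pair (ι := Fin N)
    (by simpa using hN) (w := fun i => π 1 i / π (-1) i) (fun i => div_pos (hπ0 _ _) (hπ0 _ _))
  -- The condition on running costs to which Kac's formula will reduce the claim. After
  -- multiplication of the costs by `π (-1)` it is the pair of inequalities for `x` and `y` with `w
  -- = π 1 / π (-1)`.
  have hc : ∃ c : ℤˣ → Fin N → ℝ, (∀ k i, 0 < c k i) ∧
      ∀ k i, c k i * π (-k) i < ∑ m ∈ Finset.univ.erase i, π (-k) m * c (-k) m := by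
    refine ⟨fun k i => if k = 1 then x i / π (-1) i else y i / π (-1) i, fun k i => ?_,
      fun k i => ?_⟩
    · dsimp only
      split_ifs
      exacts [div_pos (hx i) (hπ0 _ _), div_pos (hy i) (hπ0 _ _)]
    · have hne : (-1 : ℤˣ) ≠ 1 := by decide
      rcases Int.units_eq_one_or k with rfl | rfl
      · simp only [if_true, if_neg hne]
        rw [div_mul_cancel₀ _ (hπ0 _ _).ne']
        refine (hxy i).trans_eq (Finset.sum_congr rfl fun m _ => ?_)
        rw [mul_div_cancel₀ _ (hπ0 _ _).ne']
      · simp only [neg_neg, if_true, if_neg hne]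
        calc y i / π (-1) i * π 1 i = y i * (π 1 i / π (-1) i) := by ring
          _ < _ := hyx i
          _ = _ := Finset.sum_congr rfl fun m _ => by ring
  obtain ⟨c, hc0, hc⟩ := hc
  choose f hfj hf0 hfi hK using fun k j =>
    exists_hitting_cost (q := fun i j => p i j k) (fun i j h => hp.pos i j k h) (hc0 k) (hπ k) j
  -- `v i j k` is the expected cost of reaching `j` from `i` using index `k` only. Steps of index
  -- `k` lose exactly `c k i`; the cost of an excursion of index `-k` from `i` must gain more, which
  -- is `h2`.
  refine ⟨fun i j k => f k j i, fun i j k h => hf0 k j i h, fun i j k h => ?_⟩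
  have h1 := hfi k j i h
  have h2 : c k i < ∑ m ∈ Finset.univ.erase i, p i m (-k) * f (-k) i m := by
    have := hc k i
    rw [← hK (-k) i, mul_comm] at this
    exact lt_of_mul_lt_mul_left this (hπ0 _ _).le
  have h3 := hp.sum_eq_one i
  simp_rw [sum_units_int _ k] at h3
  rw [Finset.sum_add_distrib] at h3
  have h4 : ∑ m ∈ (Finset.univ.erase i).erase j, p i m k * f k j m
      = ∑ m ∈ Finset.univ.erase i, p i m k * f k j m := by
    refine Finset.sum_erase _ ?_
    rw [hfj, mul_zero]
  simp_rw [mul_sub, mul_add] at h1 ⊢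
  rw [Finset.sum_sub_distrib, ← Finset.sum_mul] at h1
  rw [h4, Finset.sum_add_distrib, ← Finset.sum_mul]
  have h5 : ∑ m ∈ Finset.univ.erase i, p i m (-k) = 1 - ∑ m ∈ Finset.univ.erase i, p i m k := by
    linarith
  rw [h5]
  linarith

/-- A strict supersolution of the system, with a parameter larger than `1`. -/
theorem exists_supersolution (hN : 3 ≤ N) {p : Fin N → Fin N → ℤˣ → ℝ} (hp : IsJumpProb p) :
    ∃ t₀ : ℝ, 1 < t₀ ∧ ∃ r : Fin N → Fin N → ℤˣ → ℝ, (∀ i j k, i ≠ j → r i j k ∈ Set.Ioo 0 1) ∧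
      ∀ i j k, i ≠ j → t₀ * rPoly p r i j k ≤ r i j k := by
  obtain ⟨v, hv0, hv⟩ := exists_expanded_vector hN hp
  -- The constant 1 solves the system at parameter 1. Moving to `1 - δ v` gains `δ (a - v)` at first
  -- order and loses only `δ² b`; the strict inequality then leaves room for a parameter above 1.
  have h1 : ∀ i j k, i ≠ j → ∀ᶠ δ : ℝ in 𝓝[>] 0, (1 - δ * v i j k ∈ Set.Ioo 0 1) ∧
      rPoly p (fun i j k => 1 - δ * v i j k) i j k < 1 - δ * v i j k := by
    intro i j k hij
    have e1 : ∀ᶠ δ : ℝ in 𝓝[>] 0, 0 < 1 - δ * v i j k := by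
      refine (Continuous.tendsto' (f := fun δ : ℝ => 1 - δ * v i j k) (by fun_prop) 0 1
        (by simp)).mono_left nhdsWithin_le_nhds |>.eventually (lt_mem_nhds one_pos)
    set a := ∑ m ∈ (Finset.univ.erase i).erase j, p i m k * v m j k
        + ∑ m ∈ Finset.univ.erase i, p i m (-k) * (v m i (-k) + v i j k) with ha
    set b := ∑ m ∈ Finset.univ.erase i, p i m (-k) * v m i (-k) * v i j k with hb
    have e2 : ∀ᶠ δ : ℝ in 𝓝[>] 0, δ * b < a - v i j k := by
      refine (Continuous.tendsto' (f := fun δ : ℝ => δ * b) (by fun_prop) 0 0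
        (by simp)).mono_left nhdsWithin_le_nhds |>.eventually
        (gt_mem_nhds (sub_pos.mpr (hv i j k hij)))
    filter_upwards [e1, e2, self_mem_nhdsWithin] with δ e1 e2 (hδ : 0 < δ)
    refine ⟨⟨e1, by nlinarith [hv0 i j k hij, mul_pos hδ (hv0 i j k hij)]⟩, ?_⟩
    have key : rPoly p (fun i j k => 1 - δ * v i j k) i j k = 1 - δ * a + δ ^ 2 * b := by
      have h3 := hp.sum_eq_one i
      simp_rw [sum_units_int _ k] at h3
      rw [Finset.sum_add_distrib, ← Finset.add_sum_erase _ (fun m => p i m k) (a := j)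
        (Finset.mem_erase.mpr ⟨hij.symm, Finset.mem_univ _⟩)] at h3
      have e3 : ∑ m ∈ (Finset.univ.erase i).erase j, p i m k * (1 - δ * v m j k)
          = ∑ m ∈ (Finset.univ.erase i).erase j, p i m k
            - δ * ∑ m ∈ (Finset.univ.erase i).erase j, p i m k * v m j k := by
        rw [Finset.mul_sum, ← Finset.sum_sub_distrib]
        exact Finset.sum_congr rfl fun m _ => by ring
      have e4 : ∑ m ∈ Finset.univ.erase i,
            p i m (-k) * (1 - δ * v m i (-k)) * (1 - δ * v i j k)
          = ∑ m ∈ Finset.univ.erase i, p i m (-k)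
            - δ * ∑ m ∈ Finset.univ.erase i, p i m (-k) * (v m i (-k) + v i j k)
            + δ ^ 2 * b := by
        rw [hb, Finset.mul_sum, Finset.mul_sum, ← Finset.sum_sub_distrib,
          ← Finset.sum_add_distrib]
        exact Finset.sum_congr rfl fun m _ => by ring
      rw [rPoly, e3, e4, ha]
      linear_combination h3
    rw [key]
    nlinarith
  have h1' : ∀ᶠ δ : ℝ in 𝓝[>] 0, ∀ i j k, i ≠ j → (1 - δ * v i j k ∈ Set.Ioo 0 1) ∧
      rPoly p (fun i j k => 1 - δ * v i j k) i j k < 1 - δ * v i j k := by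
    simp only [eventually_all]
    exact h1
  obtain ⟨δ, hδ⟩ := h1'.exists
  set r : Fin N → Fin N → ℤˣ → ℝ := fun i j k => 1 - δ * v i j k with hr
  have h2 : ∀ᶠ t : ℝ in 𝓝[>] 1, ∀ i j k, i ≠ j → t * rPoly p r i j k < r i j k := by
    simp only [eventually_all]
    intro i j k hij
    refine (Continuous.tendsto' (f := fun t : ℝ => t * rPoly p r i j k) (by fun_prop) 1
      (rPoly p r i j k) (by simp)).mono_left nhdsWithin_le_nhds |>.eventually
      (gt_mem_nhds (hδ i j k hij).2)
  obtain ⟨t₀, ht₀, ht₁⟩ := (h2.and self_mem_nhdsWithin).exists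
  exact ⟨t₀, ht₁, r, fun i j k h => (hδ i j k h).1, fun i j k h => (ht₀ i j k h).le⟩

end System

end WindowWalk

end

noncomputable section

namespace WindowWalk

/-! ### Existence and uniqueness of the functions R by monotone iteration. -/

section RFunctions

variable {N : ℕ}

/-- The iterates of the system of equations for the functions `R`, started at `0`. -/
def rIter {𝕜 : Type*} [CommRing 𝕜] (q : Fin N → Fin N → ℤˣ → 𝕜) (t : 𝕜) :
    ℕ → Fin N → Fin N → ℤˣ → 𝕜
  | 0 => 0
  | n + 1 => fun i j k => t * rPoly q (rIter q t n) i j k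

/-- The coefficients of the system are non-negative, so real increments majorise complex ones. The
comparisons between iterates rest on this. -/
theorem norm_rPoly_sub_le {p : Fin N → Fin N → ℤˣ → ℝ} (hp : IsJumpProb p)
    {x y : Fin N → Fin N → ℤˣ → ℂ} {X Y : Fin N → Fin N → ℤˣ → ℝ}
    (hy : ∀ i j k, i ≠ j → ‖y i j k‖ ≤ Y i j k)
    (hxy : ∀ i j k, i ≠ j → ‖x i j k - y i j k‖ ≤ X i j k - Y i j k)
    (i j : Fin N) (k : ℤˣ) (hij : i ≠ j) :
    ‖rPoly (fun i j k => (p i j k : ℂ)) x i j k - rPoly (fun i j k => (p i j k : ℂ)) y i j k‖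
      ≤ rPoly p X i j k - rPoly p Y i j k := by
  have hx : ∀ i j k, i ≠ j → ‖x i j k‖ ≤ X i j k := by
    intro i j k h
    have h1 := norm_add_le (x i j k - y i j k) (y i j k)
    rw [sub_add_cancel] at h1
    linarith [hy i j k h, hxy i j k h]
  have e1 : rPoly (fun i j k => (p i j k : ℂ)) x i j k - rPoly (fun i j k => (p i j k : ℂ)) y i j k
      = ∑ m ∈ (Finset.univ.erase i).erase j, (p i m k : ℂ) * (x m j k - y m j k)
        + ∑ m ∈ Finset.univ.erase i, (p i m (-k) : ℂ) * ((x m i (-k) - y m i (-k)) * x i j k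
          + y m i (-k) * (x i j k - y i j k)) := by
    rw [rPoly, rPoly, add_sub_add_comm, add_sub_add_left_eq_sub, ← Finset.sum_sub_distrib,
      ← Finset.sum_sub_distrib]
    congr 1
    · exact Finset.sum_congr rfl fun m _ => by ring
    · exact Finset.sum_congr rfl fun m _ => by ring
  have e2 : rPoly p X i j k - rPoly p Y i j k
      = ∑ m ∈ (Finset.univ.erase i).erase j, p i m k * (X m j k - Y m j k)
        + ∑ m ∈ Finset.univ.erase i, p i m (-k) * ((X m i (-k) - Y m i (-k)) * X i j k
          + Y m i (-k) * (X i j k - Y i j k)) := by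
    rw [rPoly, rPoly, add_sub_add_comm, add_sub_add_left_eq_sub, ← Finset.sum_sub_distrib,
      ← Finset.sum_sub_distrib]
    congr 1
    · exact Finset.sum_congr rfl fun m _ => by ring
    · exact Finset.sum_congr rfl fun m _ => by ring
  rw [e1, e2]
  refine (norm_add_le _ _).trans (add_le_add ?_ ?_)
  · refine (norm_sum_le _ _).trans (Finset.sum_le_sum fun m hm => ?_)
    have hmj := Finset.ne_of_mem_erase hm
    have hmi := Finset.ne_of_mem_erase (Finset.mem_of_mem_erase hm)
    have hp0 := (hp.pos i m k hmi.symm).le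
    rw [norm_mul, Complex.norm_real, Real.norm_of_nonneg hp0]
    exact mul_le_mul_of_nonneg_left (hxy _ _ _ hmj) hp0
  · refine (norm_sum_le _ _).trans (Finset.sum_le_sum fun m hm => ?_)
    have hmi := Finset.ne_of_mem_erase hm
    have hp0 := (hp.pos i m (-k) hmi.symm).le
    rw [norm_mul, Complex.norm_real, Real.norm_of_nonneg hp0]
    refine mul_le_mul_of_nonneg_left ((norm_add_le _ _).trans ?_) hp0
    rw [norm_mul, norm_mul]
    have hYX : 0 ≤ X m i (-k) - Y m i (-k) := (norm_nonneg _).trans (hxy _ _ _ hmi)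
    have hY : 0 ≤ Y m i (-k) := (norm_nonneg _).trans (hy _ _ _ hmi)
    exact add_le_add (mul_le_mul (hxy _ _ _ hmi) (hx _ _ _ hij) (norm_nonneg _) hYX)
      (mul_le_mul (hy _ _ _ hmi) (hxy _ _ _ hij) (norm_nonneg _) hY)

theorem rPoly_zero {𝕜 : Type*} [CommRing 𝕜] (q : Fin N → Fin N → ℤˣ → 𝕜) (i j : Fin N) (k : ℤˣ) :
    rPoly q 0 i j k = q i j k := by
  simp [rPoly]

theorem norm_rPoly_le {p : Fin N → Fin N → ℤˣ → ℝ} (hp : IsJumpProb p)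
    {x : Fin N → Fin N → ℤˣ → ℂ} {X : Fin N → Fin N → ℤˣ → ℝ}
    (hx : ∀ i j k, i ≠ j → ‖x i j k‖ ≤ X i j k) (i j : Fin N) (k : ℤˣ) (hij : i ≠ j) :
    ‖rPoly (fun i j k => (p i j k : ℂ)) x i j k‖ ≤ rPoly p X i j k := by
  have h := norm_rPoly_sub_le hp (x := x) (y := 0) (X := X) (Y := 0) (by simp)
    (by simpa using hx) i j k hij
  rw [rPoly_zero, rPoly_zero] at h
  have h1 := norm_add_le (rPoly (fun i j k => (p i j k : ℂ)) x i j k - (p i j k : ℂ)) (p i j k)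
  rw [sub_add_cancel, Complex.norm_real, Real.norm_of_nonneg (hp.pos i j k hij).le] at h1
  linarith

theorem rPoly_mono {p : Fin N → Fin N → ℤˣ → ℝ} (hp : IsJumpProb p)
    {X Y : Fin N → Fin N → ℤˣ → ℝ} (hY : ∀ i j k, i ≠ j → 0 ≤ Y i j k)
    (hYX : ∀ i j k, i ≠ j → Y i j k ≤ X i j k) (i j : Fin N) (k : ℤˣ) (hij : i ≠ j) :
    rPoly p Y i j k ≤ rPoly p X i j k := by
  have h := norm_rPoly_sub_le hp (x := 0) (y := 0) (X := X) (Y := Y) (by simpa using hY)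
    (by simpa using hYX) i j k hij
  simpa using h

theorem rIter_cast (p : Fin N → Fin N → ℤˣ → ℝ) (t : ℝ) (n : ℕ) (i j : Fin N) (k : ℤˣ) :
    rIter (fun i j k => (p i j k : ℂ)) (t : ℂ) n i j k = ((rIter p t n i j k : ℝ) : ℂ) := by
  induction n generalizing i j k with
  | zero => simp [rIter]
  | succ n ih => simp [rIter, rPoly, ih]

theorem norm_rIter_le {p : Fin N → Fin N → ℤˣ → ℝ} (hp : IsJumpProb p) {t : ℂ} {s : ℝ}
    (hts : ‖t‖ ≤ s) (n : ℕ) (i j : Fin N) (k : ℤˣ) (hij : i ≠ j) :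
    ‖rIter (fun i j k => (p i j k : ℂ)) t n i j k‖ ≤ rIter p s n i j k := by
  induction n generalizing i j k with
  | zero => simp [rIter]
  | succ n ih =>
    rw [rIter, rIter, norm_mul]
    exact mul_le_mul hts (norm_rPoly_le hp ih i j k hij) (norm_nonneg _) ((norm_nonneg _).trans hts)

theorem norm_rIter_succ_sub_le {p : Fin N → Fin N → ℤˣ → ℝ} (hp : IsJumpProb p) {t : ℂ} {s : ℝ}
    (hts : ‖t‖ ≤ s) (n : ℕ) (i j : Fin N) (k : ℤˣ) (hij : i ≠ j) :
    ‖rIter (fun i j k => (p i j k : ℂ)) t (n + 1) i j k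
      - rIter (fun i j k => (p i j k : ℂ)) t n i j k‖
      ≤ rIter p s (n + 1) i j k - rIter p s n i j k := by
  induction n generalizing i j k with
  | zero => simpa [rIter] using norm_rIter_le hp hts 1 i j k hij
  | succ n ih =>
    have h := norm_rPoly_sub_le hp (norm_rIter_le hp hts n) ih i j k hij
    calc _ = ‖t‖ * ‖rPoly (fun i j k => (p i j k : ℂ))
            (rIter (fun i j k => (p i j k : ℂ)) t (n + 1)) i j k
          - rPoly (fun i j k => (p i j k : ℂ)) (rIter (fun i j k => (p i j k : ℂ)) t n) i j k‖ := by
          rw [← norm_mul, mul_sub]; rfl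
      _ ≤ s * (rPoly p (rIter p s (n + 1)) i j k - rPoly p (rIter p s n) i j k) :=
          mul_le_mul hts h (norm_nonneg _) ((norm_nonneg _).trans hts)
      _ = _ := by rw [mul_sub]; rfl

theorem rIter_mono {p : Fin N → Fin N → ℤˣ → ℝ} (hp : IsJumpProb p) {t s : ℝ} (ht : 0 ≤ t)
    (hts : t ≤ s) (n : ℕ) (i j : Fin N) (k : ℤˣ) (hij : i ≠ j) :
    0 ≤ rIter p t n i j k ∧ rIter p t n i j k ≤ rIter p s n i j k := by
  have h1 : ∀ s, t ≤ s → |rIter p t n i j k| ≤ rIter p s n i j k := by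
    intro s hts
    have h := norm_rIter_le hp (t := (t : ℂ)) (s := s)
      (by rwa [Complex.norm_real, Real.norm_of_nonneg ht]) n i j k hij
    rwa [rIter_cast, Complex.norm_real] at h
  exact ⟨(abs_nonneg _).trans (h1 t le_rfl), (le_abs_self _).trans (h1 s hts)⟩

/-- The system carries an overall factor `t` and is monotone. In the limit this gives R(t) ≤ t R(1),
the strict growth that makes ∂_λ h(1,1) non-zero. -/
theorem rIter_le_mul {p : Fin N → Fin N → ℤˣ → ℝ} (hp : IsJumpProb p) {t : ℝ} (ht : 0 ≤ t)
    (ht1 : t ≤ 1) (n : ℕ) (i j : Fin N) (k : ℤˣ) (hij : i ≠ j) :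
    rIter p t n i j k ≤ t * rIter p 1 n i j k := by
  cases n with
  | zero => simp [rIter]
  | succ n =>
    simp only [rIter, one_mul]
    exact mul_le_mul_of_nonneg_left (rPoly_mono hp (fun i j k h => (rIter_mono hp ht ht1 n i j k h).1)
      (fun i j k h => (rIter_mono hp ht ht1 n i j k h).2) i j k hij) ht

theorem rIter_le_supersolution {p : Fin N → Fin N → ℤˣ → ℝ} (hp : IsJumpProb p) {t : ℝ}
    (ht : 0 ≤ t) {r : Fin N → Fin N → ℤˣ → ℝ} (hr0 : ∀ i j k, i ≠ j → 0 ≤ r i j k)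
    (hr : ∀ i j k, i ≠ j → t * rPoly p r i j k ≤ r i j k) (n : ℕ) (i j : Fin N) (k : ℤˣ)
    (hij : i ≠ j) : rIter p t n i j k ≤ r i j k := by
  induction n generalizing i j k with
  | zero => exact hr0 i j k hij
  | succ n ih =>
    exact (mul_le_mul_of_nonneg_left (rPoly_mono hp
      (fun i j k h => (rIter_mono hp ht le_rfl n i j k h).1) ih i j k hij) ht).trans (hr i j k hij)

theorem le_rIter_succ {p : Fin N → Fin N → ℤˣ → ℝ} (hp : IsJumpProb p) {t : ℝ} (ht : 0 ≤ t)
    (n : ℕ) (i j : Fin N) (k : ℤˣ) (hij : i ≠ j) : t * p i j k ≤ rIter p t (n + 1) i j k := by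
  rw [rIter, ← rPoly_zero p i j k]
  exact mul_le_mul_of_nonneg_left (rPoly_mono hp (fun _ _ _ _ => le_rfl)
    (fun i j k h => (rIter_mono hp ht le_rfl n i j k h).1) i j k hij) ht

theorem differentiable_rIter (q : Fin N → Fin N → ℤˣ → ℂ) (n : ℕ) (i j : Fin N) (k : ℤˣ) :
    Differentiable ℂ fun t => rIter q t n i j k := by
  induction n generalizing i j k with
  | zero => simp [rIter]
  | succ n ih => simp only [rIter, rPoly]; fun_prop

theorem tendsto_rPoly (q : Fin N → Fin N → ℤˣ → ℂ) {F : ℕ → Fin N → Fin N → ℤˣ → ℂ}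
    {x : Fin N → Fin N → ℤˣ → ℂ}
    (h : ∀ i j k, i ≠ j → Tendsto (fun n => F n i j k) atTop (𝓝 (x i j k)))
    (i j : Fin N) (k : ℤˣ) (hij : i ≠ j) :
    Tendsto (fun n => rPoly q (F n) i j k) atTop (𝓝 (rPoly q x i j k)) := by
  unfold rPoly
  refine (tendsto_const_nhds.add (tendsto_finsetSum _ fun m hm => ?_)).add
    (tendsto_finsetSum _ fun m hm => ?_)
  · exact (h m j k (Finset.ne_of_mem_erase hm)).const_mul _
  · exact ((h m i (-k) (Finset.ne_of_mem_erase hm)).const_mul _).mul (h i j k hij)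

/-- At the parameter `t₀ > 1` the real iterates increase and stay below the supersolution `r`, so
their increments are summable and dominate the complex increments on the disk of radius `t₀`. The
limit is uniform, hence analytic; on (0, 1] it is at least `t * p` and at most `r < 1`. -/
theorem exists_isRFamily (hN : 3 ≤ N) {p : Fin N → Fin N → ℤˣ → ℝ} (hp : IsJumpProb p) :
    ∃ ε : ℝ, 0 < ε ∧ ∃ R : Fin N → Fin N → ℤˣ → ℂ → ℂ, IsRFamily p ε R ∧
      ∀ i j k, i ≠ j → ∀ t ∈ Set.Ioc (0 : ℝ) 1, (R i j k t).re ≤ t * (R i j k 1).re := by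
  obtain ⟨t₀, ht₀, r, hr, hr'⟩ := exists_supersolution hN hp
  set q : Fin N → Fin N → ℤˣ → ℂ := fun i j k => (p i j k : ℂ) with hq
  set R : Fin N → Fin N → ℤˣ → ℂ → ℂ := fun i j k t =>
    ∑' n, (rIter q t (n + 1) i j k - rIter q t n i j k) with hR
  have hball : ∀ t ∈ Metric.ball (0 : ℂ) t₀, ‖t‖ ≤ t₀ := fun t ht => by
    simpa using (mem_ball_zero_iff.mp ht).le
  have hsub : ∀ i j k, i ≠ j →
      Summable fun n => rIter p t₀ (n + 1) i j k - rIter p t₀ n i j k := by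
    intro i j k hij
    refine summable_of_sum_range_le (c := r i j k) (fun n => ?_) fun n => ?_
    · exact (norm_nonneg _).trans (norm_rIter_succ_sub_le hp (t := 0) (by simp; linarith) n i j k hij)
    · rw [Finset.sum_range_sub (fun n => rIter p t₀ n i j k)]
      have := rIter_le_supersolution hp (by linarith) (fun i j k h => (hr i j k h).1.le) hr' n i j k hij
      simpa [rIter] using this
  have hunif : ∀ i j k, i ≠ j → TendstoUniformlyOn (fun n t => rIter q t n i j k) (R i j k) atTop
      (Metric.ball 0 t₀) := by
    intro i j k hij
    have h := tendstoUniformlyOn_tsum_nat (hsub i j k hij)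
      (fun n t (ht : t ∈ Metric.ball (0 : ℂ) t₀) => norm_rIter_succ_sub_le hp (hball t ht) n i j k hij)
    refine h.congr (Eventually.of_forall fun n t _ => ?_)
    dsimp only
    rw [Finset.sum_range_sub (fun n => rIter q t n i j k)]
    simp [rIter]
  have hlim : ∀ t ∈ Metric.ball (0 : ℂ) t₀, ∀ i j k, i ≠ j →
      Tendsto (fun n => rIter q t n i j k) atTop (𝓝 (R i j k t)) :=
    fun t ht i j k hij => (hunif i j k hij).tendsto_at ht
  have hre : ∀ t ∈ Set.Ioc (0 : ℝ) 1, ∀ i j k, i ≠ j → R i j k (t : ℂ) = ((R i j k t).re : ℂ) ∧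
      Tendsto (fun n => rIter p t n i j k) atTop (𝓝 (R i j k t).re) := by
    intro t ht i j k hij
    have h := hlim (t : ℂ) (by
      rw [mem_ball_zero_iff, Complex.norm_real, Real.norm_of_nonneg ht.1.le]
      exact ht.2.trans_lt ht₀) i j k hij
    simp_rw [hq, rIter_cast] at h
    have h1 := (Complex.continuous_im.tendsto _).comp h
    have h2 := (Complex.continuous_re.tendsto _).comp h
    simp only [Function.comp_def, Complex.ofReal_im, Complex.ofReal_re] at h1 h2
    refine ⟨Complex.ext (by simp) ?_, h2⟩
    rw [Complex.ofReal_im]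
    exact tendsto_nhds_unique h1 tendsto_const_nhds
  refine ⟨t₀ - 1, by linarith, R, ⟨?_, ?_, ?_⟩, ?_⟩
  · intro i j k hij
    rw [add_sub_cancel]
    refine DifferentiableOn.analyticOnNhd ?_ Metric.isOpen_ball
    exact (hunif i j k hij).tendstoLocallyUniformlyOn.differentiableOn
      (Eventually.of_forall fun n => (differentiable_rIter q n i j k).differentiableOn)
      Metric.isOpen_ball
  · intro i j k hij t ht
    obtain ⟨h1, h2⟩ := hre t ht i j k hij
    refine ⟨_, ⟨?_, ?_⟩, h1⟩
    · refine (mul_pos ht.1 (hp.pos i j k hij)).trans_le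
        (ge_of_tendsto ((tendsto_add_atTop_iff_nat 1).mpr h2) (Eventually.of_forall fun n => ?_))
      exact le_rIter_succ hp ht.1.le n i j k hij
    · refine (le_of_tendsto h2 (Eventually.of_forall fun n => ?_)).trans_lt (hr i j k hij).2
      exact (rIter_mono hp ht.1.le (ht.2.trans ht₀.le) n i j k hij).2.trans
        (rIter_le_supersolution hp (by linarith) (fun i j k h => (hr i j k h).1.le) hr' n i j k hij)
  · intro i j k hij t ht
    rw [add_sub_cancel] at ht
    have h1 := (tendsto_add_atTop_iff_nat 1).mpr (hlim t ht i j k hij)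
    exact tendsto_nhds_unique h1 ((tendsto_rPoly q (hlim t ht) i j k hij).const_mul t)
  · intro i j k hij t ht
    have h1 := (hre 1 ⟨one_pos, le_rfl⟩ i j k hij).2
    rw [Complex.ofReal_one] at h1
    exact le_of_tendsto_of_tendsto (hre t ht i j k hij).2 (h1.const_mul t)
      (Eventually.of_forall fun n => rIter_le_mul hp ht.1.le ht.2 n i j k hij)

/-- A Lipschitz bound on the unit polydisk for the uniqueness argument; the constant 3 is not sharp.
-/
theorem norm_rPoly_sub_le_of_norm_le_one {p : Fin N → Fin N → ℤˣ → ℝ} (hp : IsJumpProb p)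
    {x y : Fin N → Fin N → ℤˣ → ℂ} {S : ℝ} (hx : ∀ i j k, i ≠ j → ‖x i j k‖ ≤ 1)
    (hy : ∀ i j k, i ≠ j → ‖y i j k‖ ≤ 1) (hS : ∀ i j k, i ≠ j → ‖x i j k - y i j k‖ ≤ S)
    (i j : Fin N) (k : ℤˣ) (hij : i ≠ j) :
    ‖rPoly (fun i j k => (p i j k : ℂ)) x i j k - rPoly (fun i j k => (p i j k : ℂ)) y i j k‖
      ≤ 3 * S := by
  have hS0 : 0 ≤ S := (norm_nonneg _).trans (hS i j k hij)
  have e1 : rPoly (fun i j k => (p i j k : ℂ)) x i j k - rPoly (fun i j k => (p i j k : ℂ)) y i j k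
      = ∑ m ∈ (Finset.univ.erase i).erase j, (p i m k : ℂ) * (x m j k - y m j k)
        + ∑ m ∈ Finset.univ.erase i, (p i m (-k) : ℂ) * ((x m i (-k) - y m i (-k)) * x i j k
          + y m i (-k) * (x i j k - y i j k)) := by
    rw [rPoly, rPoly, add_sub_add_comm, add_sub_add_left_eq_sub, ← Finset.sum_sub_distrib,
      ← Finset.sum_sub_distrib]
    congr 1
    · exact Finset.sum_congr rfl fun m _ => by ring
    · exact Finset.sum_congr rfl fun m _ => by ring
  have hsum := hp.sum_eq_one i
  simp_rw [sum_units_int _ k] at hsum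
  rw [Finset.sum_add_distrib] at hsum
  have hpos : ∀ k, ∀ m ∈ Finset.univ.erase i, 0 ≤ p i m k := fun k m hm =>
    (hp.pos i m k (Finset.ne_of_mem_erase hm).symm).le
  have h1 : ‖∑ m ∈ (Finset.univ.erase i).erase j, (p i m k : ℂ) * (x m j k - y m j k)‖
      ≤ (∑ m ∈ Finset.univ.erase i, p i m k) * S := by
    rw [Finset.sum_mul]
    refine (norm_sum_le _ _).trans ((Finset.sum_le_sum fun m hm => ?_).trans
      (Finset.sum_le_sum_of_subset_of_nonneg (Finset.erase_subset j _)
        fun m hm _ => mul_nonneg (hpos k m hm) hS0))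
    have hp0 := hpos k m (Finset.mem_of_mem_erase hm)
    rw [norm_mul, Complex.norm_real, Real.norm_of_nonneg hp0]
    exact mul_le_mul_of_nonneg_left (hS _ _ _ (Finset.ne_of_mem_erase hm)) hp0
  have h2 : ‖∑ m ∈ Finset.univ.erase i, (p i m (-k) : ℂ) * ((x m i (-k) - y m i (-k)) * x i j k
          + y m i (-k) * (x i j k - y i j k))‖
      ≤ (∑ m ∈ Finset.univ.erase i, p i m (-k)) * (2 * S) := by
    rw [Finset.sum_mul]
    refine (norm_sum_le _ _).trans (Finset.sum_le_sum fun m hm => ?_)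
    have hp0 := hpos (-k) m hm
    have hmi := Finset.ne_of_mem_erase hm
    rw [norm_mul, Complex.norm_real, Real.norm_of_nonneg hp0]
    refine mul_le_mul_of_nonneg_left ((norm_add_le _ _).trans ?_) hp0
    rw [norm_mul, norm_mul]
    have a1 := mul_le_mul (hS m i (-k) hmi) (hx i j k hij) (norm_nonneg _) hS0
    have a2 := mul_le_mul (hy m i (-k) hmi) (hS i j k hij) (norm_nonneg _) zero_le_one
    linarith
  have h3 : 0 ≤ ∑ m ∈ Finset.univ.erase i, p i m k := Finset.sum_nonneg (hpos k)
  have h4 : 0 ≤ ∑ m ∈ Finset.univ.erase i, p i m (-k) := Finset.sum_nonneg (hpos (-k))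
  rw [e1]
  refine (norm_add_le _ _).trans ((add_le_add h1 h2).trans ?_)
  nlinarith

/-- The equation forces R(0) = 0, so near 0 both families lie in the unit polydisk, where the system
is a contraction for small |t|. The identity theorem extends the equality to the whole disk. -/
theorem IsRFamily.eqOn {p : Fin N → Fin N → ℤˣ → ℝ} (hp : IsJumpProb p) {ε : ℝ} (hε : 0 < ε)
    {R R' : Fin N → Fin N → ℤˣ → ℂ → ℂ} (hR : IsRFamily p ε R) (hR' : IsRFamily p ε R')
    (i j : Fin N) (k : ℤˣ) (hij : i ≠ j) :
    Set.EqOn (R' i j k) (R i j k) (Metric.ball 0 (1 + ε)) := by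
  have h0 : (0 : ℂ) ∈ Metric.ball (0 : ℂ) (1 + ε) := Metric.mem_ball_self (by linarith)
  have hsmall : ∀ {R : Fin N → Fin N → ℤˣ → ℂ → ℂ}, IsRFamily p ε R →
      ∀ᶠ t in 𝓝 (0 : ℂ), ∀ i j k, i ≠ j → ‖R i j k t‖ ≤ 1 := by
    intro R hR
    simp only [eventually_all]
    intro i j k hij
    have hc := (hR.analytic i j k hij 0 h0).continuousAt
    have hz : R i j k 0 = 0 := by rw [hR.equation i j k hij 0 h0, zero_mul]
    have h1 : ‖R i j k 0‖ < 1 := by rw [hz]; simp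
    filter_upwards [hc.norm.eventually (gt_mem_nhds h1)] with t ht
    exact ht.le
  set C : ℝ := (Fintype.card (Fin N × Fin N × ℤˣ) : ℝ) * 3 with hC
  have hC0 : 0 ≤ C := by positivity
  have ht : ∀ᶠ t : ℂ in 𝓝 0, ‖t‖ * C < 1 :=
    (Continuous.tendsto' (f := fun t : ℂ => ‖t‖ * C) (by fun_prop) 0 0 (by simp)).eventually
      (gt_mem_nhds one_pos)
  have heq : ∀ᶠ t in 𝓝 (0 : ℂ), R' i j k t = R i j k t := by
    filter_upwards [hsmall hR, hsmall hR', ht, Metric.isOpen_ball.mem_nhds h0] with t h1 h2 h3 h4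
    set S : ℝ := ∑ a : Fin N × Fin N × ℤˣ,
      if a.1 = a.2.1 then 0 else ‖R' a.1 a.2.1 a.2.2 t - R a.1 a.2.1 a.2.2 t‖ with hSdef
    have hnn : ∀ a : Fin N × Fin N × ℤˣ, a ∈ Finset.univ →
        0 ≤ if a.1 = a.2.1 then 0 else ‖R' a.1 a.2.1 a.2.2 t - R a.1 a.2.1 a.2.2 t‖ := by
      intro a _; split_ifs; exacts [le_rfl, norm_nonneg _]
    have hle : ∀ i j k, i ≠ j → ‖R' i j k t - R i j k t‖ ≤ S := by
      intro i j k hij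
      have := Finset.single_le_sum hnn (Finset.mem_univ (i, j, k))
      rwa [if_neg hij] at this
    have hS0 : 0 ≤ S := Finset.sum_nonneg hnn
    have hSle : S ≤ ‖t‖ * C * S := by
      have : S ≤ ∑ a : Fin N × Fin N × ℤˣ, ‖t‖ * (3 * S) := by
        refine Finset.sum_le_sum fun a _ => ?_
        split_ifs with ha
        · positivity
        · rw [hR.equation _ _ _ ha t h4, hR'.equation _ _ _ ha t h4, ← mul_sub, norm_mul]
          exact mul_le_mul_of_nonneg_left (norm_rPoly_sub_le_of_norm_le_one hp
            (x := fun i j k => R' i j k t) (y := fun i j k => R i j k t) h2 h1 hle _ _ _ ha)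
            (norm_nonneg _)
      rw [Finset.sum_const, Finset.card_univ, nsmul_eq_mul] at this
      rw [hC]; linarith
    have hS : S = 0 := by nlinarith
    have := hle i j k hij
    rw [hS] at this
    exact sub_eq_zero.mp (norm_le_zero_iff.mp this)
  exact (hR'.analytic i j k hij).eqOn_of_preconnected_of_eventuallyEq (hR.analytic i j k hij)
    (convex_ball _ _).isPreconnected h0 heq

theorem IsRFamily.mono {p : Fin N → Fin N → ℤˣ → ℝ} {ε ε' : ℝ} (hε : ε' ≤ ε)
    {R : Fin N → Fin N → ℤˣ → ℂ → ℂ} (hR : IsRFamily p ε R) : IsRFamily p ε' R where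
  analytic i j k hij := (hR.analytic i j k hij).mono (Metric.ball_subset_ball (by linarith))
  mem_Ioo := hR.mem_Ioo
  equation i j k hij t ht := hR.equation i j k hij t (Metric.ball_subset_ball (by linarith) ht)

/-- The functions `R` vanish at `0` and have non-negative Taylor coefficients; only the following
consequence is needed. -/
theorem IsRFamily.re_le_mul (hN : 3 ≤ N) {p : Fin N → Fin N → ℤˣ → ℝ} (hp : IsJumpProb p) {ε : ℝ}
    (hε : 0 < ε) {R : Fin N → Fin N → ℤˣ → ℂ → ℂ} (hR : IsRFamily p ε R) (i j : Fin N) (k : ℤˣ)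
    (hij : i ≠ j) (t : ℝ) (ht : t ∈ Set.Ioc (0 : ℝ) 1) :
    (R i j k t).re ≤ t * (R i j k 1).re := by
  obtain ⟨ε', hε', R', hR', h⟩ := exists_isRFamily hN hp
  -- Uniqueness on the smaller of the two disks transfers the bound from the constructed family to
  -- the given one.
  have heq := IsRFamily.eqOn hp (lt_min hε hε') (hR.mono (min_le_left _ _))
    (hR'.mono (min_le_right _ _)) i j k hij
  have hmem : ∀ t ∈ Set.Ioc (0 : ℝ) 1, (t : ℂ) ∈ Metric.ball (0 : ℂ) (1 + min ε ε') := by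
    intro t ht
    rw [mem_ball_zero_iff, Complex.norm_real, Real.norm_of_nonneg ht.1.le]
    linarith [ht.2, lt_min hε hε']
  have h1 := heq (hmem 1 ⟨one_pos, le_rfl⟩)
  rw [Complex.ofReal_one] at h1
  rw [← heq (hmem t ht), ← h1]
  exact h i j k hij t ht

end RFunctions

end WindowWalk

end

noncomputable section

namespace WindowWalk

/-! ### Eigenfunctions of the transition operator -/

section Eigenfunction

variable {N : ℕ} {K : Type*} [Field K]

/-- The family `x` with the values on the diagonal replaced by `1`. -/
def hat (x : Fin N → Fin N → ℤˣ → K) (i j : Fin N) (k : ℤˣ) : K := if i = j then 1 else x i j k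

/-- The reciprocal of `t` times the Green function at the unit `i`. -/
def greenInv (q x : Fin N → Fin N → ℤˣ → K) (t : K) (i : Fin N) : K :=
  t⁻¹ - ∑ m ∈ Finset.univ.erase i, ∑ k : ℤˣ, q i m k * x m i k

/-- The diagonal part of the block operator of upper index `k`. -/
def blockDiag (q x : Fin N → Fin N → ℤˣ → K) (t : K) (k : ℤˣ) (i : Fin N) : K :=
  t⁻¹ - ∑ m ∈ Finset.univ.erase i, q i m (-k) * x m i (-k)

/-- In a block with base target `i`, the column `hat x · i k` solves the resolvent equation with a
point source at `i`: away from `i` this is the system divided by `t`, and at `i` the excursions of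
both indices add up to `greenInv`. -/
theorem block_hat {q x : Fin N → Fin N → ℤˣ → K} {t : K} (ht : t ≠ 0)
    (hx : ∀ i j k, i ≠ j → x i j k = t * rPoly q x i j k) (i j : Fin N) (k : ℤˣ) :
    blockDiag q x t k j * hat x j i k - ∑ m ∈ Finset.univ.erase j, q j m k * hat x m i k
      = if j = i then greenInv q x t i else 0 := by
  unfold blockDiag greenInv
  split_ifs with h
  · subst h
    have h1 : ∑ m ∈ Finset.univ.erase j, q j m k * hat x m j k
        = ∑ m ∈ Finset.univ.erase j, q j m k * x m j k :=
      Finset.sum_congr rfl fun m hm => by rw [hat, if_neg (Finset.ne_of_mem_erase hm)]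
    rw [h1]
    simp_rw [sum_units_int _ k]
    rw [Finset.sum_add_distrib, hat, if_pos rfl]
    ring
  · have h1 : ∑ m ∈ Finset.univ.erase j, q j m k * hat x m i k
        = q j i k + ∑ m ∈ (Finset.univ.erase j).erase i, q j m k * x m i k := by
      rw [← Finset.add_sum_erase _ _ (Finset.mem_erase.mpr ⟨Ne.symm h, Finset.mem_univ i⟩)]
      congr 1
      · rw [hat, if_pos rfl, mul_one]
      · exact Finset.sum_congr rfl fun m hm => by rw [hat, if_neg (Finset.ne_of_mem_erase hm)]
    have h2 : t⁻¹ * x j i k = rPoly q x j i k := by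
      rw [hx j i k h, inv_mul_cancel_left₀ ht]
    rw [h1, hat, if_neg h, sub_mul, h2, rPoly, ← Finset.sum_mul]
    ring

/-- The source term of the block with base point `i` and upper index `k`. -/
def blockSource (Z : Fin N → Fin N → ℤˣ → K) (σ : ℤˣ → Fin N → K) (i : Fin N) (k : ℤˣ)
    (m : Fin N) : K :=
  if m = i then -σ k i else Z i m k * σ (-k) m

/-- The solution of the block equation that vanishes at the base point. -/
def blockSol (x Z : Fin N → Fin N → ℤˣ → K) (σ : ℤˣ → Fin N → K) (i : Fin N) (k : ℤˣ)
    (j : Fin N) : K :=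
  ∑ m, hat x j m k * blockSource Z σ i k m

/-- The vectors `σ 1`, `σ (-1)` form a fixed vector of the two transfer matrices. -/
def IsTransferFixed (x Z : Fin N → Fin N → ℤˣ → K) (σ : ℤˣ → Fin N → K) : Prop :=
  ∀ k i, σ k i = ∑ m ∈ Finset.univ.erase i, Z i m k * x i m k * σ (-k) m

/-- The only use of the transfer condition: the base is itself a member of its block, so the
correction has to vanish there for the blocks to fit together. -/
theorem blockSol_self {x Z : Fin N → Fin N → ℤˣ → K} {σ : ℤˣ → Fin N → K}
    (hσ : IsTransferFixed x Z σ) (i : Fin N) (k : ℤˣ) : blockSol x Z σ i k i = 0 := by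
  unfold blockSol
  rw [← Finset.add_sum_erase _ _ (Finset.mem_univ i)]
  have h1 : ∀ m ∈ Finset.univ.erase i, hat x i m k * blockSource Z σ i k m
      = Z i m k * x i m k * σ (-k) m := fun m hm => by
    rw [hat, if_neg (Finset.ne_of_mem_erase hm).symm, blockSource,
      if_neg (Finset.ne_of_mem_erase hm)]
    ring
  rw [Finset.sum_congr rfl h1, ← hσ k i, hat, if_pos rfl, blockSource, if_pos rfl]
  ring

theorem block_blockSol {q x Z : Fin N → Fin N → ℤˣ → K} {σ : ℤˣ → Fin N → K} {t : K} (ht : t ≠ 0)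
    (hx : ∀ i j k, i ≠ j → x i j k = t * rPoly q x i j k) (i j : Fin N) (k : ℤˣ) :
    blockDiag q x t k j * blockSol x Z σ i k j
        - ∑ m ∈ Finset.univ.erase j, q j m k * blockSol x Z σ i k m
      = greenInv q x t j * blockSource Z σ i k j := by
  have h1 : blockDiag q x t k j * blockSol x Z σ i k j
        - ∑ m ∈ Finset.univ.erase j, q j m k * blockSol x Z σ i k m
      = ∑ l, (blockDiag q x t k j * hat x j l k - ∑ m ∈ Finset.univ.erase j, q j m k * hat x m l k)
        * blockSource Z σ i k l := by
    unfold blockSol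
    simp_rw [sub_mul, Finset.sum_sub_distrib, Finset.mul_sum, Finset.sum_mul]
    rw [Finset.sum_comm (s := Finset.univ.erase j)]
    simp_rw [mul_assoc]
  rw [h1]
  simp_rw [block_hat ht hx, ite_mul, zero_mul]
  rw [Finset.sum_ite_eq Finset.univ j, if_pos (Finset.mem_univ j)]

/-- The product of the weights of the letters of a stack. -/
def stackProd (Z : Fin N → Fin N → ℤˣ → K) (i₀ : Fin N) : List (Fin N × ℤˣ) → K
  | [] => 1
  | a :: s => stackProd Z i₀ s * Z (stackTarget i₀ s) a.1 a.2

/-- The eigenfunction of the transition operator, as a function on stacks. -/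
def eigenfun (x Z : Fin N → Fin N → ℤˣ → K) (σ : ℤˣ → Fin N → K) (i₀ : Fin N) :
    List (Fin N × ℤˣ) → K
  | [] => σ 1 i₀ + σ (-1) i₀
  | a :: s => x a.1 (stackTarget i₀ s) a.2 * eigenfun x Z σ i₀ s
      + stackProd Z i₀ s * blockSol x Z σ (stackTarget i₀ s) a.2 a.1

/-- One formula for the whole block, base included, so that deleting, replacing and appending a last
letter need no separate treatment. -/
theorem eigenfun_push {x Z : Fin N → Fin N → ℤˣ → K} {σ : ℤˣ → Fin N → K}
    (hσ : IsTransferFixed x Z σ) (i₀ : Fin N) (s : List (Fin N × ℤˣ)) (m : Fin N) (k : ℤˣ) :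
    eigenfun x Z σ i₀ (push i₀ s m k)
      = hat x m (stackTarget i₀ (strip k s)) k * eigenfun x Z σ i₀ (strip k s)
        + stackProd Z i₀ (strip k s) * blockSol x Z σ (stackTarget i₀ (strip k s)) k m := by
  unfold push
  split_ifs with h
  · rw [← h, blockSol_self hσ, hat, if_pos rfl]; ring
  · rw [eigenfun, hat, if_neg h]

theorem sum_mul_eigenfun_push {q x Z : Fin N → Fin N → ℤˣ → K} {σ : ℤˣ → Fin N → K} {t : K}
    (ht : t ≠ 0) (hx : ∀ i j k, i ≠ j → x i j k = t * rPoly q x i j k)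
    (hσ : IsTransferFixed x Z σ) {i₀ : Fin N} {s : List (Fin N × ℤˣ)} (hs : IsReducedStack i₀ s)
    (k : ℤˣ) :
    ∑ m ∈ Finset.univ.erase (stackTarget i₀ s),
        q (stackTarget i₀ s) m k * eigenfun x Z σ i₀ (push i₀ s m k)
      = blockDiag q x t k (stackTarget i₀ s) * eigenfun x Z σ i₀ s
        - greenInv q x t (stackTarget i₀ s) *
          ((if stackTarget i₀ s = stackTarget i₀ (strip k s) then eigenfun x Z σ i₀ (strip k s)
              else 0)
            + stackProd Z i₀ (strip k s)
              * blockSource Z σ (stackTarget i₀ (strip k s)) k (stackTarget i₀ s)) := by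
  have h1 := eigenfun_push hσ i₀ s (stackTarget i₀ s) k
  rw [push_stackTarget hs k] at h1
  simp_rw [eigenfun_push hσ]
  set j := stackTarget i₀ s
  set b := strip k s
  set i := stackTarget i₀ b
  have h2 := block_hat ht hx i j k
  have h3 := block_blockSol (Z := Z) (σ := σ) ht hx i j k
  have h4 : ∑ m ∈ Finset.univ.erase j, q j m k
        * (hat x m i k * eigenfun x Z σ i₀ b + stackProd Z i₀ b * blockSol x Z σ i k m)
      = (∑ m ∈ Finset.univ.erase j, q j m k * hat x m i k) * eigenfun x Z σ i₀ b
        + stackProd Z i₀ b * ∑ m ∈ Finset.univ.erase j, q j m k * blockSol x Z σ i k m := by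
    rw [Finset.sum_mul, Finset.mul_sum, ← Finset.sum_add_distrib]
    exact Finset.sum_congr rfl fun m _ => by ring
  rw [h4, h1]
  have h5 : greenInv q x t j * (if j = i then eigenfun x Z σ i₀ b else 0)
      = (if j = i then greenInv q x t i else 0) * eigenfun x Z σ i₀ b := by
    split_ifs with h
    · rw [h]
    · simp
  rw [← h2] at h5
  linear_combination (-stackProd Z i₀ b) * h3 + h5

/-- An arrow lies in two blocks: the block of its last letter, and the block of the opposite index
of which it is the base. Their diagonal parts add up to `t⁻¹ + greenInv`, so the two source terms
must add up to the eigenfunction itself. The base contributes its value minus `stackProd` times `σ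
(-k)`, and the other block returns exactly the subtracted term. At the empty stack both blocks have
the same base, which dictates the initial value `σ 1 + σ (-1)`. -/
theorem transition_eigenfun {q x Z : Fin N → Fin N → ℤˣ → K} {σ : ℤˣ → Fin N → K} {t : K}
    (ht : t ≠ 0) (hx : ∀ i j k, i ≠ j → x i j k = t * rPoly q x i j k)
    (hσ : IsTransferFixed x Z σ) {i₀ : Fin N} {s : List (Fin N × ℤˣ)} (hs : IsReducedStack i₀ s) :
    ∑ m ∈ Finset.univ.erase (stackTarget i₀ s), ∑ k : ℤˣ,
        q (stackTarget i₀ s) m k * eigenfun x Z σ i₀ (push i₀ s m k)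
      = t⁻¹ * eigenfun x Z σ i₀ s := by
  have key : ∀ k : ℤˣ, strip (-k) s = s → (s ≠ [] → strip k s ≠ s ∧
        stackTarget i₀ s ≠ stackTarget i₀ (strip k s) ∧
        stackProd Z i₀ s = stackProd Z i₀ (strip k s)
          * Z (stackTarget i₀ (strip k s)) (stackTarget i₀ s) k) →
      ∑ m ∈ Finset.univ.erase (stackTarget i₀ s), ∑ k : ℤˣ,
        q (stackTarget i₀ s) m k * eigenfun x Z σ i₀ (push i₀ s m k)
      = t⁻¹ * eigenfun x Z σ i₀ s := by
    intro k h1 h2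
    simp_rw [sum_units_int _ k]
    rw [Finset.sum_add_distrib, sum_mul_eigenfun_push ht hx hσ hs,
      sum_mul_eigenfun_push ht hx hσ hs, h1, if_pos rfl, blockSource, blockSource, if_pos rfl]
    have h3 : blockDiag q x t k (stackTarget i₀ s) + blockDiag q x t (-k) (stackTarget i₀ s)
        = t⁻¹ + greenInv q x t (stackTarget i₀ s) := by
      unfold blockDiag greenInv
      simp_rw [sum_units_int _ k]
      rw [Finset.sum_add_distrib, neg_neg]
      ring
    by_cases hnil : s = []
    · subst hnil
      have h4 : σ k i₀ + σ (-k) i₀ = eigenfun x Z σ i₀ [] := by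
        rw [eigenfun]
        rcases Int.units_eq_one_or k with rfl | rfl
        · rfl
        · rw [neg_neg, add_comm]
      simp only [strip, stackTarget, if_true, stackProd] at h3 ⊢
      linear_combination (eigenfun x Z σ i₀ []) * h3 + greenInv q x t i₀ * h4
    · obtain ⟨-, h4, h5⟩ := h2 hnil
      rw [if_neg h4, if_neg h4]
      linear_combination (eigenfun x Z σ i₀ s) * h3
        + (greenInv q x t (stackTarget i₀ s) * σ (-k) (stackTarget i₀ s)) * h5
  cases s with
  | nil => exact key 1 rfl fun h => absurd rfl h
  | cons a s =>
    have hne : a.2 ≠ -a.2 := by rcases Int.units_eq_one_or a.2 with h | h <;> rw [h] <;> decide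
    have h1 : strip a.2 (a :: s) = s := by simp [strip]
    refine key a.2 ?_ fun _ => ?_
    · simp [strip, hne]
    · rw [h1]
      exact ⟨by simp, hs.1.symm, rfl⟩

/-- For the parameters `t = 1` and `Z = 1` the eigenfunction is constant. -/
theorem blockSol_eq_one_sub {x : Fin N → Fin N → ℤˣ → K} {σ : ℤˣ → Fin N → K}
    (hσ : IsTransferFixed x (fun _ _ _ => 1) σ) (hσ1 : ∀ i, σ 1 i + σ (-1) i = 1)
    (i j : Fin N) (k : ℤˣ) (hij : i ≠ j) :
    blockSol x (fun _ _ _ => 1) σ i k j = 1 - x j i k := by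
  have hs : ∀ k i, σ (-k) i + σ k i = 1 := by
    intro k i
    rcases Int.units_eq_one_or k with rfl | rfl
    · rw [add_comm]; exact hσ1 i
    · rw [neg_neg]; exact hσ1 i
  have h1 : ∀ m, hat x j m k * blockSource (fun _ _ _ => 1) σ i k m
      = hat x j m k * σ (-k) m - if m = i then hat x j m k else 0 := by
    intro m
    unfold blockSource
    split_ifs with h
    · subst h
      linear_combination (-hat x j m k) * hs k m
    · ring
  unfold blockSol
  rw [Finset.sum_congr rfl fun m _ => h1 m, Finset.sum_sub_distrib,
    Finset.sum_ite_eq' Finset.univ i, if_pos (Finset.mem_univ i),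
    ← Finset.add_sum_erase _ _ (Finset.mem_univ j)]
  have h2 : ∑ m ∈ Finset.univ.erase j, hat x j m k * σ (-k) m = σ k j := by
    rw [hσ k j]
    exact Finset.sum_congr rfl fun m hm => by
      rw [hat, if_neg (Finset.ne_of_mem_erase hm).symm]; ring
  rw [h2, hat, if_pos rfl, one_mul, hs, hat, if_neg hij.symm]

/-- The fixed vector of the transfer matrices for `t = 1` and `Z = 1`. -/
theorem exists_transferFixed_one {q x : Fin N → Fin N → ℤˣ → ℝ} (hq : IsJumpProb q)
    (hN : 3 ≤ N) (hx : ∀ i j k, i ≠ j → x i j k = rPoly q x i j k)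
    (hx1 : ∀ i j k, i ≠ j → x i j k < 1) :
    ∃ σ : ℤˣ → Fin N → ℝ, (∀ k i, 0 < σ k i) ∧ (∀ i, σ 1 i + σ (-1) i = 1) ∧
      IsTransferFixed x (fun _ _ _ => 1) σ := by
  -- `s k i` stands for the probability of leaving a unit by a letter of index `k` and never
  -- returning. Divided by the total `greenInv`, it gives the law of the index of the first letter
  -- of the limiting infinite word.
  set s : ℤˣ → Fin N → ℝ := fun k i => ∑ m ∈ Finset.univ.erase i, q i m k * (1 - x m i k) with hs
  have hspos : ∀ k i, 0 < s k i := by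
    intro k i
    refine Finset.sum_pos (fun m hm => ?_) (Finset.card_pos.mp ?_)
    · have hmi := Finset.ne_of_mem_erase hm
      exact mul_pos (hq.pos _ _ _ hmi.symm) (sub_pos.mpr (hx1 _ _ _ hmi))
    · rw [Finset.card_erase_of_mem (Finset.mem_univ i), Finset.card_univ, Fintype.card_fin]
      omega
  have hsum : ∀ k i, ∑ m ∈ Finset.univ.erase i, q i m k
      + ∑ m ∈ Finset.univ.erase i, q i m (-k) = 1 := by
    intro k i
    have := hq.sum_eq_one i
    simp_rw [sum_units_int _ k] at this
    rwa [Finset.sum_add_distrib] at this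
  have hg : ∀ k i, greenInv q x 1 i = s k i + s (-k) i := by
    intro k i
    simp only [greenInv, hs, mul_sub, mul_one, Finset.sum_sub_distrib, sum_units_int _ k,
      Finset.sum_add_distrib, inv_one]
    linear_combination -(hsum k i)
  have hgpos : ∀ i, 0 < greenInv q x 1 i := fun i => by
    rw [hg 1]; exact add_pos (hspos _ _) (hspos _ _)
  -- `B` is the Green matrix of a block and `T` its inverse. As `T` maps the constant 1 to `s (-k)`,
  -- `B` maps `s (-k)` back to 1.
  have hhat : ∀ k i, ∑ m, hat x i m k * (s (-k) m / greenInv q x 1 m) = 1 := by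
    intro k
    let T : Matrix (Fin N) (Fin N) ℝ := Matrix.of fun i m =>
      if m = i then blockDiag q x 1 k i else -q i m k
    have hTmul : ∀ v : Fin N → ℝ, ∀ i, ∑ m, T i m * v m
        = blockDiag q x 1 k i * v i - ∑ m ∈ Finset.univ.erase i, q i m k * v m := by
      intro v i
      have h : ∀ m ∈ Finset.univ.erase i, T i m * v m = -(q i m k * v m) := fun m hm => by
        simp only [T, Matrix.of_apply, if_neg (Finset.ne_of_mem_erase hm), neg_mul]
      rw [← Finset.add_sum_erase _ _ (Finset.mem_univ i), Finset.sum_congr rfl h,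
        Finset.sum_neg_distrib]
      simp only [T, Matrix.of_apply, if_true]
      ring
    let B : Matrix (Fin N) (Fin N) ℝ := Matrix.of fun i m => hat x i m k / greenInv q x 1 m
    have hTB : T * B = 1 := by
      ext i j
      rw [Matrix.mul_apply, hTmul (fun m => B m j) i]
      have h := block_hat (q := q) (x := x) one_ne_zero
        (fun i j k h => by rw [one_mul]; exact hx i j k h) j i k
      simp only [B, Matrix.of_apply, ← mul_div_assoc, ← Finset.sum_div, ← sub_div]
      rw [h, Matrix.one_apply]
      split_ifs with hij
      · exact div_self (hgpos j).ne'
      · exact zero_div _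
    have hBT : B * T = 1 := mul_eq_one_comm.mp hTB
    have hT1 : T.mulVec (fun _ => 1) = s (-k) := by
      ext i
      have := hTmul (fun _ => 1) i
      simp only [Matrix.mulVec, dotProduct]
      rw [this]
      simp only [blockDiag, hs, mul_sub, mul_one, Finset.sum_sub_distrib, inv_one]
      linear_combination -(hsum k i)
    intro i
    have h1 : B.mulVec (s (-k)) = fun _ => 1 := by
      rw [← hT1, Matrix.mulVec_mulVec, hBT, Matrix.one_mulVec]
    have h2 := congrFun h1 i
    simp only [Matrix.mulVec, dotProduct, B, Matrix.of_apply] at h2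
    exact (Finset.sum_congr rfl fun m _ => by ring).trans h2
  refine ⟨fun k i => s k i / greenInv q x 1 i, fun k i => div_pos (hspos _ _) (hgpos _),
    fun i => ?_, fun k i => ?_⟩
  · rw [← add_div, ← hg 1, div_self (hgpos i).ne']
  · have h1 := hhat k i
    rw [← Finset.add_sum_erase _ _ (Finset.mem_univ i), hat, if_pos rfl, one_mul] at h1
    have h2 : ∑ m ∈ Finset.univ.erase i, hat x i m k * (s (-k) m / greenInv q x 1 m)
        = ∑ m ∈ Finset.univ.erase i, 1 * x i m k * (s (-k) m / greenInv q x 1 m) :=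
      Finset.sum_congr rfl fun m hm => by
        rw [hat, if_neg (Finset.ne_of_mem_erase hm).symm, one_mul]
    rw [← h2]
    have h3 : s k i / greenInv q x 1 i + s (-k) i / greenInv q x 1 i = 1 := by
      rw [← add_div, ← hg k, div_self (hgpos i).ne']
    linarith

/-- Appending a letter multiplies the relative error by at most `ρ` and adds at most `(1 - ρ) * δ`,
so the bound `δ` is preserved whatever the length of the word. -/
theorem norm_eigenfun_sub_le {x Z : Fin N → Fin N → ℤˣ → ℂ} {σ : ℤˣ → Fin N → ℂ} {ρ δ : ℝ}
    (hx : ∀ i j k, i ≠ j → ‖x j i k‖ ≤ ρ * ‖Z i j k‖)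
    (hu : ∀ i j k, i ≠ j → ‖x j i k + blockSol x Z σ i k j - Z i j k‖ ≤ (1 - ρ) * δ * ‖Z i j k‖)
    {i₀ : Fin N} (h0 : ‖σ 1 i₀ + σ (-1) i₀ - 1‖ ≤ δ) {s : List (Fin N × ℤˣ)}
    (hs : IsReducedStack i₀ s) :
    ‖eigenfun x Z σ i₀ s - stackProd Z i₀ s‖ ≤ δ * ‖stackProd Z i₀ s‖ := by
  induction s with
  | nil => simpa [eigenfun, stackProd] using h0
  | cons a s ih =>
    have ih := ih hs.2.2
    have hx := hx (stackTarget i₀ s) a.1 a.2 hs.1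
    have hu := hu (stackTarget i₀ s) a.1 a.2 hs.1
    rw [eigenfun, stackProd]
    set i := stackTarget i₀ s
    calc _ = ‖x a.1 i a.2 * (eigenfun x Z σ i₀ s - stackProd Z i₀ s)
          + stackProd Z i₀ s * (x a.1 i a.2 + blockSol x Z σ i a.2 a.1 - Z i a.1 a.2)‖ := by
          congr 1; ring
      _ ≤ ‖x a.1 i a.2‖ * ‖eigenfun x Z σ i₀ s - stackProd Z i₀ s‖
          + ‖stackProd Z i₀ s‖ * ‖x a.1 i a.2 + blockSol x Z σ i a.2 a.1 - Z i a.1 a.2‖ := by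
          rw [← norm_mul, ← norm_mul]; exact norm_add_le _ _
      _ ≤ (ρ * ‖Z i a.1 a.2‖) * (δ * ‖stackProd Z i₀ s‖)
          + ‖stackProd Z i₀ s‖ * ((1 - ρ) * δ * ‖Z i a.1 a.2‖) :=
          add_le_add (mul_le_mul hx ih (norm_nonneg _) ((norm_nonneg _).trans hx))
            (mul_le_mul_of_nonneg_left hu (norm_nonneg _))
      _ = _ := by rw [norm_mul]; ring

end Eigenfunction

end WindowWalk

end

noncomputable section

namespace WindowWalk

/-! ### Determinants, adjugates and a Perron–Frobenius argument. -/

section Determinants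

variable {ι : Type*} [Fintype ι] [DecidableEq ι]

theorem analyticAt_det {E : Type*} [NormedAddCommGroup E] [NormedSpace ℂ E]
    {f : E → Matrix ι ι ℂ} {x : E} (hf : ∀ i j, AnalyticAt ℂ (fun y => f y i j) x) :
    AnalyticAt ℂ (fun y => (f y).det) x := by
  simp only [Matrix.det_apply, Units.smul_def, zsmul_eq_mul]
  exact Finset.analyticAt_fun_sum _ fun τ _ => analyticAt_const.mul
    (Finset.analyticAt_fun_prod _ fun i _ => hf _ _)

theorem analyticAt_adjugate {E : Type*} [NormedAddCommGroup E] [NormedSpace ℂ E]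
    {f : E → Matrix ι ι ℂ} {x : E} (hf : ∀ i j, AnalyticAt ℂ (fun y => f y i j) x) (i j : ι) :
    AnalyticAt ℂ (fun y => (f y).adjugate i j) x := by
  simp only [Matrix.adjugate_apply]
  refine analyticAt_det fun a b => ?_
  by_cases h : a = j
  · subst h
    simp only [Matrix.updateRow_self]
    exact analyticAt_const
  · simp only [Matrix.updateRow_ne h]
    exact hf a b

/-- If `K` is a positive matrix with a positive fixed vector, then a negative vector completes any
`card ι - 1` columns of `1 - K` to a basis. -/
theorem det_updateCol_ne_zero {K : Matrix ι ι ℝ} (hK : ∀ i j, 0 < K i j) {σ w : ι → ℝ}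
    (hσ : ∀ i, 0 < σ i) (hKσ : K.mulVec σ = σ) (hw : ∀ i, w i < 0) (a : ι) :
    ((1 - K).updateCol a w).det ≠ 0 := by
  intro hdet
  -- A left null vector `η` is orthogonal to `w` and to the columns of `1 - K` other than `a`; since
  -- `(1 - K)σ = 0` and `σ a ≠ 0`, also to column `a`. So `η` is a left fixed vector of the positive
  -- matrix `K`, hence of one sign, and cannot be orthogonal to the negative vector `w`.
  obtain ⟨η, hη0, hη⟩ := Matrix.exists_vecMul_eq_zero_iff.mpr hdet
  have hηw : ∑ i, η i * w i = 0 := by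
    have := congrFun hη a
    simpa [Matrix.vecMul, dotProduct] using this
  have hσ0 : (1 - K).mulVec σ = 0 := by
    rw [Matrix.sub_mulVec, Matrix.one_mulVec, hKσ, sub_self]
  have hne : ∀ m, m ≠ a → Matrix.vecMul η (1 - K) m = 0 := by
    intro m hm
    have := congrFun hη m
    simpa [Matrix.vecMul, dotProduct, Matrix.updateCol_ne hm] using this
  have ha : Matrix.vecMul η (1 - K) a = 0 := by
    have h1 : Matrix.vecMul η (1 - K) ⬝ᵥ σ = 0 := by
      rw [← Matrix.dotProduct_mulVec, hσ0, dotProduct_zero]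
    rw [dotProduct, ← Finset.add_sum_erase _ _ (Finset.mem_univ a),
      Finset.sum_eq_zero (fun m hm => by rw [hne m (Finset.ne_of_mem_erase hm), zero_mul]),
      add_zero] at h1
    exact (mul_eq_zero.mp h1).resolve_right (hσ a).ne'
  have hηK : ∀ m, ∑ i, η i * K i m = η m := by
    intro m
    have h1 : Matrix.vecMul η (1 - K) m = 0 := by
      by_cases hm : m = a
      · rw [hm, ha]
      · exact hne m hm
    rw [Matrix.vecMul_sub, Matrix.vecMul_one, Pi.sub_apply] at h1
    simp only [Matrix.vecMul, dotProduct] at h1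
    linarith
  -- Weighted by `σ`, both sides have the same total, so |η| is a left fixed vector too, and so is
  -- the non-negative vector |η| - η.
  have hle : ∀ m ∈ Finset.univ, |η m| * σ m ≤ (∑ i, |η i| * K i m) * σ m := by
    intro m _
    refine mul_le_mul_of_nonneg_right ?_ (hσ m).le
    rw [← hηK m]
    refine (Finset.abs_sum_le_sum_abs _ _).trans (Finset.sum_le_sum fun i _ => ?_)
    rw [abs_mul, abs_of_pos (hK i m)]
  have hsum : ∑ m, |η m| * σ m = ∑ m, (∑ i, |η i| * K i m) * σ m := by
    simp_rw [Finset.sum_mul, mul_assoc]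
    rw [Finset.sum_comm]
    refine Finset.sum_congr rfl fun i _ => ?_
    rw [← Finset.mul_sum]
    have := congrFun hKσ i
    simp only [Matrix.mulVec, dotProduct] at this
    rw [this]
  have habs : ∀ m, ∑ i, |η i| * K i m = |η m| := fun m =>
    (mul_right_cancel₀ (hσ m).ne'
      ((Finset.sum_eq_sum_iff_of_le hle).mp hsum m (Finset.mem_univ m))).symm
  have hν : ∀ m, ∑ i, (|η i| - η i) * K i m = |η m| - η m := by
    intro m
    simp_rw [sub_mul]
    rw [Finset.sum_sub_distrib, habs, hηK]
  by_cases hall : ∀ i, |η i| - η i = 0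
  · have hnn : ∀ i, 0 ≤ η i := fun i => by have := abs_nonneg (η i); linarith [hall i]
    refine hη0 (funext fun i => ?_)
    have h1 : ∀ i ∈ Finset.univ, 0 ≤ η i * -w i := fun i _ =>
      mul_nonneg (hnn i) (neg_nonneg.mpr (hw i).le)
    have h2 : ∑ i, η i * -w i = 0 := by simp [hηw]
    have h3 := (Finset.sum_eq_zero_iff_of_nonneg h1).mp h2 i (Finset.mem_univ i)
    exact (mul_eq_zero.mp h3).resolve_right (neg_pos.mpr (hw i)).ne'
  · push Not at hall
    obtain ⟨b, hb⟩ := hall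
    have hνnn : ∀ i, 0 ≤ |η i| - η i := fun i => sub_nonneg.mpr (le_abs_self _)
    have hneg : ∀ m, η m < 0 := by
      intro m
      have h1 : 0 < |η m| - η m := by
        rw [← hν m]
        exact Finset.sum_pos' (fun i _ => mul_nonneg (hνnn i) (hK i m).le)
          ⟨b, Finset.mem_univ b, mul_pos ((hνnn b).lt_of_ne hb.symm) (hK b m)⟩
      by_contra h
      rw [abs_of_nonneg (not_lt.mp h)] at h1
      linarith
    have : 0 < ∑ i, η i * w i :=
      Finset.sum_pos (fun i _ => mul_pos_of_neg_of_neg (hneg i) (hw i)) ⟨b, Finset.mem_univ b⟩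
    linarith

theorem adjugate_mulVec_apply (A : Matrix ι ι ℂ) (v : ι → ℂ) (a : ι) :
    A.adjugate.mulVec v a = (A.updateCol a v).det := by
  rw [← Matrix.cramer_apply, Matrix.cramer_eq_adjugate_mulVec]

theorem det_mul_eq_adjugate_mulVec (A : Matrix ι ι ℂ) (σ : ι → ℂ) (a : ι) :
    A.det * σ a = A.adjugate.mulVec (A.mulVec σ) a := by
  rw [Matrix.mulVec_mulVec, Matrix.adjugate_mul, Matrix.smul_mulVec, Matrix.one_mulVec,
    Pi.smul_apply, smul_eq_mul]

/-- If one column of `A` can be replaced so that the determinant does not vanish, and `A` has the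
kernel vector `σ`, then some column of the adjugate of `A` is a non-zero multiple of `σ`. -/
theorem exists_adjugate_col_eq {A : Matrix ι ι ℂ} {σ w : ι → ℂ} (hσ : A.mulVec σ = 0) {a : ι}
    (ha : σ a ≠ 0) (hdet : (A.updateCol a w).det ≠ 0) :
    ∃ (b : ι) (c : ℂ), c ≠ 0 ∧ ∀ i, c * A.adjugate i b = σ i := by
  have hA : A.det = 0 := by
    have := det_mul_eq_adjugate_mulVec A σ a
    rw [hσ, Matrix.mulVec_zero, Pi.zero_apply] at this
    exact (mul_eq_zero.mp this).resolve_right ha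
  obtain ⟨b, hb⟩ : ∃ b, A.adjugate a b ≠ 0 := by
    by_contra! h
    apply hdet
    rw [← adjugate_mulVec_apply]
    simp [Matrix.mulVec, dotProduct, h]
  refine ⟨b, σ a / A.adjugate a b, div_ne_zero ha hb, fun i => ?_⟩
  set c := σ a / A.adjugate a b with hc
  -- `v` lies in the kernel of `A` and vanishes at `a`, so column `a` does not act on it and the
  -- invertible updated matrix kills it as well.
  set v : ι → ℂ := fun i => c * A.adjugate i b - σ i with hv
  have hva : v a = 0 := by
    simp only [hv, hc]; rw [div_mul_cancel₀ _ hb, sub_self]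
  have hAv : A.mulVec v = 0 := by
    have h1 : v = c • (A.adjugate.mulVec (Pi.single b 1)) - σ := by
      ext i; simp [hv]
    rw [h1, Matrix.mulVec_sub, hσ, sub_zero, Matrix.mulVec_smul, Matrix.mulVec_mulVec,
      Matrix.mul_adjugate, hA, zero_smul, Matrix.zero_mulVec, smul_zero]
  have hCv : (A.updateCol a w).mulVec v = 0 := by
    rw [← hAv]
    ext m
    simp only [Matrix.mulVec, dotProduct]
    refine Finset.sum_congr rfl fun j _ => ?_
    by_cases hj : j = a
    · rw [hj, hva, mul_zero, mul_zero]
    · rw [Matrix.updateCol_ne hj]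
  have hv0 : v = 0 := by
    by_contra hne
    exact hdet (Matrix.exists_mulVec_eq_zero_iff.mp ⟨v, hne, hCv⟩)
  have := congrFun hv0 i
  simp only [hv, Pi.zero_apply] at this
  exact sub_eq_zero.mp this

end Determinants

/-- A lower bound for the slope of a function that is real on the interval `(0, 1)`. -/
theorem im_eq_zero_and_re_le_of_hasDerivAt {f : ℂ → ℂ} {f' : ℂ} (hf : HasDerivAt f f' 1)
    (h1 : f 1 = 0) {c : ℝ} (h : ∀ t ∈ Set.Ioo (0 : ℝ) 1, (f t).im = 0 ∧ (1 - t) * c ≤ (f t).re) :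
    f'.im = 0 ∧ f'.re ≤ -c := by
  have h2 : HasDerivAt (fun t : ℝ => f t) f' 1 := by
    have := hf.comp_ofReal (z := 1)
    simpa using this
  have h3 := (hasDerivAt_iff_tendsto_slope_left_right.mp h2).1
  have hmem : ∀ᶠ t : ℝ in 𝓝[<] 1, t ∈ Set.Ioo (0 : ℝ) 1 := Ioo_mem_nhdsLT one_pos
  have hslope : ∀ t : ℝ, slope (fun t : ℝ => f t) 1 t = ((t - 1)⁻¹ : ℝ) • f t := by
    intro t
    rw [slope_def_module]
    simp [h1]
  constructor
  · refine tendsto_nhds_unique ((Complex.continuous_im.tendsto _).comp h3)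
      (tendsto_const_nhds.congr' ?_)
    filter_upwards [hmem] with t ht
    rw [Function.comp_apply, hslope, Complex.smul_im, (h t ht).1, smul_zero]
  · refine le_of_tendsto ((Complex.continuous_re.tendsto _).comp h3) ?_
    filter_upwards [hmem] with t ht
    rw [Function.comp_apply, hslope, Complex.smul_re, smul_eq_mul]
    have h4 := (h t ht).2
    have h5 : (t - 1)⁻¹ < 0 := inv_lt_zero.mpr (by linarith [ht.2])
    have h6 : t - 1 ≠ 0 := by linarith [ht.2]
    calc (t - 1)⁻¹ * (f t).re ≤ (t - 1)⁻¹ * ((1 - t) * c) :=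
          mul_le_mul_of_nonpos_left h4 h5.le
      _ = -c := by field_simp; ring

/-! ### The transfer matrices near (1, 1). -/

section Transfer

variable {N : ℕ}

/-- The weights `z ^ |A_{i,j}^{(k)}|_M`. -/
def zPow (M : Arr N → ℝ) (z : ℂ) (i j : Fin N) (k : ℤˣ) : ℂ := z ^ ((M (gen i j k) : ℝ) : ℂ)

theorem zPow_one (M : Arr N → ℝ) : zPow M 1 = fun _ _ _ => 1 := by
  funext i j k
  exact Complex.one_cpow _

theorem matB_mulVec (M : Arr N → ℝ) (R : Fin N → Fin N → ℤˣ → ℂ → ℂ) (k : ℤˣ) (t z : ℂ)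
    (v : Fin N → ℂ) (i : Fin N) :
    (matB M R k t z).mulVec v i
      = ∑ m ∈ Finset.univ.erase i, zPow M z i m k * R i m k t * v m := by
  simp only [Matrix.mulVec, dotProduct, matB, Matrix.of_apply, zPow]
  rw [← Finset.add_sum_erase _ _ (Finset.mem_univ i), if_pos rfl, zero_mul, zero_add]
  exact Finset.sum_congr rfl fun m hm => by rw [if_neg (Finset.ne_of_mem_erase hm).symm]

theorem isTransferFixed_of_mulVec (M : Arr N → ℝ) (R : Fin N → Fin N → ℤˣ → ℂ → ℂ) (t z : ℂ)
    {v : Fin N → ℂ} (hv : (1 - matB M R 1 t z * matB M R (-1) t z).mulVec v = 0) :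
    IsTransferFixed (fun i j k => R i j k t) (zPow M z)
      (fun k => if k = 1 then v else (matB M R (-1) t z).mulVec v) := by
  intro k i
  have hne : (-1 : ℤˣ) ≠ 1 := by decide
  rcases Int.units_eq_one_or k with rfl | rfl
  · simp only [if_true, if_neg hne]
    rw [← matB_mulVec, Matrix.mulVec_mulVec]
    rw [Matrix.sub_mulVec, Matrix.one_mulVec, sub_eq_zero] at hv
    exact congrFun hv i
  · simp only [neg_neg, if_true, if_neg hne]
    rw [matB_mulVec]

theorem analyticAt_matB (M : Arr N → ℝ) {p : Fin N → Fin N → ℤˣ → ℝ} {ε : ℝ} (hε : 0 < ε)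
    {R : Fin N → Fin N → ℤˣ → ℂ → ℂ} (hR : IsRFamily p ε R) (k : ℤˣ) (i j : Fin N) :
    AnalyticAt ℂ (fun q : ℂ × ℂ => matB M R k q.1 q.2 i j) (1, 1) := by
  by_cases h : i = j
  · simp only [matB, Matrix.of_apply, if_pos h]
    exact analyticAt_const
  · simp only [matB, Matrix.of_apply, if_neg h]
    have h1 : AnalyticAt ℂ (fun q : ℂ × ℂ => R i j k q.1) (1, 1) := by
      have := hR.analytic i j k h 1 (by rw [mem_ball_zero_iff, norm_one]; linarith)
      exact AnalyticAt.fun_comp (f := fun q : ℂ × ℂ => q.1) (x := ((1 : ℂ), (1 : ℂ))) this analyticAt_fst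
    exact (analyticAt_snd.cpow analyticAt_const (by simp)).mul h1

theorem analyticAt_one_sub_matB (M : Arr N → ℝ) {p : Fin N → Fin N → ℤˣ → ℝ} {ε : ℝ} (hε : 0 < ε)
    {R : Fin N → Fin N → ℤˣ → ℂ → ℂ} (hR : IsRFamily p ε R) (i j : Fin N) :
    AnalyticAt ℂ (fun q : ℂ × ℂ =>
      (1 - matB M R 1 q.1 q.2 * matB M R (-1) q.1 q.2) i j) (1, 1) := by
  simp only [Matrix.sub_apply, Matrix.mul_apply]
  exact analyticAt_const.sub (Finset.analyticAt_fun_sum _ fun m _ =>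
    (analyticAt_matB M hε hR _ _ _).mul (analyticAt_matB M hε hR _ _ _))

theorem analyticAt_hFun (M : Arr N → ℝ) {p : Fin N → Fin N → ℤˣ → ℝ} {ε : ℝ} (hε : 0 < ε)
    {R : Fin N → Fin N → ℤˣ → ℂ → ℂ} (hR : IsRFamily p ε R) :
    AnalyticAt ℂ (fun q : ℂ × ℂ => hFun M R q.1 q.2) (1, 1) :=
  analyticAt_det (analyticAt_one_sub_matB M hε hR)

/-- `h` vanishes at `(1, 1)`, its first partial derivative does not, and near `(1, 1)` the zeros of
`h` carry fixed vectors of the transfer matrices that depend continuously on the parameters. -/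
theorem hFun_one_one (hN : 3 ≤ N) {p : Fin N → Fin N → ℤˣ → ℝ} (hp : IsJumpProb p)
    (M : Arr N → ℝ) {ε : ℝ} (hε : 0 < ε) {R : Fin N → Fin N → ℤˣ → ℂ → ℂ} (hR : IsRFamily p ε R) :
    hFun M R 1 1 = 0 ∧ d1 (hFun M R) ≠ 0 ∧
    ∃ S : ℂ × ℂ → ℤˣ → Fin N → ℂ, (∀ k i, ContinuousAt (fun q => S q k i) (1, 1)) ∧
      (∀ q : ℂ × ℂ, hFun M R q.1 q.2 = 0 →
        IsTransferFixed (fun i j k => R i j k q.1) (zPow M q.2) (S q)) ∧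
      (∀ i, S (1, 1) 1 i + S (1, 1) (-1) i = 1) := by
  -- the real values of the functions `R`
  set r : ℝ → Fin N → Fin N → ℤˣ → ℝ := fun t i j k => (R i j k t).re with hr
  have hrR : ∀ t ∈ Set.Ioc (0 : ℝ) 1, ∀ i j k, i ≠ j →
      R i j k (t : ℂ) = (r t i j k : ℂ) ∧ r t i j k ∈ Set.Ioo (0 : ℝ) 1 := by
    intro t ht i j k hij
    obtain ⟨y, hy, hy'⟩ := hR.mem_Ioo i j k hij t ht
    have : r t i j k = y := by simp only [hr, hy', Complex.ofReal_re]
    rw [this]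
    exact ⟨hy', hy⟩
  have hmono : ∀ t ∈ Set.Ioc (0 : ℝ) 1, ∀ i j k, i ≠ j → r t i j k ≤ t * r 1 i j k := by
    intro t ht i j k hij
    simpa [hr] using hR.re_le_mul hN hp hε i j k hij t ht
  have one_mem : (1 : ℝ) ∈ Set.Ioc (0 : ℝ) 1 := ⟨one_pos, le_rfl⟩
  have heq1 : ∀ i j k, i ≠ j → r 1 i j k = rPoly p (r 1) i j k := by
    intro i j k hij
    have h1 := hR.equation i j k hij 1 (by rw [mem_ball_zero_iff, norm_one]; linarith)
    rw [one_mul] at h1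
    have h2 := fun i j k hij => (hrR 1 one_mem i j k hij).1
    simp only [Complex.ofReal_one] at h2
    rw [h2 i j k hij] at h1
    have h3 : ((r 1 i j k : ℝ) : ℂ) = ((rPoly p (r 1) i j k : ℝ) : ℂ) := by
      rw [h1, rPoly]
      push_cast
      refine congrArg₂ (· + ·) (congrArg₂ (· + ·) rfl ?_) ?_
      · exact Finset.sum_congr rfl fun m hm => by rw [h2 m j k (Finset.ne_of_mem_erase hm)]
      · exact Finset.sum_congr rfl fun m hm => by rw [h2 m i (-k) (Finset.ne_of_mem_erase hm)]
    exact_mod_cast h3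
  obtain ⟨σ, hσ0, hσ1, hσ⟩ := exists_transferFixed_one hp hN heq1
    fun i j k hij => (hrR 1 one_mem i j k hij).2.2
  -- the real transfer matrices
  set b : ℝ → ℤˣ → Matrix (Fin N) (Fin N) ℝ := fun t k => Matrix.of fun i j =>
    if i = j then 0 else r t i j k with hb
  have hbB : ∀ t ∈ Set.Ioc (0 : ℝ) 1, ∀ k, matB M R k (t : ℂ) 1 = (b t k).map (fun y => (y : ℂ)) := by
    intro t ht k
    ext i j
    simp only [matB, Matrix.of_apply, Matrix.map_apply, hb, Complex.one_cpow, one_mul]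
    split_ifs with h
    · simp
    · exact (hrR t ht i j k h).1
  have hb0 : ∀ t ∈ Set.Ioc (0 : ℝ) 1, ∀ k i j, 0 ≤ b t k i j := by
    intro t ht k i j
    simp only [hb, Matrix.of_apply]
    split_ifs with h
    exacts [le_rfl, (hrR t ht i j k h).2.1.le]
  have hbt : ∀ t ∈ Set.Ioc (0 : ℝ) 1, ∀ k i j, b t k i j ≤ t * b 1 k i j := by
    intro t ht k i j
    simp only [hb, Matrix.of_apply]
    split_ifs with h
    · simp
    · exact hmono t ht i j k h
  set K : ℝ → Matrix (Fin N) (Fin N) ℝ := fun t => b t 1 * b t (-1) with hK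
  have hKB : ∀ t ∈ Set.Ioc (0 : ℝ) 1, matB M R 1 (t : ℂ) 1 * matB M R (-1) (t : ℂ) 1
      = (K t).map (fun y => (y : ℂ)) := by
    intro t ht
    rw [hbB t ht, hbB t ht, hK]
    exact (Matrix.map_mul (f := Complex.ofRealHom)).symm
  have hKpos : ∀ i j, 0 < K 1 i j := by
    intro i j
    simp only [hK, Matrix.mul_apply]
    -- Each factor has zero diagonal; a window different from both `i` and `j`, available because `N
    -- ≥ 3`, makes the product positive.
    obtain ⟨m, hm⟩ : ((Finset.univ.erase i).erase j : Finset (Fin N)).Nonempty := by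
      rw [← Finset.card_pos]
      have h1 := Finset.pred_card_le_card_erase (s := (Finset.univ.erase i : Finset (Fin N))) (a := j)
      rw [Finset.card_erase_of_mem (Finset.mem_univ i), Finset.card_univ, Fintype.card_fin] at h1
      omega
    have hmj := Finset.ne_of_mem_erase hm
    have hmi := Finset.ne_of_mem_erase (Finset.mem_of_mem_erase hm)
    refine Finset.sum_pos' (fun m _ => mul_nonneg (hb0 1 one_mem _ _ _) (hb0 1 one_mem _ _ _))
      ⟨m, Finset.mem_univ m, mul_pos ?_ ?_⟩
    · simp only [hb, Matrix.of_apply, if_neg hmi.symm]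
      exact (hrR 1 one_mem _ _ _ hmi.symm).2.1
    · simp only [hb, Matrix.of_apply, if_neg hmj]
      exact (hrR 1 one_mem _ _ _ hmj).2.1
  have hKt : ∀ t ∈ Set.Ioc (0 : ℝ) 1, ∀ i j, K t i j ≤ t * K 1 i j := by
    intro t ht i j
    simp only [hK, Matrix.mul_apply, Finset.mul_sum]
    refine Finset.sum_le_sum fun m _ => ?_
    have h1 : b t (-1) m j ≤ b 1 (-1) m j :=
      (hbt t ht _ _ _).trans (mul_le_of_le_one_left (hb0 1 one_mem _ _ _) ht.2)
    rw [← mul_assoc]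
    exact mul_le_mul (hbt t ht _ _ _) h1 (hb0 t ht _ _ _)
      (mul_nonneg ht.1.le (hb0 1 one_mem _ _ _))
  have hbσ : ∀ k, (b 1 k).mulVec (σ (-k)) = σ k := by
    intro k
    ext i
    simp only [Matrix.mulVec, dotProduct, hb, Matrix.of_apply]
    rw [hσ k i, ← Finset.add_sum_erase _ _ (Finset.mem_univ i), if_pos rfl, zero_mul, zero_add]
    exact Finset.sum_congr rfl fun m hm => by
      rw [if_neg (Finset.ne_of_mem_erase hm).symm, one_mul]
  have hKσ : (K 1).mulVec (σ 1) = σ 1 := by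
    have h2 := hbσ (-1)
    rw [neg_neg] at h2
    rw [hK, ← Matrix.mulVec_mulVec, h2, hbσ 1]
  -- the complex transfer matrix
  set A : ℂ × ℂ → Matrix (Fin N) (Fin N) ℂ := fun q =>
    1 - matB M R 1 q.1 q.2 * matB M R (-1) q.1 q.2 with hA
  have hAan : ∀ i j, AnalyticAt ℂ (fun q => A q i j) (1, 1) := analyticAt_one_sub_matB M hε hR
  set s : Fin N → ℂ := fun i => (σ 1 i : ℂ) with hs
  have hAt : ∀ t ∈ Set.Ioc (0 : ℝ) 1, ∀ i,
      (A ((t : ℂ), 1)).mulVec s i = ((σ 1 i - (K t).mulVec (σ 1) i : ℝ) : ℂ) := by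
    intro t ht i
    simp only [hA, Matrix.sub_mulVec, Matrix.one_mulVec, hKB t ht, Pi.sub_apply]
    simp [Matrix.mulVec, dotProduct, hs]
  have hA11s : (A (1, 1)).mulVec s = 0 := by
    ext i
    have := hAt 1 one_mem i
    rw [Complex.ofReal_one] at this
    rw [this, hKσ]
    simp
  have hA11 : A (1, 1) = (1 - K 1).map (fun y => (y : ℂ)) := by
    have h1 := hKB 1 one_mem
    rw [Complex.ofReal_one] at h1
    simp only [hA, h1]
    exact (((Complex.ofRealHom.mapMatrix : Matrix (Fin N) (Fin N) ℝ →+* _).map_sub 1 (K 1)).trans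
      (by rw [map_one]; rfl)).symm
  -- the derivative in the first variable
  have hcurve : ∀ {f : ℂ × ℂ → ℂ}, AnalyticAt ℂ f (1, 1) → AnalyticAt ℂ (fun t => f (t, 1)) 1 :=
    fun hf => hf.fun_comp (f := fun t : ℂ => (t, (1 : ℂ))) (analyticAt_id.prod analyticAt_const)
  set v : ℂ → Fin N → ℂ := fun t => (A (t, 1)).mulVec s with hv
  have hvan : ∀ i, AnalyticAt ℂ (fun t => v t i) 1 := by
    intro i
    simp only [hv, Matrix.mulVec, dotProduct]
    exact Finset.analyticAt_fun_sum _ fun m _ => (hcurve (hAan i m)).mul analyticAt_const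
  have hv1 : ∀ i, v 1 i = 0 := fun i => congrFun hA11s i
  -- From `K t ≤ t K 1` and `K 1 σ = σ` one gets `(1 - K t)σ ≥ (1 - t)σ`, so the slope at 1 is at
  -- most `-σ`.
  have hv' : ∀ i, (deriv (fun t => v t i) 1).im = 0 ∧ (deriv (fun t => v t i) 1).re ≤ -σ 1 i := by
    intro i
    refine im_eq_zero_and_re_le_of_hasDerivAt (hvan i).differentiableAt.hasDerivAt (hv1 i) ?_
    intro t ht
    have ht' : t ∈ Set.Ioc (0 : ℝ) 1 := ⟨ht.1, ht.2.le⟩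
    simp only [hv]
    rw [hAt t ht' i, Complex.ofReal_im, Complex.ofReal_re]
    refine ⟨rfl, ?_⟩
    have h1 : (K t).mulVec (σ 1) i ≤ t * σ 1 i := by
      conv_rhs => rw [← hKσ]
      simp only [Matrix.mulVec, dotProduct, Finset.mul_sum]
      refine Finset.sum_le_sum fun m _ => ?_
      rw [← mul_assoc]
      exact mul_le_mul_of_nonneg_right (hKt t ht' i m) (hσ0 1 m).le
    linarith
  set w : Fin N → ℝ := fun i => (deriv (fun t => v t i) 1).re with hw
  have hw0 : ∀ i, w i < 0 := fun i => (hv' i).2.trans_lt (neg_lt_zero.mpr (hσ0 1 i))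
  have hwv : ∀ i, deriv (fun t => v t i) 1 = (w i : ℂ) := fun i =>
    Complex.ext (by simp [hw]) (by simpa using (hv' i).1)
  let a : Fin N := ⟨0, by omega⟩
  have hdet : ((A (1, 1)).updateCol a fun i => (w i : ℂ)).det ≠ 0 := by
    have h1 := det_updateCol_ne_zero hKpos (hσ0 1) hKσ hw0 a
    have h2 : (A (1, 1)).updateCol a (fun i => (w i : ℂ))
        = ((1 - K 1).updateCol a w).map Complex.ofRealHom := by
      rw [hA11, Matrix.map_updateCol]
      rfl
    rw [h2]
    have h3 := (Complex.ofRealHom.map_det ((1 - K 1).updateCol a w)).symm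
    rw [RingHom.mapMatrix_apply] at h3
    rw [h3]
    simpa using h1
  have hsa : s a ≠ 0 := by simpa [hs] using (hσ0 1 a).ne'
  have hh11 : hFun M R 1 1 = 0 := by
    have h1 := det_mul_eq_adjugate_mulVec (A (1, 1)) s a
    rw [hA11s, Matrix.mulVec_zero, Pi.zero_apply] at h1
    exact (mul_eq_zero.mp h1).resolve_right hsa
  refine ⟨hh11, ?_, ?_⟩
  -- By the adjugate identity `h * s a` is entry `a` of `adj A (A s)`. As `A s` vanishes at `t = 1`,
  -- only its derivative `w` survives in the product rule, and Cramer's rule turns the result into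
  -- the determinant in `hdet`.
  · have h1 : HasDerivAt (fun t => hFun M R t 1 * s a)
        (∑ m, (A (1, 1)).adjugate a m * (w m : ℂ)) 1 := by
      have h2 : (fun t => hFun M R t 1 * s a) = fun t => ∑ m, (A (t, 1)).adjugate a m * v t m := by
        funext t
        exact det_mul_eq_adjugate_mulVec (A (t, 1)) s a
      rw [h2]
      refine HasDerivAt.fun_sum fun m _ => ?_
      have h3 := (hcurve (analyticAt_adjugate hAan a m)).differentiableAt.hasDerivAt.mul
        (hvan m).differentiableAt.hasDerivAt
      rw [hwv, hv1, mul_zero, zero_add] at h3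
      exact h3
    have h4 : ∑ m, (A (1, 1)).adjugate a m * (w m : ℂ) ≠ 0 := by
      have := adjugate_mulVec_apply (A (1, 1)) (fun i => (w i : ℂ)) a
      rw [← this] at hdet
      exact hdet
    intro h5
    have h6 : HasDerivAt (fun t => hFun M R t 1 * s a) (0 * s a) 1 := by
      have h7 := (hcurve (analyticAt_hFun M hε hR)).differentiableAt.hasDerivAt
      have h8 : deriv (fun t => hFun M R t 1) 1 = 0 := h5
      simp only [h8] at h7
      exact h7.mul_const (s a)
    rw [zero_mul] at h6
    exact h4 (h1.unique h6)
  -- Where `det A = 0` every column of the adjugate lies in the kernel of `A` and depends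
  -- continuously on the parameters. Column `e`, scaled by `c`, takes the required value at (1, 1).
  · obtain ⟨e, c, -, hc⟩ := exists_adjugate_col_eq hA11s hsa hdet
    set V : ℂ × ℂ → Fin N → ℂ := fun q i => c * (A q).adjugate i e with hV
    have hVan : ∀ i, ContinuousAt (fun q => V q i) (1, 1) := fun i =>
      continuousAt_const.mul (analyticAt_adjugate hAan i e).continuousAt
    have hne : (-1 : ℤˣ) ≠ 1 := by decide
    refine ⟨fun q k => if k = 1 then V q else (matB M R (-1) q.1 q.2).mulVec (V q),
      fun k i => ?_, fun q hq => ?_, fun i => ?_⟩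
    · by_cases hk : k = 1
      · simp only [if_pos hk]
        exact hVan i
      · simp only [if_neg hk, Matrix.mulVec, dotProduct]
        exact tendsto_finsetSum _ fun m _ =>
          (analyticAt_matB M hε hR (-1) i m).continuousAt.mul (hVan m)
    · refine isTransferFixed_of_mulVec M R q.1 q.2 ?_
      have h1 : V q = c • ((A q).adjugate.mulVec (Pi.single e 1)) := by
        ext i; simp [hV]
      have h2 : (A q).det = 0 := hq
      change (A q).mulVec (V q) = 0
      rw [h1, Matrix.mulVec_smul, Matrix.mulVec_mulVec, Matrix.mul_adjugate, h2, zero_smul,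
        Matrix.zero_mulVec, smul_zero]
    · have h1 : V (1, 1) = s := funext fun i => hc i
      have h2 : (matB M R (-1) 1 1).mulVec s i = (σ (-1) i : ℂ) := by
        have h3 := hbB 1 one_mem (-1)
        rw [Complex.ofReal_one] at h3
        have h4 := hbσ (-1)
        rw [neg_neg] at h4
        rw [h3, ← h4]
        simp [Matrix.mulVec, dotProduct, hs]
      simp only [if_true, if_neg hne, h1]
      rw [h2]
      simp only [hs]
      exact_mod_cast hσ1 i

end Transfer

end WindowWalk

end

noncomputable section

namespace WindowWalk

/-! ### The eigenvalue exponent ψ and its first two derivatives. -/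

section Implicit

open scoped ContDiff

theorem pair_eq_smul_add_smul (a b : ℂ) : ((a, b) : ℂ × ℂ) = a • (1, 0) + b • (0, 1) := by
  simp

/-- The logarithmic form of the implicit function of an analytic equation `h t z = 0` at `(1, 1)`,
with its first two derivatives. -/
theorem exists_log_implicit {h : ℂ → ℂ → ℂ} (hh : AnalyticAt ℂ (fun q : ℂ × ℂ => h q.1 q.2) (1, 1))
    (h0 : h 1 1 = 0) (h1 : d1 h ≠ 0) :
    ∃ ψ : ℂ → ℂ, AnalyticAt ℂ ψ 0 ∧ ψ 0 = 0 ∧ deriv ψ 0 = gammaOf h ∧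
      deriv (deriv ψ) 0 = sigmaSqOf h ∧
      ∀ᶠ θ in 𝓝 (0 : ℂ), h (Complex.exp (-ψ θ)) (Complex.exp θ) = 0 := by
  set H : ℂ × ℂ → ℂ := fun q => h q.1 q.2 with hH
  set D : ℂ × ℂ → ℂ × ℂ →L[ℂ] ℂ := fderiv ℂ H with hD
  have hDan : AnalyticAt ℂ D (1, 1) := hh.fderiv
  have hHD : ∀ᶠ q in 𝓝 ((1 : ℂ), (1 : ℂ)), HasFDerivAt H (D q) q :=
    hh.eventually_analyticAt.mono fun q hq => hq.differentiableAt.hasFDerivAt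
  have hcurve1 : ∀ {q : ℂ × ℂ}, HasFDerivAt H (D q) q →
      HasDerivAt (fun t => h t q.2) (D q (1, 0)) q.1 := fun {q} hq =>
    HasFDerivAt.comp_hasDerivAt (f := fun t : ℂ => (t, q.2)) q.1 hq
      ((hasDerivAt_id q.1).prodMk (hasDerivAt_const q.1 q.2))
  have hcurve2 : ∀ {q : ℂ × ℂ}, HasFDerivAt H (D q) q →
      HasDerivAt (fun z => h q.1 z) (D q (0, 1)) q.2 := fun {q} hq =>
    HasFDerivAt.comp_hasDerivAt (f := fun z : ℂ => (q.1, z)) q.2 hq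
      ((hasDerivAt_const q.2 q.1).prodMk (hasDerivAt_id q.2))
  have c1 : ContinuousAt (fun t : ℂ => (t, (1 : ℂ))) 1 := by fun_prop
  have c2 : ContinuousAt (fun z : ℂ => ((1 : ℂ), z)) 1 := by fun_prop
  -- the first partial derivatives
  have hd1 : d1 h = D (1, 1) (1, 0) := (hcurve1 hHD.self_of_nhds).deriv
  have hd2 : d2 h = D (1, 1) (0, 1) := (hcurve2 hHD.self_of_nhds).deriv
  -- the second partial derivatives
  set D2 : ℂ × ℂ →L[ℂ] ℂ × ℂ →L[ℂ] ℂ := fderiv ℂ D (1, 1) with hD2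
  have hDD : HasFDerivAt D D2 (1, 1) := hDan.differentiableAt.hasFDerivAt
  have hDt : ∀ w, HasDerivAt (fun t : ℂ => D (t, 1) w) (D2 (1, 0) w) 1 := fun w => by
    have := HasFDerivAt.comp_hasDerivAt (f := fun t : ℂ => (t, (1 : ℂ))) 1 hDD
      ((hasDerivAt_id (1 : ℂ)).prodMk (hasDerivAt_const (1 : ℂ) (1 : ℂ)))
    simpa using this.clm_apply (hasDerivAt_const (1 : ℂ) w)
  have hDz : ∀ w, HasDerivAt (fun z : ℂ => D (1, z) w) (D2 (0, 1) w) 1 := fun w => by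
    have := HasFDerivAt.comp_hasDerivAt (f := fun z : ℂ => ((1 : ℂ), z)) 1 hDD
      ((hasDerivAt_const (1 : ℂ) (1 : ℂ)).prodMk (hasDerivAt_id (1 : ℂ)))
    simpa using this.clm_apply (hasDerivAt_const (1 : ℂ) w)
  have hd11 : d11 h = D2 (1, 0) (1, 0) := by
    rw [d11, iteratedDeriv_succ, iteratedDeriv_one]
    refine (EventuallyEq.deriv_eq ?_).trans (hDt (1, 0)).deriv
    exact (c1.eventually hHD).mono fun t ht => (hcurve1 ht).deriv
  have hd22 : d22 h = D2 (0, 1) (0, 1) := by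
    rw [d22, iteratedDeriv_succ, iteratedDeriv_one]
    refine (EventuallyEq.deriv_eq ?_).trans (hDz (0, 1)).deriv
    exact (c2.eventually hHD).mono fun z hz => (hcurve2 hz).deriv
  have hd21 : d21 h = D2 (0, 1) (1, 0) := by
    rw [d21]
    refine (EventuallyEq.deriv_eq ?_).trans (hDz (1, 0)).deriv
    exact (c2.eventually hHD).mono fun z hz => (hcurve1 hz).deriv
  have hsymm : D2 (1, 0) (0, 1) = D2 (0, 1) (1, 0) :=
    (hh.contDiffAt (n := ω)).isSymmSndFDerivAt (by simp) (1, 0) (0, 1)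
  -- the implicit function
  set G : ℂ × ℂ → ℂ := fun q => h q.2 q.1 with hG
  have hGan : AnalyticAt ℂ G (1, 1) :=
    AnalyticAt.fun_comp (f := fun q : ℂ × ℂ => (q.2, q.1)) (x := ((1 : ℂ), (1 : ℂ))) hh
      (analyticAt_snd.prod analyticAt_fst)
  have hGc : ContDiffAt ℂ ω G (1, 1) := hGan.contDiffAt
  have hinv : (fderiv ℂ G (1, 1) ∘L .inr ℂ ℂ ℂ).IsInvertible := by
    refine ⟨ContinuousLinearEquiv.unitsEquivAut ℂ (Units.mk0 _ h1), ?_⟩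
    ext
    have h2 : HasDerivAt (fun t => h t 1) (fderiv ℂ G (1, 1) (0, 1)) 1 :=
      HasFDerivAt.comp_hasDerivAt (f := fun t : ℂ => ((1 : ℂ), t)) 1
        hGan.differentiableAt.hasFDerivAt
        ((hasDerivAt_const (1 : ℂ) (1 : ℂ)).prodMk (hasDerivAt_id (1 : ℂ)))
    simpa [d1] using h2.deriv
  have hω : (ω : ℕ∞ω) ≠ 0 := by simp
  set τ : ℂ → ℂ := hGc.implicitFunction hω hinv with hτ
  have hτ1 : τ 1 = 1 := hGc.implicitFunction_apply_self hω hinv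
  have hτan : AnalyticAt ℂ τ 1 :=
    (hGc.contDiffAt_implicitFunction hω hinv).analyticAt
  have hτ0 : ∀ᶠ z in 𝓝 (1 : ℂ), h (τ z) z = 0 := by
    filter_upwards [hGc.eventually_apply_implicitFunction hω hinv] with z hz
    exact hz.trans h0
  have hexp : Tendsto Complex.exp (𝓝 0) (𝓝 1) := by
    simpa using (Complex.continuous_exp.tendsto 0)
  have hτexp : AnalyticAt ℂ (fun θ => τ (Complex.exp θ)) 0 :=
    AnalyticAt.fun_comp (f := Complex.exp) (x := 0) (by rwa [Complex.exp_zero]) (by fun_prop)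
  -- With λ = exp(-ψ(θ)) and z = exp(θ), the eigenvalue 1/λ is exp(ψ(θ)).
  set ψ : ℂ → ℂ := fun θ => -Complex.log (τ (Complex.exp θ)) with hψ
  have hψan : AnalyticAt ℂ ψ 0 := by
    refine (hτexp.clog ?_).neg
    rw [Complex.exp_zero, hτ1]
    exact Complex.one_mem_slitPlane
  have hψ0 : ψ 0 = 0 := by simp [hψ, hτ1]
  have hψτ : ∀ᶠ θ in 𝓝 (0 : ℂ), Complex.exp (-ψ θ) = τ (Complex.exp θ) := by
    have hne : ∀ᶠ θ in 𝓝 (0 : ℂ), τ (Complex.exp θ) ≠ 0 := by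
      refine hτexp.continuousAt.eventually_ne ?_
      rw [Complex.exp_zero, hτ1]
      exact one_ne_zero
    filter_upwards [hne] with θ hθ
    rw [hψ, neg_neg, Complex.exp_log hθ]
  have hzero : ∀ᶠ θ in 𝓝 (0 : ℂ), h (Complex.exp (-ψ θ)) (Complex.exp θ) = 0 := by
    filter_upwards [hψτ, hexp.eventually hτ0] with θ h2 h3
    rw [h2, h3]
  -- differentiate the equation along the curve
  set c : ℂ → ℂ × ℂ := fun θ => (Complex.exp (-ψ θ), Complex.exp θ) with hc
  set c' : ℂ → ℂ × ℂ := fun θ => (Complex.exp (-ψ θ) * -deriv ψ θ, Complex.exp θ) with hc'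
  have hc0 : c 0 = (1, 1) := by simp [hc, hψ0]
  have hc'0 : c' 0 = (-deriv ψ 0, 1) := by simp [hc', hψ0]
  have hcd : ∀ᶠ θ in 𝓝 (0 : ℂ), HasDerivAt c (c' θ) θ := by
    filter_upwards [hψan.eventually_analyticAt] with θ hθ
    exact (hθ.differentiableAt.hasDerivAt.neg.cexp).prodMk (Complex.hasDerivAt_exp θ)
  have hccont : ContinuousAt c 0 := hcd.self_of_nhds.continuousAt
  have hfirst : ∀ᶠ θ in 𝓝 (0 : ℂ), D (c θ) (c' θ) = 0 := by
    have hHD' : ∀ᶠ θ in 𝓝 (0 : ℂ), HasFDerivAt H (D (c θ)) (c θ) :=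
      hccont.eventually (by rw [hc0]; exact hHD)
    filter_upwards [hzero.eventually_nhds, hcd, hHD'] with θ h2 h3 h4
    have h5 := h4.comp_hasDerivAt θ h3
    have h6 : HasDerivAt (H ∘ c) 0 θ :=
      (hasDerivAt_const θ (0 : ℂ)).congr_of_eventuallyEq h2
    exact h5.unique h6
  -- The derivative of `hfirst` at 0; the last argument is the second derivative there of (exp(-ψ),
  -- exp).
  have hsecond : D2 (c' 0) (c' 0) + D (1, 1) (-deriv (deriv ψ) 0 + deriv ψ 0 ^ 2, 1) = 0 := by
    have hDc : HasDerivAt (fun θ => D (c θ)) (D2 (c' 0)) 0 :=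
      HasFDerivAt.comp_hasDerivAt (f := c) 0 (by rw [hc0]; exact hDD) hcd.self_of_nhds
    have hc'' : HasDerivAt c' (-deriv (deriv ψ) 0 + deriv ψ 0 ^ 2, 1) 0 := by
      have e1 := hψan.differentiableAt.hasDerivAt.neg.cexp
      have e2 := hψan.deriv.differentiableAt.hasDerivAt.neg
      have e3 := (e1.mul e2).prodMk (Complex.hasDerivAt_exp 0)
      convert! e3 using 1
      simp [hψ0]
      ring
    have e4 := hDc.clm_apply hc''
    rw [hc0] at e4
    have e5 : HasDerivAt (fun θ => D (c θ) (c' θ)) 0 0 :=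
      (hasDerivAt_const (0 : ℂ) (0 : ℂ)).congr_of_eventuallyEq hfirst
    exact e4.unique e5
  have hlin : ∀ a b : ℂ, D (1, 1) (a, b) = a * d1 h + b * d2 h := by
    intro a b
    rw [pair_eq_smul_add_smul a b, map_add, map_smul, map_smul, hd1, hd2]
    rfl
  have hquad : ∀ a b : ℂ, D2 (a, b) (a, b)
      = a ^ 2 * d11 h + 2 * a * b * d21 h + b ^ 2 * d22 h := by
    intro a b
    rw [pair_eq_smul_add_smul a b, map_add, map_smul, map_smul, hd11, hd21, hd22]
    simp only [add_apply, smul_apply, map_add, map_smul,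
      smul_eq_mul, hsymm]
    ring
  have hγ : deriv ψ 0 = gammaOf h := by
    have h2 := hfirst.self_of_nhds
    rw [hc0, hc'0, hlin] at h2
    rw [gammaOf, eq_div_iff h1]
    linear_combination -h2
  refine ⟨ψ, hψan, hψ0, hγ, ?_, hzero⟩
  rw [hc'0, hquad, hlin, hγ] at hsecond
  rw [sigmaSqOf, eq_div_iff h1]
  linear_combination -hsecond

/-- The Taylor expansion of second order of an analytic function. -/
theorem exists_eq_add_sq_mul {ψ : ℂ → ℂ} (hψ : AnalyticAt ℂ ψ 0) (h0 : ψ 0 = 0) :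
    ∃ g : ℂ → ℂ, ContinuousAt g 0 ∧ g 0 = deriv (deriv ψ) 0 / 2 ∧
      ∀ θ, ψ θ = deriv ψ 0 * θ + θ ^ 2 * g θ := by
  have hds : ∀ {f : ℂ → ℂ}, AnalyticAt ℂ f 0 → AnalyticAt ℂ (dslope f 0) 0 := by
    rintro f ⟨p, hp⟩
    exact hp.has_fpower_series_dslope_fslope.analyticAt
  set g₁ := dslope ψ 0 with hg₁
  set g := dslope g₁ 0 with hg
  have hg₁an : AnalyticAt ℂ g₁ 0 := hds hψ
  have hgan : AnalyticAt ℂ g 0 := hds hg₁an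
  have e1 : ∀ θ, ψ θ = θ * g₁ θ := fun θ => by
    have := sub_smul_dslope ψ 0 θ
    rw [sub_zero, h0, sub_zero, smul_eq_mul] at this
    exact this.symm
  have e2 : ∀ θ, g₁ θ = deriv ψ 0 + θ * g θ := fun θ => by
    have := sub_smul_dslope g₁ 0 θ
    rw [sub_zero, smul_eq_mul, hg₁, dslope_same] at this
    rw [hg, hg₁]
    linear_combination -this
  have e3 : ∀ θ, ψ θ = deriv ψ 0 * θ + θ ^ 2 * g θ := fun θ => by rw [e1, e2]; ring
  refine ⟨g, hgan.continuousAt, ?_, e3⟩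
  have e4 : ∀ᶠ θ in 𝓝 (0 : ℂ), deriv ψ θ = deriv ψ 0 + 2 * θ * g θ + θ ^ 2 * deriv g θ := by
    filter_upwards [hgan.eventually_analyticAt] with θ hθ
    have h1 := ((hasDerivAt_id θ).const_mul (deriv ψ 0)).add
      (((hasDerivAt_id θ).pow 2).mul hθ.differentiableAt.hasDerivAt)
    have h2 : HasDerivAt ψ (deriv ψ 0 + 2 * θ * g θ + θ ^ 2 * deriv g θ) θ := by
      have h3 : ψ = fun θ => deriv ψ 0 * θ + θ ^ 2 * g θ := funext e3
      rw [h3]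
      convert! h1 using 1
      · rw [← h3]
        simp
        ring
    exact h2.deriv
  have e5 : HasDerivAt (fun θ => deriv ψ 0 + 2 * θ * g θ + θ ^ 2 * deriv g θ) (2 * g 0) 0 := by
    have h1 := ((((hasDerivAt_id (0 : ℂ)).const_mul 2).mul hgan.differentiableAt.hasDerivAt).const_add
      (deriv ψ 0)).add (((hasDerivAt_id (0 : ℂ)).pow 2).mul
        hgan.deriv.differentiableAt.hasDerivAt)
    convert! h1 using 1
    simp
  rw [EventuallyEq.deriv_eq e4, e5.deriv]
  ring

end Implicit

end WindowWalk

end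

noncomputable section

namespace WindowWalk

/-! ### Perturbed eigenfunctions on the arrow set. -/

section StepOperator

variable {N : ℕ}

/-- The transition operator of the Markov chain. -/
def stepOp (p : Fin N → Fin N → ℤˣ → ℝ) (f : Arr N → ℂ) (x : Arr N) : ℂ :=
  ∑ j ∈ Finset.univ.erase x.target, ∑ k : ℤˣ, (p x.target j k : ℂ) * f (x.mulGen j k)

theorem tendsto_blockSol {α : Type*} {l : Filter α} {x Z : α → Fin N → Fin N → ℤˣ → ℂ}
    {σ : α → ℤˣ → Fin N → ℂ} {x' Z' : Fin N → Fin N → ℤˣ → ℂ} {σ' : ℤˣ → Fin N → ℂ}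
    (hx : ∀ i j k, i ≠ j → Tendsto (fun a => x a i j k) l (𝓝 (x' i j k)))
    (hZ : ∀ i j k, Tendsto (fun a => Z a i j k) l (𝓝 (Z' i j k)))
    (hσ : ∀ k i, Tendsto (fun a => σ a k i) l (𝓝 (σ' k i))) (i : Fin N) (k : ℤˣ) (j : Fin N) :
    Tendsto (fun a => blockSol (x a) (Z a) (σ a) i k j) l (𝓝 (blockSol x' Z' σ' i k j)) := by
  unfold blockSol
  refine tendsto_finsetSum _ fun m _ => Tendsto.mul ?_ ?_
  · unfold hat
    split_ifs with h
    exacts [tendsto_const_nhds, hx _ _ _ h]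
  · unfold blockSource
    split_ifs with h
    exacts [(hσ _ _).neg, (hZ _ _ _).mul (hσ _ _)]

theorem stackProd_eq_exp (M : Arr N → ℝ) {θ : ℂ}
    (hθ : ∀ i j k, zPow M (Complex.exp θ) i j k = Complex.exp (θ * (M (gen i j k) : ℂ)))
    (i₀ : Fin N) (s : List (Fin N × ℤˣ)) :
    stackProd (zPow M (Complex.exp θ)) i₀ s = Complex.exp (θ * (stackSum M i₀ s : ℂ)) := by
  induction s with
  | nil => simp [stackProd, stackSum]
  | cons a s ih =>
    rw [stackProd, stackSum, ih, hθ, ← Complex.exp_add]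
    push_cast
    ring_nf

/-- The perturbed eigenfunctions of the transition operator. -/
theorem exists_eigenfunctions (hN : 3 ≤ N) {p : Fin N → Fin N → ℤˣ → ℝ} (hp : IsJumpProb p)
    {M : Arr N → ℝ} (hM : IsGeneratedMetric M) {ε : ℝ} (hε : 0 < ε)
    {R : Fin N → Fin N → ℤˣ → ℂ → ℂ} (hR : IsRFamily p ε R) :
    ∃ ψ : ℂ → ℂ, AnalyticAt ℂ ψ 0 ∧ ψ 0 = 0 ∧ deriv ψ 0 = gammaOf (hFun M R) ∧
      deriv (deriv ψ) 0 = sigmaSqOf (hFun M R) ∧ ∃ F : ℂ → Arr N → ℂ,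
        (∀ᶠ θ in 𝓝 (0 : ℂ), ∀ x, stepOp p (F θ) x = Complex.exp (ψ θ) * F θ x) ∧
        ∀ δ : ℝ, 0 < δ → ∀ᶠ θ in 𝓝 (0 : ℂ), ∀ x,
          ‖F θ x - Complex.exp (θ * (M x : ℂ))‖ ≤ δ * ‖Complex.exp (θ * (M x : ℂ))‖ := by
  obtain ⟨h0, h1, S, hS, hSfix, hS1⟩ := hFun_one_one hN hp M hε hR
  obtain ⟨ψ, hψan, hψ0, hψ1, hψ2, hψ⟩ := exists_log_implicit (analyticAt_hFun M hε hR) h0 h1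
  refine ⟨ψ, hψan, hψ0, hψ1, hψ2, fun θ x => eigenfun
    (fun i j k => R i j k (Complex.exp (-ψ θ))) (zPow M (Complex.exp θ))
    (S (Complex.exp (-ψ θ), Complex.exp θ)) x.source x.stack, ?_, ?_⟩
  · have htend : Tendsto (fun θ => Complex.exp (-ψ θ)) (𝓝 0) (𝓝 1) := by
      have : ContinuousAt (fun θ => Complex.exp (-ψ θ)) 0 := hψan.continuousAt.neg.cexp
      simpa [ContinuousAt, hψ0] using this
    have hmem : ∀ᶠ θ in 𝓝 (0 : ℂ), Complex.exp (-ψ θ) ∈ Metric.ball (0 : ℂ) (1 + ε) :=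
      htend.eventually (Metric.isOpen_ball.mem_nhds
        (by rw [mem_ball_zero_iff, norm_one]; linarith))
    filter_upwards [hψ, hmem] with θ h2 h3 x
    have h4 := transition_eigenfun (q := fun i j k => (p i j k : ℂ))
      (x := fun i j k => R i j k (Complex.exp (-ψ θ))) (Complex.exp_ne_zero (-ψ θ))
      (fun i j k hij => hR.equation i j k hij _ h3)
      (hSfix (Complex.exp (-ψ θ), Complex.exp θ) h2) x.isReducedStack
    rw [x.stackTarget_stack, ← Complex.exp_neg, neg_neg] at h4
    rw [stepOp, ← h4]
    refine Finset.sum_congr rfl fun m _ => Finset.sum_congr rfl fun k _ => ?_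
    rw [Arr.stack_mulGen]
    rfl
  · intro δ hδ
    have one_mem : (1 : ℂ) ∈ Metric.ball (0 : ℂ) (1 + ε) := by
      rw [mem_ball_zero_iff, norm_one]; linarith
    have hψt : Tendsto ψ (𝓝 0) (𝓝 0) := by
      have := hψan.continuousAt.tendsto
      rwa [hψ0] at this
    have ht : Tendsto (fun θ => Complex.exp (-ψ θ)) (𝓝 0) (𝓝 1) := by
      simpa using hψt.neg.cexp
    have hz : Tendsto Complex.exp (𝓝 0) (𝓝 1) := by
      simpa using Complex.continuous_exp.tendsto 0
    have hx : ∀ i j k, i ≠ j →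
        Tendsto (fun θ => R i j k (Complex.exp (-ψ θ))) (𝓝 0) (𝓝 (R i j k 1)) :=
      fun i j k hij => (hR.analytic i j k hij 1 one_mem).continuousAt.tendsto.comp ht
    -- On the principal branch, the power of exp(θ) is the exponential of the product as long as |Im
    -- θ| < π.
    have hθ : ∀ᶠ θ in 𝓝 (0 : ℂ), ∀ i j k,
        zPow M (Complex.exp θ) i j k = Complex.exp (θ * (M (gen i j k) : ℂ)) := by
      have h2 : ∀ᶠ θ in 𝓝 (0 : ℂ), θ.im ∈ Set.Ioo (-Real.pi) Real.pi :=
        (Complex.continuous_im.tendsto 0).eventually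
          (Ioo_mem_nhds (by simpa using Real.pi_pos) (by simpa using Real.pi_pos))
      filter_upwards [h2] with θ h2 i j k
      rw [zPow, Complex.cpow_def_of_ne_zero (Complex.exp_ne_zero _),
        Complex.log_exp h2.1 h2.2.le]
    have hZ : ∀ i j k, Tendsto (fun θ => zPow M (Complex.exp θ) i j k) (𝓝 0) (𝓝 1) := by
      intro i j k
      have h2 : Tendsto (fun θ : ℂ => Complex.exp (θ * (M (gen i j k) : ℂ))) (𝓝 0) (𝓝 1) :=
        Continuous.tendsto' (by fun_prop) _ _ (by simp)
      exact h2.congr' (hθ.mono fun θ h => (h i j k).symm)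
    have hσ : ∀ k i, Tendsto (fun θ => S (Complex.exp (-ψ θ), Complex.exp θ) k i) (𝓝 0)
        (𝓝 (S (1, 1) k i)) := fun k i => (hS k i).tendsto.comp (ht.prodMk_nhds hz)
    have hfix := hSfix (1, 1) h0
    rw [zPow_one] at hfix
    -- The finitely many values R(1) lie below 1 with a common margin; near θ = 0 this supplies the
    -- factor by which relative errors contract.
    obtain ⟨ρ, hρ, hρ1⟩ : ∃ ρ : ℝ, (∀ i j k, i ≠ j → ‖R i j k 1‖ < ρ) ∧ ρ < 1 := by
      have h2 : ∀ᶠ ρ : ℝ in 𝓝[<] 1, ∀ i j k, i ≠ j → ‖R i j k 1‖ < ρ := by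
        simp only [eventually_all]
        intro i j k hij
        obtain ⟨r, hr, hr'⟩ := hR.mem_Ioo i j k hij 1 ⟨one_pos, le_rfl⟩
        rw [Complex.ofReal_one] at hr'
        rw [hr', Complex.norm_real, Real.norm_of_nonneg hr.1.le]
        exact nhdsWithin_le_nhds (lt_mem_nhds hr.2)
      exact (h2.and self_mem_nhdsWithin).exists
    have e1 : ∀ᶠ θ in 𝓝 (0 : ℂ), ∀ i j k, i ≠ j →
        ‖R j i k (Complex.exp (-ψ θ))‖ ≤ ρ * ‖zPow M (Complex.exp θ) i j k‖ := by
      simp only [eventually_all]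
      intro i j k hij
      have h2 := (hx j i k hij.symm).norm
      have h3 := ((hZ i j k).norm).const_mul ρ
      rw [norm_one, mul_one] at h3
      exact (h2.eventually_lt h3 (hρ j i k hij.symm)).mono fun θ h => h.le
    -- At θ = 0 the eigenfunction is the constant 1 and the left side is 0, by
    -- `blockSol_eq_one_sub`; continuity does the rest.
    have e2 : ∀ᶠ θ in 𝓝 (0 : ℂ), ∀ i j k, i ≠ j →
        ‖R j i k (Complex.exp (-ψ θ)) + blockSol (fun i j k => R i j k (Complex.exp (-ψ θ)))
          (zPow M (Complex.exp θ)) (S (Complex.exp (-ψ θ), Complex.exp θ)) i k j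
          - zPow M (Complex.exp θ) i j k‖
        ≤ (1 - ρ) * δ * ‖zPow M (Complex.exp θ) i j k‖ := by
      simp only [eventually_all]
      intro i j k hij
      have h2 := (((hx j i k hij.symm).add (tendsto_blockSol hx hZ hσ i k j)).sub (hZ i j k)).norm
      have h3 := ((hZ i j k).norm).const_mul ((1 - ρ) * δ)
      rw [blockSol_eq_one_sub hfix hS1 i j k hij, add_sub_cancel, sub_self, norm_zero] at h2
      rw [norm_one, mul_one] at h3
      exact (h2.eventually_lt h3 (mul_pos (sub_pos.mpr hρ1) hδ)).mono fun θ h => h.le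
    have e3 : ∀ᶠ θ in 𝓝 (0 : ℂ), ∀ i, ‖S (Complex.exp (-ψ θ), Complex.exp θ) 1 i
        + S (Complex.exp (-ψ θ), Complex.exp θ) (-1) i - 1‖ ≤ δ := by
      simp only [eventually_all]
      intro i
      have h2 := (((hσ 1 i).add (hσ (-1) i)).sub_const 1).norm
      rw [hS1, sub_self, norm_zero] at h2
      exact (h2.eventually (gt_mem_nhds hδ)).mono fun θ h => h.le
    filter_upwards [hθ, e1, e2, e3] with θ h2 h3 h4 h5 x
    have h6 := norm_eigenfun_sub_le h3 h4 (h5 x.source) x.isReducedStack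
    rw [stackProd_eq_exp M h2, ← hM.eq_stackSum] at h6
    exact h6

end StepOperator

end WindowWalk

end

noncomputable section

namespace WindowWalk

/-! ### Iterates of the transition operator. -/

section Iterates

variable {N : ℕ}

theorem norm_stepOp_le {p : Fin N → Fin N → ℤˣ → ℝ} (hp : IsJumpProb p) {f g : Arr N → ℂ}
    (h : ∀ x, ‖f x‖ ≤ (g x).re) (x : Arr N) : ‖stepOp p f x‖ ≤ (stepOp p g x).re := by
  simp only [stepOp, Complex.re_sum, Complex.re_ofReal_mul]
  refine (norm_sum_le _ _).trans (Finset.sum_le_sum fun j hj => (norm_sum_le _ _).trans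
    (Finset.sum_le_sum fun k _ => ?_))
  have hp0 := (hp.pos x.target j k (Finset.ne_of_mem_erase hj).symm).le
  rw [norm_mul, Complex.norm_real, Real.norm_of_nonneg hp0]
  exact mul_le_mul_of_nonneg_left (h _) hp0

theorem norm_stepOp_iterate_le {p : Fin N → Fin N → ℤˣ → ℝ} (hp : IsJumpProb p) {f g : Arr N → ℂ}
    (h : ∀ x, ‖f x‖ ≤ (g x).re) (n : ℕ) (x : Arr N) :
    ‖(stepOp p)^[n] f x‖ ≤ ((stepOp p)^[n] g x).re := by
  induction n generalizing f g with
  | zero => exact h x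
  | succ n ih => exact ih (norm_stepOp_le hp h)

theorem stepOp_const {p : Fin N → Fin N → ℤˣ → ℝ} (hp : IsJumpProb p) (c : ℂ) :
    stepOp p (fun _ => c) = fun _ => c := by
  funext x
  simp only [stepOp, ← Finset.sum_mul]
  have := hp.sum_eq_one x.target
  have h2 : ∑ j ∈ Finset.univ.erase x.target, ∑ k : ℤˣ, (p x.target j k : ℂ) = 1 := by
    exact_mod_cast this
  rw [h2, one_mul]

theorem stepOp_iterate_const {p : Fin N → Fin N → ℤˣ → ℝ} (hp : IsJumpProb p) (c : ℂ) (n : ℕ) :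
    (stepOp p)^[n] (fun _ => c) = fun _ => c :=
  Function.iterate_fixed (stepOp_const hp c) n

theorem norm_stepOp_iterate_le_const {p : Fin N → Fin N → ℤˣ → ℝ} (hp : IsJumpProb p)
    {f : Arr N → ℂ} {C : ℝ} (h : ∀ x, ‖f x‖ ≤ C) (n : ℕ) (x : Arr N) :
    ‖(stepOp p)^[n] f x‖ ≤ C := by
  have h1 := norm_stepOp_iterate_le hp (f := f) (g := fun _ => (C : ℂ)) (by simpa using h) n x
  rwa [stepOp_iterate_const hp, Complex.ofReal_re] at h1

theorem stepOp_iterate_sub (p : Fin N → Fin N → ℤˣ → ℝ) (f g : Arr N → ℂ) (n : ℕ) (x : Arr N) :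
    (stepOp p)^[n] (fun y => f y - g y) x = (stepOp p)^[n] f x - (stepOp p)^[n] g x := by
  induction n generalizing f g with
  | zero => rfl
  | succ n ih =>
    have h : stepOp p (fun y => f y - g y) = fun y => stepOp p f y - stepOp p g y := by
      funext y
      simp only [stepOp, mul_sub, Finset.sum_sub_distrib]
    rw [Function.iterate_succ_apply, h, ih]
    rfl

theorem stepOp_iterate_conj (p : Fin N → Fin N → ℤˣ → ℝ) (f : Arr N → ℂ) (n : ℕ) (x : Arr N) :
    (stepOp p)^[n] (fun y => (starRingEnd ℂ) (f y)) x = (starRingEnd ℂ) ((stepOp p)^[n] f x) := by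
  induction n generalizing f with
  | zero => rfl
  | succ n ih =>
    have h : stepOp p (fun y => (starRingEnd ℂ) (f y)) = fun y => (starRingEnd ℂ) (stepOp p f y) := by
      funext y
      simp only [stepOp, map_sum, map_mul, Complex.conj_ofReal]
    rw [Function.iterate_succ_apply, h, ih]
    rfl

theorem stepOp_iterate_eigen {p : Fin N → Fin N → ℤˣ → ℝ} {F : Arr N → ℂ} {c : ℂ}
    (hF : ∀ x, stepOp p F x = c * F x) (a : ℂ) (n : ℕ) (x : Arr N) :
    (stepOp p)^[n] (fun y => a * F y) x = a * c ^ n * F x := by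
  induction n generalizing a with
  | zero => simp
  | succ n ih =>
    have h : stepOp p (fun y => a * F y) = fun y => a * c * F y := by
      funext y
      rw [mul_assoc, ← hF y]
      simp only [stepOp, Finset.mul_sum]
      exact Finset.sum_congr rfl fun j _ => Finset.sum_congr rfl fun k _ => by ring
    rw [Function.iterate_succ_apply, h, ih, pow_succ]
    ring

end Iterates

/-! ### From the Markov property to expectations. -/

section Chain

variable {N : ℕ}

instance : DiscreteMeasurableSpace (Arr N) := ⟨fun _ => trivial⟩

/-- The transition kernel of the Markov chain. -/
def stepKernel (p : Fin N → Fin N → ℤˣ → ℝ) : Kernel (Arr N) (Arr N) :=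
  Kernel.ofFunOfCountable fun x => ∑ j ∈ Finset.univ.erase x.target, ∑ k : ℤˣ,
    ENNReal.ofReal (p x.target j k) • Measure.dirac (x.mulGen j k)

theorem stepKernel_apply (p : Fin N → Fin N → ℤˣ → ℝ) (x : Arr N) :
    stepKernel p x = ∑ j ∈ Finset.univ.erase x.target, ∑ k : ℤˣ,
      ENNReal.ofReal (p x.target j k) • Measure.dirac (x.mulGen j k) := rfl

theorem stepKernel_singleton {p : Fin N → Fin N → ℤˣ → ℝ} (hp : IsJumpProb p) (x y : Arr N) :
    stepKernel p x {y} = ENNReal.ofReal (transProb p x y) := by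
  classical
  have hp0 : ∀ j ∈ Finset.univ.erase x.target, ∀ k, 0 ≤ p x.target j k := fun j hj k =>
    (hp.pos x.target j k (Finset.ne_of_mem_erase hj).symm).le
  have hnn : ∀ j ∈ Finset.univ.erase x.target, ∀ k ∈ (Finset.univ : Finset ℤˣ),
      0 ≤ if y = x.mulGen j k then p x.target j k else 0 := by
    intro j hj k _
    split_ifs
    exacts [hp0 j hj k, le_rfl]
  rw [stepKernel_apply, transProb,
    ENNReal.ofReal_sum_of_nonneg fun j hj => Finset.sum_nonneg fun k hk => by
      convert! hnn j hj k hk, Measure.finsetSum_apply]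
  refine Finset.sum_congr rfl fun j hj => ?_
  rw [ENNReal.ofReal_sum_of_nonneg fun k hk => by convert! hnn j hj k hk, Measure.finsetSum_apply]
  refine Finset.sum_congr rfl fun k _ => ?_
  rw [Measure.smul_apply, Measure.dirac_apply' _ (measurableSet_singleton y), smul_eq_mul]
  by_cases h : y = x.mulGen j k
  · rw [if_pos h, Set.indicator_of_mem (by exact h.symm), Pi.one_apply, mul_one]
  · rw [if_neg h, Set.indicator_of_notMem (by exact fun h' => h h'.symm), mul_zero,
      ENNReal.ofReal_zero]

theorem isMarkovKernel_stepKernel {p : Fin N → Fin N → ℤˣ → ℝ} (hp : IsJumpProb p) :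
    IsMarkovKernel (stepKernel p) := by
  refine ⟨fun x => ⟨?_⟩⟩
  have hp0 : ∀ j ∈ Finset.univ.erase x.target, ∀ k, 0 ≤ p x.target j k := fun j hj k =>
    (hp.pos x.target j k (Finset.ne_of_mem_erase hj).symm).le
  rw [stepKernel_apply, Measure.finsetSum_apply, ← ENNReal.ofReal_one, ← hp.sum_eq_one x.target,
    ENNReal.ofReal_sum_of_nonneg fun j hj => Finset.sum_nonneg fun k _ => hp0 j hj k]
  refine Finset.sum_congr rfl fun j hj => ?_
  rw [ENNReal.ofReal_sum_of_nonneg fun k _ => hp0 j hj k, Measure.finsetSum_apply]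
  exact Finset.sum_congr rfl fun k _ => by simp

theorem integral_stepKernel {p : Fin N → Fin N → ℤˣ → ℝ} (hp : IsJumpProb p) (f : Arr N → ℂ)
    (x : Arr N) : ∫ y, f y ∂(stepKernel p x) = stepOp p f x := by
  have hint : ∀ (j : Fin N) (k : ℤˣ), Integrable f
      (ENNReal.ofReal (p x.target j k) • Measure.dirac (x.mulGen j k)) := fun j k =>
    (integrable_dirac (by simp)).smul_measure ENNReal.ofReal_ne_top
  rw [stepKernel_apply, stepOp, integral_finsetSum_measure fun j _ =>
    integrable_finsetSum_measure.mpr fun k _ => hint j k]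
  refine Finset.sum_congr rfl fun j hj => ?_
  rw [integral_finsetSum_measure fun k _ => hint j k]
  refine Finset.sum_congr rfl fun k _ => ?_
  rw [integral_smul_measure, integral_dirac,
    ENNReal.toReal_ofReal (hp.pos x.target j k (Finset.ne_of_mem_erase hj).symm).le,
    Complex.real_smul]

variable {Ω : Type*} [MeasurableSpace Ω] {P : Measure Ω} {W : ℕ → Ω → Arr N}

/-- The Markov property is given for whole paths. Paths up to time `n` form a countable space, so
agreement at single paths is an equality of measures, and taking total mass removes the dependence
on the past. -/
theorem IsWordChain.measure_succ_eq {p : Fin N → Fin N → ℤˣ → ℝ} (hW : IsWordChain p P W)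
    (n : ℕ) (y : Arr N) :
    P (W (n + 1) ⁻¹' {y}) = ∫⁻ ω, ENNReal.ofReal (transProb p (W n ω) y) ∂P := by
  set T : Ω → Fin (n + 1) → Arr N := fun ω m => W m ω with hT
  have hTm : Measurable T := measurable_pi_lambda _ fun m => hW.measurable m
  have hTs : ∀ v, T ⁻¹' {v} = {ω | ∀ m ≤ n, W m ω = if h : m < n + 1 then v ⟨m, h⟩ else y} := by
    intro v
    ext ω
    simp only [hT, Set.mem_preimage, Set.mem_singleton_iff, Set.mem_ofPred_eq, funext_iff]
    constructor
    · intro h m hm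
      rw [dif_pos (Nat.lt_succ_of_le hm)]
      exact h ⟨m, Nat.lt_succ_of_le hm⟩
    · intro h m
      have := h m (Nat.le_of_lt_succ m.2)
      rwa [dif_pos m.2] at this
  have hlast : ∀ ω, W n ω = T ω (Fin.last n) := fun ω => rfl
  have hstep : ∀ v, P (T ⁻¹' {v} ∩ W (n + 1) ⁻¹' {y})
      = P (T ⁻¹' {v}) * ENNReal.ofReal (transProb p (v (Fin.last n)) y) := by
    intro v
    have h1 := hW.markov n fun m => if h : m < n + 1 then v ⟨m, h⟩ else y
    rw [← hTs, dif_pos (Nat.lt_succ_self n), dif_neg (lt_irrefl (n + 1))] at h1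
    rw [show Fin.last n = ⟨n, Nat.lt_succ_self n⟩ from rfl, ← h1]
    congr 1
    ext ω
    rw [Set.mem_inter_iff, hTs]
    simp only [Set.mem_preimage, Set.mem_singleton_iff, Set.mem_ofPred_eq]
    constructor
    · rintro ⟨h2, h3⟩ m hm
      rcases Nat.le_succ_iff.mp hm with h | h
      · exact h2 m h
      · subst h
        rw [dif_neg (lt_irrefl _), h3]
    · intro h2
      refine ⟨fun m hm => h2 m (hm.trans (Nat.le_succ n)), ?_⟩
      have := h2 (n + 1) le_rfl
      rwa [dif_neg (lt_irrefl _)] at this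
  have hmeas : (P.restrict (W (n + 1) ⁻¹' {y})).map T = (P.map T).withDensity
      fun v => ENNReal.ofReal (transProb p (v (Fin.last n)) y) := by
    refine Measure.ext_of_singleton fun v => ?_
    rw [Measure.map_apply hTm (measurableSet_singleton v),
      Measure.restrict_apply (hTm (measurableSet_singleton v)), hstep,
      withDensity_apply _ (measurableSet_singleton v), lintegral_singleton,
      Measure.map_apply hTm (measurableSet_singleton v), mul_comm]
  have h := congrArg (fun μ => μ Set.univ) hmeas
  rw [Measure.map_apply hTm MeasurableSet.univ, Set.preimage_univ,
    Measure.restrict_apply_univ, withDensity_apply _ MeasurableSet.univ, Measure.restrict_univ,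
    lintegral_map (measurable_of_countable _) hTm] at h
  exact h

theorem IsWordChain.map_succ {p : Fin N → Fin N → ℤˣ → ℝ} (hp : IsJumpProb p)
    (hW : IsWordChain p P W) (n : ℕ) :
    P.map (W (n + 1)) = (P.map (W n)).bind (stepKernel p) := by
  refine Measure.ext_of_singleton fun y => ?_
  rw [Measure.map_apply (hW.measurable _) (measurableSet_singleton y), hW.measure_succ_eq,
    Measure.bind_apply (measurableSet_singleton y) (Kernel.aemeasurable _),
    lintegral_map (measurable_of_countable _) (hW.measurable n)]
  simp_rw [stepKernel_singleton hp]

theorem IsWordChain.integral_succ [IsFiniteMeasure P] {p : Fin N → Fin N → ℤˣ → ℝ}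
    (hp : IsJumpProb p) (hW : IsWordChain p P W) {f : Arr N → ℂ} {C : ℝ} (hf : ∀ x, ‖f x‖ ≤ C)
    (n : ℕ) : ∫ ω, f (W (n + 1) ω) ∂P = ∫ ω, stepOp p f (W n ω) ∂P := by
  have := isMarkovKernel_stepKernel hp
  have hsm : ∀ (g : Arr N → ℂ) (μ : Measure (Arr N)), AEStronglyMeasurable g μ := fun g μ =>
    (measurable_of_countable g).aestronglyMeasurable
  rw [← integral_map (hW.measurable _).aemeasurable (hsm f _),
    ← integral_map (hW.measurable _).aemeasurable (hsm _ _), hW.map_succ hp]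
  have hfin : IsFiniteMeasure (P.map (W n)) := inferInstance
  rw [Measure.comp_eq_comp_const_apply, Kernel.integral_comp, Kernel.const_apply]
  · simp_rw [integral_stepKernel hp]
  · rw [← Measure.comp_eq_comp_const_apply]
    exact Integrable.of_bound (hsm f _) C (Eventually.of_forall hf)

theorem IsWordChain.integral_eq [IsFiniteMeasure P] {p : Fin N → Fin N → ℤˣ → ℝ}
    (hp : IsJumpProb p) (hW : IsWordChain p P W) {f : Arr N → ℂ} {C : ℝ} (hf : ∀ x, ‖f x‖ ≤ C)
    (n : ℕ) : ∫ ω, f (W n ω) ∂P = ∫ ω, (stepOp p)^[n] f (W 0 ω) ∂P := by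
  induction n generalizing f with
  | zero => rfl
  | succ n ih =>
    rw [hW.integral_succ hp hf, ih (f := stepOp p f) (norm_stepOp_iterate_le_const hp hf 1)]
    rfl

/-- Lets bounds whose constant depends on the initial arrow be applied to one initial arrow at a
time. -/
theorem IsWordChain.restrict {p : Fin N → Fin N → ℤˣ → ℝ} (hW : IsWordChain p P W) (x : Arr N) :
    IsWordChain p (P.restrict (W 0 ⁻¹' {x})) W where
  measurable := hW.measurable
  markov n w := by
    have hm : MeasurableSet (W 0 ⁻¹' {x}) := hW.measurable 0 (measurableSet_singleton x)
    rw [Measure.restrict_apply' hm, Measure.restrict_apply' hm]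
    by_cases hx : w 0 = x
    · have h : ∀ n, {ω | ∀ m ≤ n, W m ω = w m} ∩ W 0 ⁻¹' {x} = {ω | ∀ m ≤ n, W m ω = w m} :=
        fun n => Set.inter_eq_left.mpr fun ω hω => (hω 0 (Nat.zero_le _)).trans hx
      rw [h, h]
      exact hW.markov n w
    · have h : ∀ n, {ω | ∀ m ≤ n, W m ω = w m} ∩ W 0 ⁻¹' {x} = ∅ := by
        intro n
        ext ω
        simp only [Set.mem_inter_iff, Set.mem_ofPred_eq, Set.mem_preimage, Set.mem_singleton_iff,
          Set.mem_empty_iff_false, iff_false, not_and]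
        exact fun h1 h2 => hx ((h1 0 (Nat.zero_le _)).symm.trans h2)
      rw [h, h, measure_empty, zero_mul]

end Chain

end WindowWalk

end

noncomputable section

namespace WindowWalk

/-- `F θ`, `θ → 0`, is a family of eigenfunctions of `stepOp p`, with eigenvalues
`exp (γ θ + θ² g θ)`, which is uniformly close to `exp (θ M)`. -/
structure IsEigenfamily {N : ℕ} (p : Fin N → Fin N → ℤˣ → ℝ) (M : Arr N → ℝ) (γ : ℂ) (g : ℂ → ℂ)
    (F : ℂ → Arr N → ℂ) : Prop where
  continuousAt : ContinuousAt g 0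
  eigen : ∀ᶠ θ in 𝓝 0, ∀ x, stepOp p (F θ) x = Complex.exp (γ * θ + θ ^ 2 * g θ) * F θ x
  approx : ∀ δ : ℝ, 0 < δ → ∀ᶠ θ in 𝓝 0, ∀ x,
    ‖F θ x - Complex.exp (θ * (M x : ℂ))‖ ≤ δ * ‖Complex.exp (θ * (M x : ℂ))‖

theorem norm_exp_ofReal_mul_I_mul_ofReal (s t : ℝ) :
    ‖Complex.exp ((s : ℂ) * Complex.I * (t : ℂ))‖ = 1 := by
  rw [show (s : ℂ) * Complex.I * (t : ℂ) = ((s * t : ℝ) : ℂ) * Complex.I by push_cast; ring]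
  exact Complex.norm_exp_ofReal_mul_I _

theorem tendsto_ofReal_mul_I : Tendsto (fun s : ℝ => (s : ℂ) * Complex.I) (𝓝 0) (𝓝 0) := by
  have : Continuous fun s : ℝ => (s : ℂ) * Complex.I := by fun_prop
  simpa using this.tendsto 0

/-- The value at `y` of the characteristic variable `exp (i s (M y - γ n) / √n)`. -/
def normalizedExp {N : ℕ} (M : Arr N → ℝ) (γ s : ℝ) (n : ℕ) (y : Arr N) : ℂ :=
  Complex.exp (((s * ((M y - γ * n) / √(n : ℝ)) : ℝ) : ℂ) * Complex.I)

theorem norm_normalizedExp {N : ℕ} (M : Arr N → ℝ) (γ s : ℝ) (n : ℕ) (y : Arr N) :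
    ‖normalizedExp M γ s n y‖ = 1 := Complex.norm_exp_ofReal_mul_I _

/-! ### Consequences of a family of eigenfunctions. -/

section Eigenfamily

variable {N : ℕ} {p : Fin N → Fin N → ℤˣ → ℝ} {M : Arr N → ℝ} {g : ℂ → ℂ} {F : ℂ → Arr N → ℂ}

/-- For θ = is the function F_θ is bounded above and away from 0, and the operator does not increase
sup norms. So the powers of the eigenvalue stay bounded, its modulus is at most 1, and its exponent
has non-positive real part. -/
theorem IsEigenfamily.eventually_re_nonpos {γ : ℂ} (h : IsEigenfamily p M γ g F)
    (hp : IsJumpProb p) (x : Arr N) :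
    ∀ᶠ s : ℝ in 𝓝 0, 0 ≤ s * (γ.im + s * (g (s * Complex.I)).re) := by
  filter_upwards [tendsto_ofReal_mul_I.eventually h.eigen,
    tendsto_ofReal_mul_I.eventually (h.approx (1 / 2) (by norm_num))] with s h1 h2
  set θ : ℂ := (s : ℂ) * Complex.I with hθ
  set c := Complex.exp (γ * θ + θ ^ 2 * g θ) with hc
  have h2' : ∀ y, ‖F θ y - Complex.exp (θ * (M y : ℂ))‖ ≤ 1 / 2 := fun y => by
    have := h2 y
    rwa [hθ, norm_exp_ofReal_mul_I_mul_ofReal, mul_one] at this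
  have hup : ∀ y, ‖F θ y‖ ≤ 3 / 2 := fun y => by
    have h3 := norm_sub_norm_le (F θ y) (Complex.exp (θ * (M y : ℂ)))
    have h4 : ‖Complex.exp (θ * (M y : ℂ))‖ = 1 := norm_exp_ofReal_mul_I_mul_ofReal _ _
    linarith [h2' y]
  have hlo : 1 / 2 ≤ ‖F θ x‖ := by
    have h3 := norm_sub_norm_le (Complex.exp (θ * (M x : ℂ))) (F θ x)
    have h4 : ‖Complex.exp (θ * (M x : ℂ))‖ = 1 := norm_exp_ofReal_mul_I_mul_ofReal _ _
    rw [norm_sub_rev] at h3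
    linarith [h2' x]
  have hpow : ∀ n : ℕ, ‖c‖ ^ n ≤ 3 := fun n => by
    have h3 := norm_stepOp_iterate_le_const hp (f := fun y => 1 * F θ y)
      (by simpa using hup) n x
    rw [stepOp_iterate_eigen h1, one_mul, norm_mul, norm_pow] at h3
    nlinarith [pow_nonneg (norm_nonneg c) n]
  have hc1 : ‖c‖ ≤ 1 := by
    by_contra! hlt
    obtain ⟨n, hn⟩ := pow_unbounded_of_one_lt 3 hlt
    exact absurd (hpow n) (not_le.mpr hn)
  rw [hc, Complex.norm_exp, Real.exp_le_one_iff] at hc1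
  have hre : (γ * θ + θ ^ 2 * g θ).re = -(s * (γ.im + s * (g θ).re)) := by
    have hsq : θ ^ 2 = ((-(s ^ 2) : ℝ) : ℂ) := by
      rw [hθ, mul_pow, Complex.I_sq]; push_cast; ring
    rw [hsq, Complex.add_re, Complex.re_ofReal_mul, hθ]
    simp only [Complex.mul_re, Complex.mul_im, Complex.ofReal_re, Complex.ofReal_im, Complex.I_re,
      Complex.I_im]
    ring
  linarith

theorem IsEigenfamily.im_eq_zero {γ : ℂ} (h : IsEigenfamily p M γ g F) (hp : IsJumpProb p)
    (x : Arr N) : γ.im = 0 := by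
  have hlim : Tendsto (fun s : ℝ => γ.im + s * (g (s * Complex.I)).re) (𝓝 0) (𝓝 γ.im) := by
    have h1 : Tendsto (fun s : ℝ => (g (s * Complex.I)).re) (𝓝 0) (𝓝 (g 0).re) :=
      (Complex.continuous_re.tendsto _).comp (h.continuousAt.tendsto.comp tendsto_ofReal_mul_I)
    simpa using (tendsto_const_nhds (x := γ.im)).add (tendsto_id.mul h1)
  have hev := h.eventually_re_nonpos hp x
  -- The factor `s` may be divided out for either sign, and the two signs give the two inequalities.
  apply le_antisymm
  · refine le_of_tendsto (hlim.mono_left (nhdsWithin_le_nhds (s := Set.Iio 0))) ?_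
    filter_upwards [hev.filter_mono nhdsWithin_le_nhds, self_mem_nhdsWithin] with s h1 h2
    exact nonpos_of_mul_nonneg_right h1 h2
  · refine ge_of_tendsto (hlim.mono_left (nhdsWithin_le_nhds (s := Set.Ioi 0))) ?_
    filter_upwards [hev.filter_mono nhdsWithin_le_nhds, self_mem_nhdsWithin] with s h1 h2
    exact nonneg_of_mul_nonneg_right h1 h2

theorem IsEigenfamily.re_nonneg {γ : ℂ} (h : IsEigenfamily p M γ g F) (hp : IsJumpProb p)
    (x : Arr N) : 0 ≤ (g 0).re := by
  have h1 : Tendsto (fun s : ℝ => (g (s * Complex.I)).re) (𝓝 0) (𝓝 (g 0).re) :=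
    (Complex.continuous_re.tendsto _).comp (h.continuousAt.tendsto.comp tendsto_ofReal_mul_I)
  refine ge_of_tendsto (h1.mono_left (nhdsWithin_le_nhds (s := Set.Ioi 0))) ?_
  filter_upwards [(h.eventually_re_nonpos hp x).filter_mono nhdsWithin_le_nhds,
    self_mem_nhdsWithin] with s h1 h2
  rw [h.im_eq_zero hp x, zero_add] at h1
  exact nonneg_of_mul_nonneg_right (nonneg_of_mul_nonneg_right h1 h2) h2

/-- With θ = is/√n the exponential has modulus 1, so replacing it by F_θ costs an error that `n`
iterations do not enlarge. The centring cancels nγθ, and nθ² = -s². -/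
theorem IsEigenfamily.tendsto_stepOp_iterate {γ : ℝ} (h : IsEigenfamily p M γ g F)
    (hp : IsJumpProb p) (s : ℝ) (x : Arr N) :
    Tendsto (fun n : ℕ => (stepOp p)^[n] (normalizedExp M γ s n) x) atTop
      (𝓝 (Complex.exp (-(s ^ 2 * g 0)))) := by
  set t : ℕ → ℝ := fun n => s / √(n : ℝ) with ht
  set θ : ℕ → ℂ := fun n => (t n : ℂ) * Complex.I with hθ
  have ht0 : Tendsto t atTop (𝓝 0) :=
    (Real.tendsto_sqrt_atTop.comp tendsto_natCast_atTop_atTop).const_div_atTop s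
  have hθ0 : Tendsto θ atTop (𝓝 0) := tendsto_ofReal_mul_I.comp ht0
  set a : ℕ → ℂ := fun n => Complex.exp (θ n * ((-(γ * n) : ℝ) : ℂ)) with ha
  have hf : ∀ n y, normalizedExp M γ s n y = a n * Complex.exp (θ n * (M y : ℂ)) := fun n y => by
    rw [normalizedExp, ha, ← Complex.exp_add]
    congr 1
    simp only [hθ, ht]
    push_cast
    ring
  have hdiff : Tendsto (fun n : ℕ => (stepOp p)^[n] (normalizedExp M γ s n) x -
      (stepOp p)^[n] (fun y => a n * F (θ n) y) x) atTop (𝓝 0) := by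
    rw [Metric.tendsto_nhds]
    intro ε hε
    filter_upwards [hθ0.eventually (h.approx (ε / 2) (half_pos hε))] with n hn
    rw [dist_zero_right, ← stepOp_iterate_sub]
    refine (norm_stepOp_iterate_le_const hp (C := ε / 2) (fun y => ?_) n x).trans_lt
      (half_lt_self hε)
    rw [hf, ← mul_sub, norm_mul, ha, norm_exp_ofReal_mul_I_mul_ofReal, one_mul, norm_sub_rev]
    have := hn y
    rwa [norm_exp_ofReal_mul_I_mul_ofReal, mul_one] at this
  have hF : Tendsto (fun n => F (θ n) x) atTop (𝓝 1) := by
    have h1 : Tendsto (fun n => Complex.exp (θ n * (M x : ℂ))) atTop (𝓝 1) := by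
      have : Continuous fun w : ℂ => Complex.exp (w * (M x : ℂ)) := by fun_prop
      simpa [Function.comp_def] using (this.tendsto 0).comp hθ0
    have h2 : Tendsto (fun n => F (θ n) x - Complex.exp (θ n * (M x : ℂ))) atTop (𝓝 0) := by
      rw [Metric.tendsto_nhds]
      intro ε hε
      filter_upwards [hθ0.eventually (h.approx (ε / 2) (half_pos hε))] with n hn
      have := hn x
      rw [norm_exp_ofReal_mul_I_mul_ofReal, mul_one] at this
      rw [dist_zero_right]
      exact this.trans_lt (half_lt_self hε)
    simpa using h2.add h1
  have hmain : Tendsto (fun n : ℕ => (stepOp p)^[n] (fun y => a n * F (θ n) y) x) atTop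
      (𝓝 (Complex.exp (-(s ^ 2 * g 0)))) := by
    have hg : Tendsto (fun n => g (θ n)) atTop (𝓝 (g 0)) := h.continuousAt.tendsto.comp hθ0
    have h1 : Tendsto (fun n => Complex.exp (-(s ^ 2 * g (θ n))) * F (θ n) x) atTop
        (𝓝 (Complex.exp (-(s ^ 2 * g 0)) * 1)) :=
      ((Complex.continuous_exp.tendsto _).comp (hg.const_mul _).neg).mul hF
    rw [mul_one] at h1
    refine h1.congr' ?_
    filter_upwards [hθ0.eventually h.eigen, eventually_gt_atTop 0] with n hn hn0
    rw [stepOp_iterate_eigen hn, ha, ← Complex.exp_nat_mul, ← Complex.exp_add]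
    congr 2
    have hsq : (n : ℂ) * θ n ^ 2 = -(s : ℂ) ^ 2 := by
      have h3 : (n : ℝ) * t n ^ 2 = s ^ 2 := by
        have hn1 : (0 : ℝ) < n := by exact_mod_cast hn0
        simp only [ht, div_pow, Real.sq_sqrt hn1.le]
        field_simp
      have h4 : (n : ℂ) * (t n : ℂ) ^ 2 = (s : ℂ) ^ 2 := by exact_mod_cast h3
      simp only [hθ, mul_pow, Complex.I_sq]
      linear_combination -h4
    push_cast
    linear_combination -g (θ n) * hsq
  simpa using hdiff.add hmain

/-- The limits at `s` and `-s` are conjugate, yet the formula is even in `s`; so exp(-s² g(0)) is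
real. -/
theorem IsEigenfamily.im_apply_zero {γ : ℝ} (h : IsEigenfamily p M γ g F) (hp : IsJumpProb p)
    (x : Arr N) : (g 0).im = 0 := by
  set b := (g 0).im with hb
  have hb1 : 0 < 1 + |b| := by positivity
  -- Keeps `s² |b|` below 1 < π, where the sine vanishes only at 0.
  set s : ℝ := √(1 / (1 + |b|)) with hs
  have hs2 : s ^ 2 = 1 / (1 + |b|) := Real.sq_sqrt (by positivity)
  have h1 := h.tendsto_stepOp_iterate hp s x
  have h2 := h.tendsto_stepOp_iterate hp (-s) x
  have hconj : ∀ n : ℕ, (stepOp p)^[n] (normalizedExp M γ (-s) n) x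
      = (starRingEnd ℂ) ((stepOp p)^[n] (normalizedExp M γ s n) x) := fun n => by
    rw [← stepOp_iterate_conj]
    refine congrArg (fun f => (stepOp p)^[n] f x) (funext fun y => ?_)
    rw [normalizedExp, normalizedExp, ← Complex.exp_conj, map_mul, Complex.conj_ofReal,
      Complex.conj_I]
    congr 1
    push_cast
    ring
  have h3 := tendsto_nhds_unique (h2.congr hconj) ((Complex.continuous_conj.tendsto _).comp h1)
  rw [Complex.ofReal_neg, neg_sq] at h3
  have h4 : (Complex.exp (-(s ^ 2 * g 0))).im = 0 := Complex.conj_eq_iff_im.mp h3.symm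
  rw [Complex.exp_im, mul_eq_zero, or_iff_right (Real.exp_pos _).ne', ← Complex.ofReal_pow,
    Complex.neg_im, Complex.im_ofReal_mul, ← hb, Real.sin_neg, neg_eq_zero, hs2] at h4
  have h5 : |1 / (1 + |b|) * b| < 1 := by
    rw [abs_mul, abs_of_pos (by positivity), one_div, inv_mul_lt_iff₀ hb1]
    linarith
  have h6 := Real.pi_gt_three
  rw [abs_lt] at h5
  rw [Real.sin_eq_zero_iff_of_lt_of_lt (by linarith) (by linarith)] at h4
  rcases mul_eq_zero.mp h4 with h7 | h7
  · exact absurd h7 (by positivity)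
  · exact h7

/-- Exponential decay of the probability of a deviation of order `n` in the direction `e = ±1`. -/
theorem IsEigenfamily.exists_norm_stepOp_iterate_indicator_le {γ : ℝ}
    (h : IsEigenfamily p M γ g F) (hp : IsJumpProb p) (x : Arr N) (e : ℝ) {δ : ℝ} (hδ : 0 < δ) :
    ∃ C r : ℝ, 0 ≤ r ∧ r < 1 ∧ ∀ n : ℕ, ‖(stepOp p)^[n]
      (Set.indicator {y | δ * n ≤ e * (M y - γ * n)} fun _ => (1 : ℂ)) x‖ ≤ C * r ^ n := by
  have hlim : Tendsto (fun τ : ℝ => ((e * τ : ℝ) : ℂ)) (𝓝 0) (𝓝 0) := by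
    have : Continuous fun τ : ℝ => ((e * τ : ℝ) : ℂ) := by fun_prop
    simpa using this.tendsto 0
  -- With θ = eτ the decay exponent is τ(e²τ Re g(θ) - δ), negative for small τ > 0.
  have hg : ∀ᶠ τ : ℝ in 𝓝 0, e ^ 2 * τ * (g ((e * τ : ℝ) : ℂ)).re < δ := by
    have h1 : Tendsto (fun τ : ℝ => (g ((e * τ : ℝ) : ℂ)).re) (𝓝 0) (𝓝 (g 0).re) :=
      (Complex.continuous_re.tendsto _).comp (h.continuousAt.tendsto.comp hlim)
    have h2 := (tendsto_id.const_mul (e ^ 2)).mul h1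
    simp only [mul_zero, zero_mul, id] at h2
    exact h2.eventually_lt_const hδ
  obtain ⟨τ, ⟨h1, h2, h3⟩, hτ⟩ := (((hlim.eventually h.eigen).and
    ((hlim.eventually (h.approx (1 / 2) (by norm_num))).and hg)).filter_mono
      (nhdsWithin_le_nhds (s := Set.Ioi 0)) |>.and self_mem_nhdsWithin).exists
  replace hτ : 0 < τ := hτ
  set θ : ℝ := e * τ with hθ
  refine ⟨2 * ‖F θ x‖, Real.exp (θ ^ 2 * (g θ).re - τ * δ), (Real.exp_pos _).le, ?_, fun n => ?_⟩
  · rw [Real.exp_lt_one_iff]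
    rw [hθ]
    nlinarith
  set a : ℝ := 2 * Real.exp (-(θ * γ * n) - τ * δ * n) with ha
  have ha0 : 0 < a := by positivity
  -- Chernoff's inequality: the indicator is at most exp(τ(e(M - γn) - δn)), and closeness with
  -- relative error 1/2 gives exp(θM) ≤ 2 Re F_θ.
  have hle : ∀ y, ‖Set.indicator {y | δ * n ≤ e * (M y - γ * n)} (fun _ => (1 : ℂ)) y‖
      ≤ ((a : ℂ) * F θ y).re := fun y => by
    have h4 := h2 y
    rw [← Complex.ofReal_mul, ← Complex.ofReal_exp, Complex.norm_real,
      Real.norm_of_nonneg (Real.exp_pos _).le] at h4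
    have h5 := (abs_le.mp ((Complex.abs_re_le_norm _).trans h4)).1
    rw [Complex.sub_re, Complex.ofReal_re] at h5
    have h6 : Real.exp (θ * M y) ≤ 2 * (F θ y).re := by linarith
    rw [Complex.re_ofReal_mul]
    have h7 : Real.exp (-(θ * γ * n) - τ * δ * n) * Real.exp (θ * M y) ≤ a * (F θ y).re := by
      rw [ha]
      nlinarith [Real.exp_pos (-(θ * γ * n) - τ * δ * n)]
    refine le_trans ?_ h7
    rw [← Real.exp_add]
    by_cases hy : y ∈ {y | δ * n ≤ e * (M y - γ * n)}
    · rw [Set.indicator_of_mem hy, norm_one]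
      apply Real.one_le_exp
      have h8 : τ * (δ * n) ≤ τ * (e * (M y - γ * n)) := mul_le_mul_of_nonneg_left hy hτ.le
      rw [hθ]
      linarith
    · rw [Set.indicator_of_notMem hy, norm_zero]
      exact (Real.exp_pos _).le
  refine (norm_stepOp_iterate_le hp hle n x).trans ((Complex.re_le_norm _).trans_eq ?_)
  rw [stepOp_iterate_eigen h1, norm_mul, norm_mul, Complex.norm_real, Real.norm_of_nonneg ha0.le,
    norm_pow, Complex.norm_exp, ← Real.exp_nat_mul, ← Real.exp_nat_mul, ha]
  have h9 : ((γ : ℂ) * (θ : ℂ) + (θ : ℂ) ^ 2 * g θ).re = γ * θ + θ ^ 2 * (g θ).re := by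
    rw [← Complex.ofReal_pow, ← Complex.ofReal_mul, Complex.add_re, Complex.re_ofReal_mul,
      Complex.ofReal_re]
  rw [h9, mul_assoc 2, ← Real.exp_add, mul_right_comm]
  congr 3
  ring

end Eigenfamily

/-! ### The law of large numbers and the central limit theorem. -/

section LimitTheorems

variable {N : ℕ} {p : Fin N → Fin N → ℤˣ → ℝ} {M : Arr N → ℝ} {g : ℂ → ℂ} {F : ℂ → Arr N → ℂ}
  {γ : ℝ} {Ω : Type*} [MeasurableSpace Ω] {P : Measure Ω} [IsProbabilityMeasure P]
  {W : ℕ → Ω → Arr N}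

/-- Borel–Cantelli with the exponential bound, applied separately to each of the countably many
initial arrows. -/
theorem IsEigenfamily.ae_eventually_lt (h : IsEigenfamily p M γ g F) (hp : IsJumpProb p)
    (hW : IsWordChain p P W) (e : ℝ) {δ : ℝ} (hδ : 0 < δ) :
    ∀ᵐ ω ∂P, ∀ᶠ n : ℕ in atTop, e * (M (W n ω) - γ * n) < δ * n := by
  have key : ∀ x : Arr N, ∀ᵐ ω ∂P, W 0 ω = x →
      ∀ᶠ n : ℕ in atTop, e * (M (W n ω) - γ * n) < δ * n := by
    intro x
    have hm : MeasurableSet (W 0 ⁻¹' {x}) := hW.measurable 0 (measurableSet_singleton x)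
    obtain ⟨C, r, hr0, hr1, hC⟩ := h.exists_norm_stepOp_iterate_indicator_le hp x e hδ
    set S : ℕ → Set (Arr N) := fun n => {y | δ * n ≤ e * (M y - γ * n)} with hS
    set P' := P.restrict (W 0 ⁻¹' {x}) with hP'
    have hbound : ∀ n, P' (W n ⁻¹' S n) ≤ ENNReal.ofReal (C * r ^ n) := by
      intro n
      have hint := (hW.restrict x).integral_eq hp (f := (S n).indicator fun _ => (1 : ℂ)) (C := 1)
        (fun y => (norm_indicator_le_norm_self _ _).trans (by simp)) n
      have hl : ∫ ω, (S n).indicator (fun _ => (1 : ℂ)) (W n ω) ∂P' = (P'.real (W n ⁻¹' S n) : ℂ) := by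
        have : (fun ω => (S n).indicator (fun _ => (1 : ℂ)) (W n ω))
            = (W n ⁻¹' S n).indicator fun _ => (1 : ℂ) := rfl
        rw [this, integral_indicator_const _ (hW.measurable n (MeasurableSet.of_discrete)),
          Complex.real_smul, mul_one]
      have hnorm := congrArg norm hint
      rw [hl, Complex.norm_real, Real.norm_of_nonneg measureReal_nonneg] at hnorm
      have hle : P'.real (W n ⁻¹' S n) ≤ C * r ^ n := by
        rw [hnorm]
        have h0 : 0 ≤ C * r ^ n := (norm_nonneg _).trans (hC n)
        refine (norm_integral_le_of_norm_le_const (C := C * r ^ n) ?_).trans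
          (mul_le_of_le_one_right h0 ?_)
        · filter_upwards [ae_restrict_mem hm] with ω hω
          rw [show W 0 ω = x from hω]
          exact hC n
        · rw [measureReal_restrict_apply MeasurableSet.univ]
          exact measureReal_le_one
      rw [← ENNReal.ofReal_toReal (measure_ne_top P' _)]
      exact ENNReal.ofReal_le_ofReal hle
    have hsum : ∑' n, P' (W n ⁻¹' S n) ≠ ∞ :=
      ne_top_of_le_ne_top ((summable_geometric_of_lt_one hr0 hr1).mul_left C).tsum_ofReal_ne_top
        (ENNReal.tsum_le_tsum hbound)
    have hBC := ae_eventually_notMem hsum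
    rw [hP', ae_restrict_iff' hm] at hBC
    filter_upwards [hBC] with ω h1 h2
    filter_upwards [h1 h2] with n hn
    exact not_le.mp hn
  filter_upwards [ae_all_iff.mpr key] with ω hω
  exact hω _ rfl

theorem IsEigenfamily.ae_tendsto (h : IsEigenfamily p M γ g F) (hp : IsJumpProb p)
    (hW : IsWordChain p P W) :
    ∀ᵐ ω ∂P, Tendsto (fun n : ℕ => M (W n ω) / n) atTop (𝓝 γ) := by
  have h1 := fun m : ℕ => h.ae_eventually_lt hp hW 1 (Nat.one_div_pos_of_nat (n := m) (α := ℝ))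
  have h2 := fun m : ℕ => h.ae_eventually_lt hp hW (-1) (Nat.one_div_pos_of_nat (n := m) (α := ℝ))
  filter_upwards [ae_all_iff.mpr h1, ae_all_iff.mpr h2] with ω h1 h2
  rw [Metric.tendsto_nhds]
  intro ε hε
  obtain ⟨m, hm⟩ := exists_nat_one_div_lt hε
  filter_upwards [h1 m, h2 m, eventually_gt_atTop 0] with n h3 h4 hn
  have hn1 : (0 : ℝ) < n := by exact_mod_cast hn
  have h5 := mul_lt_mul_of_pos_right hm hn1
  rw [Real.dist_eq, div_sub' hn1.ne', abs_div, abs_of_pos hn1, div_lt_iff₀ hn1, abs_lt]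
  constructor <;> linarith

/-- Lévy's continuity theorem. The characteristic function converges for each initial arrow, and
dominated convergence covers a random one. -/
theorem IsEigenfamily.tendstoInDistribution (h : IsEigenfamily p M γ g F) (hp : IsJumpProb p)
    {v : ℝ≥0} (hv : g 0 = ((v : ℝ) : ℂ) / 2) (hW : IsWordChain p P W) :
    TendstoInDistribution (fun (n : ℕ) ω => (M (W n ω) - γ * n) / √(n : ℝ)) atTop
      (id : ℝ → ℝ) (fun _ => P) (gaussianReal 0 v) := by
  have hmeas : ∀ n : ℕ, Measurable fun ω => (M (W n ω) - γ * n) / √(n : ℝ) := fun n =>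
    (measurable_of_countable fun y : Arr N => (M y - γ * n) / √(n : ℝ)).comp (hW.measurable n)
  refine ⟨fun n => (hmeas n).aemeasurable, aemeasurable_id, ?_⟩
  refine ProbabilityMeasure.tendsto_iff_tendsto_charFun.2 fun s => ?_
  have hlim : charFun ((gaussianReal 0 v).map id) s = Complex.exp (-(s ^ 2 * g 0)) := by
    rw [Measure.map_id, charFun_gaussianReal, hv]
    congr 1
    push_cast
    ring
  have hn : ∀ n : ℕ, charFun (P.map fun ω => (M (W n ω) - γ * n) / √(n : ℝ)) s
      = ∫ ω, (stepOp p)^[n] (normalizedExp M γ s n) (W 0 ω) ∂P := fun n => by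
    rw [charFun_apply_real, integral_map (hmeas n).aemeasurable (by fun_prop),
      ← hW.integral_eq hp fun y => (norm_normalizedExp M γ s n y).le]
    simp only [normalizedExp, Complex.ofReal_mul]
  simp only [ProbabilityMeasure.coe_mk, hn, hlim]
  have hdom := tendsto_integral_of_dominated_convergence (μ := P)
    (F := fun (n : ℕ) ω => (stepOp p)^[n] (normalizedExp M γ s n) (W 0 ω))
    (f := fun _ => Complex.exp (-(s ^ 2 * g 0))) (fun _ => (1 : ℝ))
    (fun n => ((measurable_of_countable _).comp (hW.measurable 0)).aestronglyMeasurable)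
    (integrable_const _)
    (fun n => Eventually.of_forall fun ω => norm_stepOp_iterate_le_const hp
      (fun y => (norm_normalizedExp M γ s n y).le) n (W 0 ω))
    (Eventually.of_forall fun ω => h.tendsto_stepOp_iterate hp s (W 0 ω))
  simpa using hdom

end LimitTheorems

end WindowWalk

end

theorem theorem3p1 {N : ℕ} (hN : 3 ≤ N)
    (p : Fin N → Fin N → ℤˣ → ℝ) (hp : WindowWalk.IsJumpProb p)
    (M : WindowWalk.Arr N → ℝ) (hM : WindowWalk.IsGeneratedMetric M) :
    -- the functions `R` exist
    (∃ ε : ℝ, 0 < ε ∧ ∃ R : Fin N → Fin N → ℤˣ → ℂ → ℂ, WindowWalk.IsRFamily p ε R) ∧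
    ∀ ε : ℝ, 0 < ε → ∀ R : Fin N → Fin N → ℤˣ → ℂ → ℂ, WindowWalk.IsRFamily p ε R →
      -- they are unique
      (∀ R' : Fin N → Fin N → ℤˣ → ℂ → ℂ, WindowWalk.IsRFamily p ε R' →
        ∀ i j k, i ≠ j → Set.EqOn (R' i j k) (R i j k) (Metric.ball 0 (1 + ε))) ∧
      -- the constants are well defined and real, `σ²` is non-negative, and the limit theorems hold
      WindowWalk.d1 (WindowWalk.hFun M R) ≠ 0 ∧
      ∃ (γ : ℝ) (σsq : ℝ≥0),
        (γ : ℂ) = WindowWalk.gammaOf (WindowWalk.hFun M R) ∧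
        ((σsq : ℝ) : ℂ) = WindowWalk.sigmaSqOf (WindowWalk.hFun M R) ∧
        ∀ (Ω : Type*) [MeasurableSpace Ω] (P : Measure Ω) [IsProbabilityMeasure P]
          (W : ℕ → Ω → WindowWalk.Arr N), WindowWalk.IsWordChain p P W →
          (∀ᵐ ω ∂P, Tendsto (fun n : ℕ => M (W n ω) / n) atTop (𝓝 γ)) ∧
          TendstoInDistribution (fun (n : ℕ) ω => (M (W n ω) - γ * n) / √(n : ℝ)) atTop
            (id : ℝ → ℝ) (fun _ => P) (gaussianReal 0 σsq) := by
  obtain ⟨ε₀, hε₀, R₀, hR₀, -⟩ := WindowWalk.exists_isRFamily hN hp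
  refine ⟨⟨ε₀, hε₀, R₀, hR₀⟩, fun ε hε R hR => ⟨fun R' hR' i j k hij =>
    WindowWalk.IsRFamily.eqOn hp hε hR hR' i j k hij,
    (WindowWalk.hFun_one_one hN hp M hε hR).2.1, ?_⟩⟩
  obtain ⟨ψ, hψ, hψ0, hγ, hσ, F, hF, hFM⟩ := WindowWalk.exists_eigenfunctions hN hp hM hε hR
  obtain ⟨g, hg, hg0, hψg⟩ := WindowWalk.exists_eq_add_sq_mul hψ hψ0
  rw [hσ] at hg0
  rw [hγ] at hψg
  have hE : WindowWalk.IsEigenfamily p M (WindowWalk.gammaOf (WindowWalk.hFun M R)) g F :=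
    ⟨hg, by simpa only [hψg] using hF, hFM⟩
  -- The reality statements are proved by following the operator at one arrow; any arrow serves.
  set x : WindowWalk.Arr N := WindowWalk.unit ⟨0, by omega⟩
  have hγr : ((WindowWalk.gammaOf (WindowWalk.hFun M R)).re : ℂ)
      = WindowWalk.gammaOf (WindowWalk.hFun M R) :=
    Complex.conj_eq_iff_re.mp (Complex.conj_eq_iff_im.mpr (hE.im_eq_zero hp x))
  rw [← hγr] at hE
  have hgr : ((g 0).re : ℂ) = g 0 :=
    Complex.conj_eq_iff_re.mp (Complex.conj_eq_iff_im.mpr (hE.im_apply_zero hp x))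
  -- g(0) is ψ''(0)/2 = σ²/2, so the variance is 2 Re g(0), which is non-negative and loses nothing
  -- in `toNNReal`.
  have hv : g 0 = (((2 * (g 0).re).toNNReal : ℝ) : ℂ) / 2 := by
    rw [Real.coe_toNNReal _ (mul_nonneg zero_le_two (hE.re_nonneg hp x)), Complex.ofReal_mul, hgr]
    push_cast
    ring
  refine ⟨_, _, hγr, ?_, fun Ω _ P _ W hW =>
    ⟨hE.ae_tendsto hp hW, hE.tendstoInDistribution hp hv hW⟩⟩
  linear_combination 2 * hg0 - 2 * hv
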